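/- Let $0<q<1$ and write $(x;q)_\infty=\prod_{k\ge0}(1-xq^k)$, $(x_1,\dots,x_m;q)_\infty=\prod_{i}(x_i;q)_\infty$, $(x;q)_k=\prod_{j=0}^{k-1}(1-xq^j)$, and $${}_3\phi_2\left[\begin{matrix}a_1,a_2,a_3\\ b_1,b_2\end{matrix};q,z\right]=\sum_{k\ge0}\frac{(a_1;q)_k(a_2;q)_k(a_3;q)_k}{(q;q)_k(b_1;q)_k(b_2;q)_k}z^k .$$ Let $a,b,c,d,e,f,g\in\mathbb C$ satisfy $$\max\{|q^f|,|q^g|,|q^{c+f}|,|q^{c+g}|,|q^{d+f}|,|q^{d+g}|,|q^{c+d+f+g}|\}<1,$$ $c-d\notin\mathbb Z$, and $q^{c+e+g+n}\ne1$, $q^{a+b+c+d+n}\neq 1$ for all integers $n\ge0$. Let the contour of integration be a continuous, piecewise continuously differentiable curve (with bounded derivative) from $-i\infty$ to $i\infty$, running upwards along vertical lines near its two ends, such that the increasing sequences of poles $c+n$, $d+n$ ($n=0,1,2,\dots$) lie to its right and the decreasing sequences of poles, that is, the solutions $s$ of $q^{x+s+n}=1$ with $x\in\{a,b,f,g\}$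 and $n=0,1,2,\dots$, lie to its left. (A point $p$ off the contour lies to the left, respectively to the right, if the argument of $s-p$ changes in total by $+\pi$, respectively $-\pi$, as $s$ runs along the contour.) Then the following integral converges absolutely, and $$\frac1{2\pi i}\int_{-i\infty}^{i\infty}\frac{(q^{1-c+s},q^{1-d+s},q^{a+b+c+d+f+s},q^{e+g+s};q)_\infty}{(q^{a+s},q^{b+s},q^{f+s},q^{g+s};q)_\infty}\,\frac{\pi q^s}{\sin\pi(c-s)\,\sin\pi(d-s)}\;{}_3\phi_2\left[\begin{matrix}q^e,q^{a+s},q^{b+s}\\ q^{e+g+s},q^{a+b+c+d+f+s}\end{matrix};q,q^{c+d+f+g}\right]ds$$ $$=\frac{q^c}{\sin\pi(d-c)}\,\frac{(q,q^{1+c-d},q^{d-c},q^{a+b+c+d},q^{a+c+d+f},q^{b+c+d+f},q^{c+e+g};q)_\infty}{(q^{a+c},q^{a+d},q^{b+c},q^{b+d},q^{c+f},q^{c+g},q^{d+f};q)_\infty}\;{}_3\phi_2\left[\begin{matrix}q^e,q^{a+c},q^{b+c}\\ q^{c+e+g},q^{a+b+c+d}\end{matrix};q,q^{d+g}\right].$$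 -/

import Mathlib

noncomputable section

/-- The infinite `q`-shifted factorial `(x; q)_∞ = ∏_{k ≥ 0} (1 - x q^k)`. -/
def qPochInf (q x : ℂ) : ℂ := ∏' k : ℕ, (1 - x * q ^ k)

/-- The finite `q`-shifted factorial `(x; q)_n = ∏_{0 ≤ k < n} (1 - x q^k)`. -/
def qPoch (q x : ℂ) (n : ℕ) : ℂ := ∏ k ∈ Finset.range n, (1 - x * q ^ k)

/-- The basic hypergeometric series `₃φ₂[a₁, a₂, a₃; b₁, b₂; q, z]`.  For `r = 3`, `s = 2` the
factor `[(-1)^k q^(k choose 2)]^(1+s-r)` of the general series is `1`. -/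
def phi32 (q a₁ a₂ a₃ b₁ b₂ z : ℂ) : ℂ :=
  ∑' k : ℕ, qPoch q a₁ k * qPoch q a₂ k * qPoch q a₃ k /
    (qPoch q q k * qPoch q b₁ k * qPoch q b₂ k) * z ^ k

/-- A contour from `-i∞` to `i∞`: a curve that is continuous and piecewise continuously
differentiable (with bounded derivative), and that runs upwards along a vertical line near each
of its two ends. -/
structure IsBarnesContour (γ : ℝ → ℂ) : Prop where
  lipschitz : ∃ K : NNReal, LipschitzWith K γ
  piecewise_contDiff : ∃ S : Finset ℝ, ∀ t ∉ S, ContDiffAt ℝ 1 γ t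
  eventually_atBot : ∃ σ : ℝ, ∀ᶠ t : ℝ in Filter.atBot, γ t = (σ : ℂ) + (t : ℂ) * Complex.I
  eventually_atTop : ∃ σ : ℝ, ∀ᶠ t : ℝ in Filter.atTop, γ t = (σ : ℂ) + (t : ℂ) * Complex.I

/-- The point `p` lies to the left of the contour `γ`: it is not on `γ`, and the argument of
`γ t - p` increases by `π` in total along `γ`. -/
def LiesLeftOf (γ : ℝ → ℂ) (p : ℂ) : Prop :=
  p ∉ Set.range γ ∧
    Filter.Tendsto (fun T : ℝ => ∫ t in (-T)..T, deriv γ t / (γ t - p)) Filter.atTop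
      (nhds ((Real.pi : ℂ) * Complex.I))

/-- The point `p` lies to the right of the contour `γ`: it is not on `γ`, and the argument of
`γ t - p` decreases by `π` in total along `γ`. -/
def LiesRightOf (γ : ℝ → ℂ) (p : ℂ) : Prop :=
  p ∉ Set.range γ ∧
    Filter.Tendsto (fun T : ℝ => ∫ t in (-T)..T, deriv γ t / (γ t - p)) Filter.atTop
      (nhds (-((Real.pi : ℂ) * Complex.I)))

/-- The decreasing sequences of poles belonging to `1 / (q^(x+s); q)_∞`: the solutions `s` of
`q^(x+s+n) = 1`, `n = 0, 1, 2, …`. -/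
def decreasingPoles (q : ℝ) (x : ℂ) : Set ℂ :=
  {s | ∃ (n : ℕ) (m : ℤ),
    s = -x - (n : ℂ) + 2 * (Real.pi : ℂ) * Complex.I * (m : ℂ) / ((Real.log q : ℝ) : ℂ)}

/-- The increasing sequence of poles `x, x + 1, x + 2, …`, which belongs to
`(q^(1-x+s); q)_∞ / sin (π (x - s))`; the zeros of the sine at `x - 1, x - 2, …` are cancelled by
zeros of the numerator. -/
def increasingPoles (x : ℂ) : Set ℂ := {s | ∃ n : ℕ, s = x + (n : ℂ)}

/-- The integrand, as a function of `s`. -/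
def barnesIntegrand (q : ℝ) (a b c d e f g s : ℂ) : ℂ :=
  (qPochInf q ((q : ℂ) ^ (1 - c + s)) * qPochInf q ((q : ℂ) ^ (1 - d + s)) *
      qPochInf q ((q : ℂ) ^ (a + b + c + d + f + s)) * qPochInf q ((q : ℂ) ^ (e + g + s))) /
    (qPochInf q ((q : ℂ) ^ (a + s)) * qPochInf q ((q : ℂ) ^ (b + s)) *
      qPochInf q ((q : ℂ) ^ (f + s)) * qPochInf q ((q : ℂ) ^ (g + s))) *
    ((Real.pi : ℂ) * (q : ℂ) ^ s /
      (Complex.sin (Real.pi * (c - s)) * Complex.sin (Real.pi * (d - s)))) *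
    phi32 q ((q : ℂ) ^ e) ((q : ℂ) ^ (a + s)) ((q : ℂ) ^ (b + s))
      ((q : ℂ) ^ (e + g + s)) ((q : ℂ) ^ (a + b + c + d + f + s)) ((q : ℂ) ^ (c + d + f + g))

end

/-! ### q-shifted factorials and the terminating q-Saalschütz sum -/

section QPochhammer

open Filter Topology Finset

variable {q : ℂ}

/-! Put `x = q ^ s` and `A = q ^ a`, `B = q ^ b`, and so on. Apart from the factor `π q ^ s / (sin
π(c - s) sin π(d - s))` the integrand is a function `barnesCore` of `x` alone. Push the contour to
the right, to lines `Re s = θ + N`. The core stays bounded, the reciprocal sines are integrable and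
`q ^ s` tends to 0, so the integral is minus `2πi` times the sum of the residues at `c + n` and `d +
n`. These residues are values `x * barnesCore x` at `x = C q ^ n` and `x = D q ^ n`, up to the
constant `∓1 / sin π(d - c)`. The contour integral is therefore a difference of two Jackson sums
(`integral_barnesReg`).

The rest is algebra (`jacksonSum_barnesCore_sub`). A two-term transformation
(`tsum_phi32_transformation`) with `y = C D F / x` and `u = G x` frees the parameters of the series
from `x`, and only moments of a q-Saalschütz kernel remain. By q-Chu-Vandermonde a moment of order
`k` is a sum over `p.1 + p.2 = k` of kernels with `C` and `F` shifted by powers of `q`. The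
nonterminating q-Saalschütz formula (`saalIntegral_eq`) evaluates each of them as a product. Summed
over `k` this is a double series; one of its sums is a q-Gauss sum (`tsum_gauss`), and the other is
the series on the right-hand side.

The curve is arbitrary and its sides are defined by the total change of argument, so the residue
theorem is proved for any functional with the formal properties of integration over a cycle
(`IsCycleFunctional.eq_sum_residues`), and winding numbers are computed from rotated branches of the
logarithm. The decreasing poles recur at all heights with period `2πi / log q`. Lying to the left of
the contour, they must have real part below that of both vertical ends (`re_decreasingPole_lt`).
Hence they have winding number zero, and the core is bounded in the half-plane to the right. -/

@[simp] theorem qPoch_zero (q x : ℂ) : qPoch q x 0 = 1 := by simp [qPoch]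

theorem qPoch_succ (q x : ℂ) (n : ℕ) : qPoch q x (n + 1) = qPoch q x n * (1 - x * q ^ n) := by
  simp [qPoch, Finset.prod_range_succ]

theorem qPoch_add (q x : ℂ) (m n : ℕ) :
    qPoch q x (m + n) = qPoch q x m * qPoch q (x * q ^ m) n := by
  simp only [qPoch, Finset.prod_range_add, pow_add, mul_assoc]

theorem qPoch_succ' (q x : ℂ) (n : ℕ) : qPoch q x (n + 1) = (1 - x) * qPoch q (x * q) n := by
  rw [add_comm, qPoch_add]; simp [qPoch]

@[simp] theorem qPoch_zero_left (q : ℂ) (n : ℕ) : qPoch q 0 n = 1 := by simp [qPoch]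

theorem qPoch_one_succ (q : ℂ) (n : ℕ) : qPoch q 1 (n + 1) = 0 := by simp [qPoch_succ']

theorem continuous_qPoch (q : ℂ) (n : ℕ) : Continuous fun x => qPoch q x n := by
  unfold qPoch; fun_prop

theorem differentiable_qPoch (q : ℂ) (n : ℕ) : Differentiable ℂ fun x => qPoch q x n := by
  unfold qPoch; fun_prop

theorem qPoch_ne_zero {x : ℂ} (h : ∀ n : ℕ, x * q ^ n ≠ 1) (n : ℕ) : qPoch q x n ≠ 0 := by
  rw [qPoch, Finset.prod_ne_zero_iff]
  exact fun k _ => sub_ne_zero.2 (h k).symm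

theorem mul_pow_ne_one_of_norm_lt {x : ℂ} (hq : ‖q‖ < 1) (hx : ‖x‖ < 1) (n : ℕ) :
    x * q ^ n ≠ 1 := by
  intro h
  have h1 : ‖x * q ^ n‖ < 1 := by
    rw [norm_mul, norm_pow]
    exact (mul_le_of_le_one_right (norm_nonneg _) (pow_le_one₀ (norm_nonneg _) hq.le)).trans_lt hx
  rw [h] at h1
  simp at h1

theorem qPoch_self_ne_zero (hq : ‖q‖ < 1) (n : ℕ) : qPoch q q n ≠ 0 :=
  qPoch_ne_zero (mul_pow_ne_one_of_norm_lt hq hq) n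

theorem summable_norm_mul_pow (hq : ‖q‖ < 1) (x : ℂ) : Summable fun k : ℕ => ‖-(x * q ^ k)‖ := by
  simp only [norm_neg, norm_mul, norm_pow]
  exact (summable_geometric_of_lt_one (norm_nonneg _) hq).mul_left _

theorem multipliable_qPochInf (hq : ‖q‖ < 1) (x : ℂ) :
    Multipliable fun k : ℕ => 1 - x * q ^ k := by
  simpa [sub_eq_add_neg] using multipliable_one_add_of_summable (summable_norm_mul_pow hq x)

theorem tendsto_qPoch (hq : ‖q‖ < 1) (x : ℂ) :
    Tendsto (qPoch q x) atTop (𝓝 (qPochInf q x)) :=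
  (multipliable_qPochInf hq x).hasProd.tendsto_prod_nat

theorem qPochInf_eq (hq : ‖q‖ < 1) (x : ℂ) (n : ℕ) :
    qPochInf q x = qPoch q x n * qPochInf q (x * q ^ n) := by
  have h1 : Tendsto (fun m => qPoch q x (n + m)) atTop (𝓝 (qPochInf q x)) := by
    simpa only [add_comm] using (tendsto_add_atTop_iff_nat n).2 (tendsto_qPoch hq x)
  simp only [qPoch_add] at h1
  exact tendsto_nhds_unique h1 ((tendsto_qPoch hq _).const_mul _)

theorem qPochInf_succ (hq : ‖q‖ < 1) (x : ℂ) :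
    qPochInf q x = (1 - x) * qPochInf q (x * q) := by
  simpa [qPoch] using qPochInf_eq hq x 1

theorem qPochInf_ne_zero (hq : ‖q‖ < 1) {x : ℂ} (h : ∀ n : ℕ, x * q ^ n ≠ 1) :
    qPochInf q x ≠ 0 := by
  have := tprod_one_add_ne_zero_of_summable (f := fun k : ℕ => -(x * q ^ k))
    (fun k => by simpa [← sub_eq_add_neg, sub_eq_zero] using (h k).symm)
    (summable_norm_mul_pow hq x)
  simpa [qPochInf, sub_eq_add_neg] using this

theorem qPochInf_eq_zero (hq : ‖q‖ < 1) {x : ℂ} {n : ℕ} (h : x * q ^ n = 1) :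
    qPochInf q x = 0 := by
  rw [qPochInf_eq hq x (n + 1), qPoch_succ, h]; simp

theorem qPochInf_ne_zero_of_norm_lt (hq : ‖q‖ < 1) {x : ℂ} (hx : ‖x‖ < 1) : qPochInf q x ≠ 0 :=
  qPochInf_ne_zero hq (mul_pow_ne_one_of_norm_lt hq hx)

@[simp] theorem qPochInf_zero (q : ℂ) : qPochInf q 0 = 1 := by simp [qPochInf]

theorem qPochInf_one (hq : ‖q‖ < 1) : qPochInf q 1 = 0 :=
  qPochInf_eq_zero hq (n := 0) (by simp)

/-- Each factor is at most `exp (r * ‖q‖ ^ k)`, and the exponents form a geometric series. The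
uniformity in `n` underlies the summability arguments below. -/
theorem norm_qPoch_le (hq : ‖q‖ < 1) {x : ℂ} {r : ℝ} (hx : ‖x‖ ≤ r) (n : ℕ) :
    ‖qPoch q x n‖ ≤ Real.exp (r / (1 - ‖q‖)) := by
  have hr : 0 ≤ r := (norm_nonneg _).trans hx
  calc ‖qPoch q x n‖ ≤ ∏ k ∈ range n, Real.exp (r * ‖q‖ ^ k) := by
        rw [qPoch, norm_prod]
        refine Finset.prod_le_prod (fun _ _ => norm_nonneg _) fun k _ => ?_
        calc ‖1 - x * q ^ k‖ ≤ 1 + ‖x‖ * ‖q‖ ^ k := by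
              simpa using norm_sub_le 1 (x * q ^ k)
          _ ≤ r * ‖q‖ ^ k + 1 := by rw [add_comm]; gcongr
          _ ≤ _ := Real.add_one_le_exp _
    _ = Real.exp (r * ∑ k ∈ range n, ‖q‖ ^ k) := by rw [← Real.exp_sum, Finset.mul_sum]
    _ ≤ _ := by
        rw [div_eq_mul_inv]
        gcongr
        rw [← tsum_geometric_of_lt_one (norm_nonneg _) hq]
        exact (summable_geometric_of_lt_one (norm_nonneg _) hq).sum_le_tsum _
          fun _ _ => by positivity

theorem norm_qPochInf_le (hq : ‖q‖ < 1) {x : ℂ} {r : ℝ} (hx : ‖x‖ ≤ r) :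
    ‖qPochInf q x‖ ≤ Real.exp (r / (1 - ‖q‖)) :=
  le_of_tendsto (tendsto_qPoch hq x).norm (Eventually.of_forall (norm_qPoch_le hq hx))

theorem norm_mul_pow_le (hq : ‖q‖ < 1) {x : ℂ} {r : ℝ} (hx : ‖x‖ ≤ r) (n : ℕ) :
    ‖x * q ^ n‖ ≤ r := by
  rw [norm_mul, norm_pow]
  exact (mul_le_of_le_one_right (norm_nonneg _) (pow_le_one₀ (norm_nonneg _) hq.le)).trans hx

/-- `1 / (q; q)_n = (q ^ (n + 1); q)_∞ / (q; q)_∞`, and the numerators are uniformly bounded. -/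
theorem exists_norm_inv_qPoch_self_le (hq : ‖q‖ < 1) :
    ∃ B : ℝ, 0 ≤ B ∧ ∀ n, ‖(qPoch q q n)⁻¹‖ ≤ B := by
  refine ⟨Real.exp (1 / (1 - ‖q‖)) / ‖qPochInf q q‖, by positivity, fun n => ?_⟩
  have h0 := qPochInf_ne_zero_of_norm_lt hq hq
  have h1 : (qPoch q q n)⁻¹ = qPochInf q (q * q ^ n) / qPochInf q q := by
    rw [qPochInf_eq hq q n] at h0 ⊢
    have := left_ne_zero_of_mul h0
    have := right_ne_zero_of_mul h0
    field_simp
  rw [h1, norm_div]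
  gcongr
  exact norm_qPochInf_le hq (norm_mul_pow_le hq hq.le n)

theorem differentiable_qPochInf (hq : ‖q‖ < 1) : Differentiable ℂ (qPochInf q) := by
  intro x
  have hs : Summable fun k : ℕ => (‖x‖ + 1) * ‖q‖ ^ k :=
    (summable_geometric_of_lt_one (norm_nonneg _) hq).mul_left _
  have h := hs.hasProdLocallyUniformlyOn_nat_one_add (f := fun (k : ℕ) (x : ℂ) => -(x * q ^ k))
    (K := Metric.ball 0 (‖x‖ + 1)) Metric.isOpen_ball
    (Eventually.of_forall fun k y hy => by
      rw [norm_neg, norm_mul, norm_pow]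
      gcongr
      simpa using (mem_ball_zero_iff.1 hy).le)
    (fun k => by fun_prop)
  have h2 := h.differentiableOn
    (Eventually.of_forall fun s => by
      simpa [Finset.prod_fn] using DifferentiableOn.finsetProd (fun _ _ => by fun_prop))
    Metric.isOpen_ball
  have h3 := h2.differentiableAt (x := x) (Metric.isOpen_ball.mem_nhds (by simp))
  have h4 : qPochInf q = fun x => ∏' i : ℕ, (1 + -(x * q ^ i)) := by
    funext y; simp only [qPochInf, sub_eq_add_neg]
  rw [h4]
  exact h3

theorem continuous_qPochInf (hq : ‖q‖ < 1) : Continuous (qPochInf q) :=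
  (differentiable_qPochInf hq).continuous

theorem one_sub_pow_succ_ne_zero (hq : ‖q‖ < 1) (n : ℕ) : 1 - q ^ (n + 1) ≠ 0 := by
  rw [pow_succ']
  exact sub_ne_zero.2 (mul_pow_ne_one_of_norm_lt hq hq n).symm

theorem one_sub_mul_pow_ne_zero (hq : ‖q‖ < 1) (n : ℕ) : 1 - q * q ^ n ≠ 0 :=
  sub_ne_zero.2 (mul_pow_ne_one_of_norm_lt hq hq n).symm

/-- The terminating `q`-Saalschütz sum, written as a convolution. -/
theorem sum_antidiagonal_saalschuetz (hq : ‖q‖ < 1) (b c y : ℂ) (k : ℕ) :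
    ∑ p ∈ antidiagonal k, qPoch q b p.1 * qPoch q c p.1 * qPoch q (b * c * y * q ^ p.1) p.2 *
      qPoch q y p.2 * y ^ p.1 / (qPoch q q p.1 * qPoch q q p.2) =
    qPoch q (b * y) k * qPoch q (c * y) k / qPoch q q k := by
  have h0 := qPoch_self_ne_zero hq
  set t : ℕ → ℕ → ℂ := fun n j => qPoch q b n * qPoch q c n * qPoch q (b * c * y * q ^ n) j *
      qPoch q y j * y ^ n / (qPoch q q n * qPoch q q j) with ht
  change ∑ p ∈ antidiagonal k, t p.1 p.2 = _
  rw [Finset.Nat.sum_antidiagonal_eq_sum_range_succ (f := t)]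
  induction k with
  | zero => simp [ht]
  | succ k ih =>
    have hk := one_sub_pow_succ_ne_zero hq k
    -- A telescoping certificate: the terms for `k + 1` and for `k`, weighted by the recurrence in
    -- `k` that the right-hand side satisfies, differ by `G (n + 1) - G n`. The value `G 0 = 0` is
    -- separate because the formula carries `1 / (q; q)_(n - 1)`.
    let G : ℕ → ℂ := fun m => Nat.casesOn m 0 fun n =>
      -(q ^ (k - n) * qPoch q b (n + 1) * qPoch q c (n + 1) *
        qPoch q (b * c * y * q ^ n) (k - n) * qPoch q y (k - n) * y ^ (n + 1) /
        (qPoch q q n * qPoch q q (k - n)))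
    have key : ∀ m ≤ k + 1, ∑ n ∈ range m, ((1 - q ^ (k + 1)) * t n (k + 1 - n) -
        (1 - b * y * q ^ k) * (1 - c * y * q ^ k) * t n (k - n)) = G m := by
      intro m
      induction m with
      | zero => intro _; simp [G]
      | succ n ihn =>
        intro hn
        rw [Finset.sum_range_succ, ihn (by omega)]
        obtain ⟨j, rfl⟩ : ∃ j, k = n + j := ⟨k - n, by omega⟩
        -- Writing `1 / (q; q)_(n - 1)` as `(1 - q ^ n) / (q; q)_n` makes one formula valid for `n =
        -- 0` as well.
        have hG : G n = -((q ^ (j + 1) - b * c * y * q ^ (n + j)) * (1 - y * q ^ j) * (1 - q ^ n) *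
            (qPoch q b n * qPoch q c n * qPoch q (b * c * y * q ^ n) j * qPoch q y j * y ^ n /
            (qPoch q q n * qPoch q q (j + 1)))) := by
          cases n with
          | zero => simp [G]
          | succ n =>
            have e : n + 1 + j - n = j + 1 := by omega
            simp only [G, e]
            rw [qPoch_succ' q (b * c * y * q ^ n) j, qPoch_succ q y j, qPoch_succ q q n]
            have h1 := h0 n
            have h2 := h0 (j + 1)
            have h3 := one_sub_mul_pow_ne_zero hq n
            rw [show b * c * y * q ^ n * q = b * c * y * q ^ (n + 1) by ring]
            simp only [pow_add, pow_one, mul_comm _ q] at *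
            generalize q ^ n = N at *
            generalize q ^ j = J at *
            field_simp
        have e1 : n + j + 1 - n = j + 1 := by omega
        have e2 : n + j - n = j := by omega
        rw [hG]
        simp only [G, ht, e1, e2]
        rw [qPoch_succ q (b * c * y * q ^ n) j, qPoch_succ q y j, qPoch_succ q b n,
          qPoch_succ q c n, qPoch_succ q q j]
        have h1 := h0 n
        have h2 := h0 j
        have h3 := one_sub_mul_pow_ne_zero hq j
        clear hG ihn ih
        simp only [pow_add, pow_one] at *
        generalize q ^ n = N at *
        generalize q ^ j = J at *
        generalize hu : 1 - q * J = u at *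
        field_simp
        rw [← hu]
        ring
    have h1 := key (k + 1) le_rfl
    rw [Finset.sum_sub_distrib, ← Finset.mul_sum, ← Finset.mul_sum] at h1
    rw [Nat.succ_eq_add_one] at ih
    rw [ih] at h1
    -- The sum for `k + 1` has the extra term `n = k + 1`, which after multiplication by `1 - q ^ (k
    -- + 1)` cancels `G (k + 1)`.
    rw [Nat.succ_eq_add_one, Finset.sum_range_succ]
    apply mul_left_cancel₀ hk
    rw [mul_add, sub_eq_iff_eq_add.1 h1]
    simp only [G, ht, Nat.sub_self]
    rw [qPoch_succ q q k, qPoch_succ q (b * y) k, qPoch_succ q (c * y) k]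
    have h2 := h0 k
    have h3 := one_sub_mul_pow_ne_zero hq k
    simp only [pow_zero, qPoch_zero, mul_one, pow_succ' q k, pow_succ]
    generalize q ^ k = K at *
    generalize 1 - q * K = u at *
    field_simp
    ring

end QPochhammer

/-! ### Bounded families: summability of bounded terms times geometric factors -/

section BoundedFamilies

variable {ι : Type*} {q : ℂ}

/-- A family of complex numbers that is bounded in norm. -/
def BddFamily (f : ι → ℂ) : Prop := ∃ C : ℝ, ∀ i, ‖f i‖ ≤ C

theorem BddFamily.const (c : ℂ) : BddFamily fun _ : ι => c := ⟨‖c‖, fun _ => le_rfl⟩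

theorem BddFamily.mul {f g : ι → ℂ} (hf : BddFamily f) (hg : BddFamily g) :
    BddFamily fun i => f i * g i := by
  obtain ⟨C, hC⟩ := hf
  obtain ⟨D, hD⟩ := hg
  refine ⟨|C| * |D|, fun i => ?_⟩
  rw [norm_mul]
  gcongr
  · exact (hC i).trans (le_abs_self _)
  · exact (hD i).trans (le_abs_self _)

theorem BddFamily.pow_of_norm_lt {z : ℂ} (hz : ‖z‖ < 1) (n : ι → ℕ) :
    BddFamily fun i => z ^ n i :=
  ⟨1, fun i => by rw [norm_pow]; exact pow_le_one₀ (norm_nonneg _) hz.le⟩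

theorem BddFamily.comp_qPoch (hq : ‖q‖ < 1) {x : ι → ℂ} (hx : BddFamily x) (n : ι → ℕ) :
    BddFamily fun i => qPoch q (x i) (n i) := by
  obtain ⟨C, hC⟩ := hx
  exact ⟨_, fun i => norm_qPoch_le hq (hC i) (n i)⟩

theorem BddFamily.comp_qPochInf (hq : ‖q‖ < 1) {x : ι → ℂ} (hx : BddFamily x) :
    BddFamily fun i => qPochInf q (x i) := by
  obtain ⟨C, hC⟩ := hx
  exact ⟨_, fun i => norm_qPochInf_le hq (hC i)⟩

theorem BddFamily.div_qPoch_self (hq : ‖q‖ < 1) {f : ι → ℂ} (hf : BddFamily f) (n : ι → ℕ) :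
    BddFamily fun i => f i / qPoch q q (n i) := by
  obtain ⟨B, -, hB⟩ := exists_norm_inv_qPoch_self_le hq
  simp only [div_eq_mul_inv]
  exact hf.mul ⟨B, fun i => hB (n i)⟩

theorem BddFamily.summable_mul_pow {f : ℕ → ℂ} (hf : BddFamily f) {z : ℂ} (hz : ‖z‖ < 1) :
    Summable fun n => f n * z ^ n := by
  obtain ⟨C, hC⟩ := hf
  refine Summable.of_norm_bounded
    ((summable_geometric_of_lt_one (norm_nonneg z) hz).mul_left C) fun n => ?_
  rw [norm_mul, norm_pow]
  gcongr
  exact hC n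

theorem BddFamily.summable_mul_pow_mul_pow {f : ℕ × ℕ → ℂ} (hf : BddFamily f) {z w : ℂ}
    (hz : ‖z‖ < 1) (hw : ‖w‖ < 1) : Summable fun p : ℕ × ℕ => f p * (z ^ p.1 * w ^ p.2) := by
  obtain ⟨C, hC⟩ := hf
  have h := (summable_geometric_of_lt_one (norm_nonneg z) hz).mul_of_nonneg
    (summable_geometric_of_lt_one (norm_nonneg w) hw) (fun _ => by positivity)
    (fun _ => by positivity)
  refine Summable.of_norm_bounded (h.mul_left C) fun n => ?_
  rw [norm_mul, norm_mul, norm_pow, norm_pow]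
  gcongr
  exact hC n

theorem tsum_tsum_eq_tsum_antidiagonal {f : ℕ × ℕ → ℂ} (hf : Summable f) :
    ∑' n, ∑' j, f (n, j) = ∑' k, ∑ p ∈ Finset.HasAntidiagonal.antidiagonal k, f p := by
  rw [← hf.tsum_prod, ← Finset.HasAntidiagonal.sigmaAntidiagonalEquivProd.tsum_eq f]
  have h := (Finset.HasAntidiagonal.sigmaAntidiagonalEquivProd (A := ℕ)).summable_iff.2 hf
  refine (h.tsum_sigma' fun n => (hasSum_fintype _).summable).trans ?_
  refine tsum_congr fun k => ?_
  rw [tsum_fintype]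
  exact Finset.sum_coe_sort (Finset.HasAntidiagonal.antidiagonal k) f

end BoundedFamilies

/-! ### The q-Gauss sum -/

section Gauss

open Filter Topology Finset

variable {q : ℂ}

/-- Letting `α` vary is what dominated convergence needs when `α` is replaced by `α * q ^ n`. The
lower parameter enters through `(αβz q ^ j; q)_∞` instead of `1 / (αβz; q)_j`, so that no
nonvanishing condition is needed. -/
theorem bddFamily_gauss (hq : ‖q‖ < 1) {ι : Type*} {α : ι → ℂ} (hα : BddFamily α) (β z : ℂ)
    (n : ι → ℕ) : BddFamily fun i => qPoch q (α i) (n i) * qPoch q β (n i) / qPoch q q (n i) *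
      qPochInf q (α i * β * z * q ^ n i) :=
  (((hα.comp_qPoch hq n).mul ((BddFamily.const β).comp_qPoch hq n)).div_qPoch_self hq n).mul
    ((((hα.mul (.const β)).mul (.const z)).mul (.pow_of_norm_lt hq n)).comp_qPochInf hq)

theorem summable_gauss (hq : ‖q‖ < 1) (α β : ℂ) {z : ℂ} (hz : ‖z‖ < 1) :
    Summable fun j => qPoch q α j * qPoch q β j / qPoch q q j *
      qPochInf q (α * β * z * q ^ j) * z ^ j :=
  (bddFamily_gauss hq (.const α) β z id).summable_mul_pow hz

/-- The difference of the two sides telescopes: its partial sums are `G m`, a bounded quantity times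
`z ^ m`, and tend to 0. -/
theorem tsum_gauss_step (hq : ‖q‖ < 1) (α β : ℂ) {z : ℂ} (hz : ‖z‖ < 1) :
    ∑' j, qPoch q α j * qPoch q β j / qPoch q q j * qPochInf q (α * β * z * q ^ j) * z ^ j =
    (1 - α * z) * ∑' j, qPoch q (α * q) j * qPoch q β j / qPoch q q j *
      qPochInf q (α * q * β * z * q ^ j) * z ^ j := by
  have h1 := (summable_gauss hq α β hz).hasSum
  have h2 := (summable_gauss hq (α * q) β hz).hasSum.mul_left (1 - α * z)
  have h3 := (h1.sub h2).tendsto_sum_nat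
  let G : ℕ → ℂ := fun m => Nat.casesOn m 0 fun m => (α * (qPoch q (α * q) m *
    qPoch q β (m + 1) / qPoch q q m * qPochInf q (α * β * z * q ^ (m + 1)))) * z ^ (m + 1)
  have hG : ∀ m, ∑ j ∈ range m, (qPoch q α j * qPoch q β j / qPoch q q j *
      qPochInf q (α * β * z * q ^ j) * z ^ j - (1 - α * z) * (qPoch q (α * q) j *
      qPoch q β j / qPoch q q j * qPochInf q (α * q * β * z * q ^ j) * z ^ j)) = G m := by
    intro m
    induction m with
    | zero => simp [G]
    | succ m ih =>
      rw [Finset.sum_range_succ, ih]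
      have hs := qPochInf_succ hq (α * β * z * q ^ m)
      have e1 : α * q * β * z * q ^ m = α * β * z * q ^ m * q := by ring
      have e2 : α * β * z * q ^ (m + 1) = α * β * z * q ^ m * q := by ring
      have h0 := qPoch_self_ne_zero hq m
      cases m with
      | zero =>
        have hG1 : G (0 + 1) = α * (qPoch q (α * q) 0 * qPoch q β (0 + 1) / qPoch q q 0 *
          qPochInf q (α * β * z * q ^ (0 + 1))) * z ^ (0 + 1) := rfl
        rw [show G 0 = 0 from rfl, hG1, e1, e2, hs]
        simp [qPoch_succ]
        ring_nf
      | succ m =>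
        have h0' := qPoch_self_ne_zero hq m
        have h3 := one_sub_mul_pow_ne_zero hq m
        simp only [G, e1, hs, e2]
        rw [qPoch_succ' q α m, qPoch_succ q (α * q) m, qPoch_succ q q m, qPoch_succ q β (m + 1)]
        generalize qPochInf q (α * β * z * q ^ (m + 1) * q) = P
        simp only [pow_succ]
        generalize q ^ m = M at *
        generalize hu : 1 - q * M = u at *
        field_simp
        rw [← hu]
        ring
  have hb : BddFamily fun m : ℕ => α * (qPoch q (α * q) m *
      qPoch q β (m + 1) / qPoch q q m * qPochInf q (α * β * z * q ^ (m + 1))) :=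
    (BddFamily.const α).mul (((((BddFamily.const (α * q)).comp_qPoch hq id).mul
      ((BddFamily.const β).comp_qPoch hq fun m => m + 1)).div_qPoch_self hq id).mul
      (((BddFamily.const (α * β * z)).mul (.pow_of_norm_lt hq fun m => m + 1)).comp_qPochInf hq))
  have h5 : Tendsto (fun m => G (m + 1)) atTop (𝓝 0) := by
    have := (hb.summable_mul_pow hz).tendsto_atTop_zero.mul_const z
    simpa only [G, pow_succ, mul_assoc, zero_mul] using this
  have h6 := tendsto_nhds_unique (h3.congr hG) ((tendsto_add_atTop_iff_nat 1).1 h5)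
  linear_combination h6

/-- Iterating the contiguous relation produces `(αz; q)_n` and replaces `α` by `α * q ^ n → 0`;
dominated convergence passes to the limit. -/
theorem tsum_gauss_eq_zero_left (hq : ‖q‖ < 1) (α β : ℂ) {z : ℂ} (hz : ‖z‖ < 1) :
    ∑' j, qPoch q α j * qPoch q β j / qPoch q q j * qPochInf q (α * β * z * q ^ j) * z ^ j =
    qPochInf q (α * z) * ∑' j, qPoch q β j / qPoch q q j * z ^ j := by
  have h1 : ∀ n : ℕ, ∑' j, qPoch q α j * qPoch q β j / qPoch q q j *
      qPochInf q (α * β * z * q ^ j) * z ^ j = qPoch q (α * z) n *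
      ∑' j, qPoch q (α * q ^ n) j * qPoch q β j / qPoch q q j *
      qPochInf q (α * q ^ n * β * z * q ^ j) * z ^ j := by
    intro n
    induction n with
    | zero => simp
    | succ n ih =>
      rw [ih, tsum_gauss_step hq (α * q ^ n) β hz, qPoch_succ]
      ring_nf
  have hz' := hz
  have h2 : Tendsto (fun n : ℕ => ∑' j, qPoch q (α * q ^ n) j * qPoch q β j / qPoch q q j *
      qPochInf q (α * q ^ n * β * z * q ^ j) * z ^ j) atTop
      (𝓝 (∑' j, qPoch q 0 j * qPoch q β j / qPoch q q j *
      qPochInf q (0 * β * z * q ^ j) * z ^ j)) := by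
    obtain ⟨C, hC⟩ := bddFamily_gauss hq (ι := ℕ × ℕ) (α := fun p => α * q ^ p.1)
      ((BddFamily.const α).mul (.pow_of_norm_lt hq _)) β z (fun p => p.2)
    refine tendsto_tsum_of_dominated_convergence (bound := fun j => C * ‖z‖ ^ j)
      ((summable_geometric_of_lt_one (norm_nonneg z) hz).mul_left C) ?_ ?_
    · intro j
      have ha : Tendsto (fun n : ℕ => α * q ^ n) atTop (𝓝 0) := by
        simpa using (tendsto_pow_atTop_nhds_zero_of_norm_lt_one hq).const_mul α
      refine Tendsto.mul_const _ (Tendsto.mul (Tendsto.div_const (Tendsto.mul_const _ ?_) _) ?_)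
      · exact ((continuous_qPoch q j).tendsto 0).comp ha
      · exact ((continuous_qPochInf hq).tendsto _).comp
          (((ha.mul_const β).mul_const z).mul_const (q ^ j))
    · refine Eventually.of_forall fun n j => ?_
      rw [norm_mul, norm_pow]
      gcongr
      exact hC (n, j)
  have h3 := (tendsto_qPoch hq (α * z)).mul h2
  simp only [← h1] at h3
  have h4 := tendsto_nhds_unique tendsto_const_nhds h3
  simpa using h4

/-- The `q`-Gauss sum. -/
theorem tsum_gauss (hq : ‖q‖ < 1) (α β : ℂ) {z : ℂ} (hz : ‖z‖ < 1) :
    ∑' j, qPoch q α j * qPoch q β j / qPoch q q j * qPochInf q (α * β * z * q ^ j) * z ^ j =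
    qPochInf q (α * z) * qPochInf q (β * z) / qPochInf q z := by
  have h0 := qPochInf_ne_zero_of_norm_lt hq hz
  -- With `α = 1` only the first term survives, so `1 = (z; q)_∞ ∑ z ^ j / (q; q)_j`. With `β` in
  -- the place of `α` the lemma then gives the q-binomial theorem.
  have h1 := tsum_gauss_eq_zero_left hq 1 0 hz
  have h2 := tsum_gauss_eq_zero_left hq β 0 hz
  have h3 : ∑' j, qPoch q 1 j * qPoch q 0 j / qPoch q q j *
      qPochInf q (1 * 0 * z * q ^ j) * z ^ j = 1 := by
    rw [tsum_eq_single 0]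
    · simp
    · intro j hj
      obtain ⟨j, rfl⟩ := Nat.exists_eq_succ_of_ne_zero hj
      simp [qPoch_one_succ]
  rw [h3] at h1
  rw [tsum_gauss_eq_zero_left hq α β hz]
  simp only [one_mul, mul_zero, zero_mul, qPochInf_zero, mul_one, qPoch_zero_left] at h1 h2
  rw [h2, eq_div_iff h0]
  linear_combination (-qPochInf q (α * z) * qPochInf q (β * z)) * h1

end Gauss

/-! ### A two-term transformation of `₃φ₂` series -/

section Transformation

open Filter Topology Finset

variable {q : ℂ}

/-- The two-term transformation of a `₃φ₂` series of type II, cleared of denominators. -/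
theorem tsum_phi32_transformation (hq : ‖q‖ < 1) (E b c y : ℂ) {u : ℂ} (hu : ‖u‖ < 1)
    (hyu : ‖y * u‖ < 1) :
    qPochInf q (y * u) * ∑' n, qPoch q E n * qPoch q b n * qPoch q c n / qPoch q q n *
      (qPochInf q (b * c * y * q ^ n) * qPochInf q (E * u * q ^ n)) * (y * u) ^ n =
    qPochInf q u * ∑' k, qPoch q E k * qPoch q (b * y) k * qPoch q (c * y) k / qPoch q q k *
      (qPochInf q (b * c * y * q ^ k) * qPochInf q (E * y * u * q ^ k)) * u ^ k := by
  have hu0 := qPochInf_ne_zero_of_norm_lt hq hu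
  -- Summed over `p.2` this is a q-Gauss sum and gives the left-hand series; summed over
  -- antidiagonals it is a terminating q-Saalschütz sum and gives the right-hand one.
  let f : ℕ × ℕ → ℂ := fun p => (qPoch q E p.1 * qPoch q (E * q ^ p.1) p.2 * qPoch q b p.1 *
    qPoch q c p.1 / qPoch q q p.1 * (qPoch q y p.2 / qPoch q q p.2) *
    (qPochInf q (b * c * y * q ^ p.1) * qPochInf q (E * y * u * q ^ (p.1 + p.2)))) *
    ((y * u) ^ p.1 * u ^ p.2)
  have hf : Summable f := by
    refine BddFamily.summable_mul_pow_mul_pow ?_ hyu hu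
    exact (((((((BddFamily.const E).comp_qPoch hq _).mul (((BddFamily.const E).mul
      (.pow_of_norm_lt hq _)).comp_qPoch hq _)).mul ((BddFamily.const b).comp_qPoch hq _)).mul
      ((BddFamily.const c).comp_qPoch hq _)).div_qPoch_self hq _).mul
      (((BddFamily.const y).comp_qPoch hq _).div_qPoch_self hq _)).mul
      ((((BddFamily.const (b * c * y)).mul (.pow_of_norm_lt hq _)).comp_qPochInf hq).mul
      (((BddFamily.const (E * y * u)).mul (.pow_of_norm_lt hq _)).comp_qPochInf hq))
  have h := tsum_tsum_eq_tsum_antidiagonal hf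
  have h1 : ∀ n, qPochInf q u * ∑' j, f (n, j) = qPochInf q (y * u) * (qPoch q E n * qPoch q b n *
      qPoch q c n / qPoch q q n *
      (qPochInf q (b * c * y * q ^ n) * qPochInf q (E * u * q ^ n)) * (y * u) ^ n) := by
    intro n
    have hg := tsum_gauss hq (E * q ^ n) y hu
    have : ∑' j, f (n, j) = (qPoch q E n * qPoch q b n * qPoch q c n / qPoch q q n *
        qPochInf q (b * c * y * q ^ n) * (y * u) ^ n) * ∑' j, qPoch q (E * q ^ n) j *
        qPoch q y j / qPoch q q j * qPochInf q (E * q ^ n * y * u * q ^ j) * u ^ j := by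
      rw [← tsum_mul_left]
      refine tsum_congr fun j => ?_
      simp only [f]
      rw [show E * q ^ n * y * u * q ^ j = E * y * u * q ^ (n + j) by ring]
      ring
    rw [this, hg]
    rw [show E * u * q ^ n = E * q ^ n * u by ring]
    field_simp
  have h2 : ∀ k, ∑ p ∈ antidiagonal k, f p = qPoch q E k * qPoch q (b * y) k *
      qPoch q (c * y) k / qPoch q q k *
      (qPochInf q (b * c * y * q ^ k) * qPochInf q (E * y * u * q ^ k)) * u ^ k := by
    intro k
    have hs := sum_antidiagonal_saalschuetz hq b c y k
    rw [show qPoch q E k * qPoch q (b * y) k * qPoch q (c * y) k / qPoch q q k *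
      (qPochInf q (b * c * y * q ^ k) * qPochInf q (E * y * u * q ^ k)) * u ^ k =
      (qPoch q E k * (qPochInf q (b * c * y * q ^ k) * qPochInf q (E * y * u * q ^ k)) * u ^ k) *
      (qPoch q (b * y) k * qPoch q (c * y) k / qPoch q q k) by ring, ← hs, Finset.mul_sum]
    refine Finset.sum_congr rfl fun p hp => ?_
    rw [HasAntidiagonal.mem_antidiagonal] at hp
    subst hp
    simp only [f]
    rw [qPochInf_eq hq (b * c * y * q ^ p.1) p.2, qPoch_add, mul_pow, pow_add u,
      show b * c * y * q ^ p.1 * q ^ p.2 = b * c * y * q ^ (p.1 + p.2) by ring]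
    ring
  rw [← tsum_mul_left]
  simp only [← h1]
  rw [tsum_mul_left, h]
  simp only [h2]

end Transformation

/-! ### Jackson sums and the nonterminating q-Saalschütz formula -/

section QIntegral

open Filter Topology Finset

variable {q : ℂ}

theorem qPochInf_mul_pow_ne_zero (hq : ‖q‖ < 1) {x : ℂ} (hx : qPochInf q x ≠ 0) (n : ℕ) :
    qPochInf q (x * q ^ n) ≠ 0 := by
  rw [qPochInf_eq hq x n] at hx
  exact right_ne_zero_of_mul hx

/-- `1 / (x q ^ n; q)_∞ = (x; q)_n / (x; q)_∞`, so one nonvanishing condition bounds all the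
reciprocals. -/
theorem BddFamily.div_qPochInf_mul_pow (hq : ‖q‖ < 1) {ι : Type*} {f : ι → ℂ} (hf : BddFamily f)
    {x : ℂ} (hx : qPochInf q x ≠ 0) (n : ι → ℕ) :
    BddFamily fun i => f i / qPochInf q (x * q ^ n i) := by
  have h : ∀ i, f i / qPochInf q (x * q ^ n i) = f i * (qPoch q x (n i) * (qPochInf q x)⁻¹) := by
    intro i
    have h1 := qPochInf_mul_pow_ne_zero hq hx (n i)
    have h2 := qPochInf_eq hq x (n i)
    rw [div_eq_iff h1, mul_assoc, mul_right_comm, ← h2, mul_inv_cancel₀ hx, mul_one]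
  simp only [h]
  exact hf.mul (((BddFamily.const x).comp_qPoch hq n).mul (.const _))

theorem BddFamily.const_mul_pow (hq : ‖q‖ < 1) {ι : Type*} (x : ℂ) (n : ι → ℕ) :
    BddFamily fun i => x * q ^ n i := (BddFamily.const x).mul (.pow_of_norm_lt hq n)

/-- The sum `∑ y q^n h (y q^n)`, that is, the Jackson integral of `h` from `0` to `y`
divided by `1 - q`. -/
noncomputable def jacksonSum (q y : ℂ) (h : ℂ → ℂ) : ℂ := ∑' n : ℕ, y * q ^ n * h (y * q ^ n)

theorem hasSum_of_telescoping {f g : ℕ → ℂ} {l : ℂ} (hf : Summable f)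
    (h : ∀ n, f n = g n - g (n + 1)) (hg : Tendsto g atTop (𝓝 l)) : HasSum f (g 0 - l) := by
  have h1 := hf.hasSum.tendsto_sum_nat
  simp only [h, Finset.sum_range_sub'] at h1
  have h2 := tendsto_nhds_unique h1 (tendsto_const_nhds.sub hg)
  simp only [← h] at h2
  rw [← h2]
  exact hf.hasSum

theorem tendsto_qPochInf_mul_pow (hq : ‖q‖ < 1) (x : ℂ) :
    Tendsto (fun n : ℕ => qPochInf q (x * q ^ n)) atTop (𝓝 1) := by
  have ha : Tendsto (fun n : ℕ => x * q ^ n) atTop (𝓝 0) := by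
    simpa using (tendsto_pow_atTop_nhds_zero_of_norm_lt_one hq).const_mul x
  simpa [Function.comp_def] using ((continuous_qPochInf hq).tendsto 0).comp ha

/-- The summand is `(y q ^ (n + 1); q)_∞ - (y q ^ n; q)_∞`. -/
theorem tsum_mul_pow_mul_qPochInf (hq : ‖q‖ < 1) (y : ℂ) :
    ∑' n : ℕ, y * q ^ n * qPochInf q (y * q ^ n * q) = 1 - qPochInf q y := by
  have hs : Summable fun n : ℕ => y * q ^ n * qPochInf q (y * q ^ n * q) := by
    have := (((BddFamily.const y).mul
      (((BddFamily.const_mul_pow hq y id).mul (.const q)).comp_qPochInf hq)).summable_mul_pow hq)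
    exact this.congr fun n => by simp only [id]; ring
  have h := hasSum_of_telescoping (g := fun n => - qPochInf q (y * q ^ n)) hs
    (fun n => by
      rw [qPochInf_succ hq (y * q ^ n), show y * q ^ (n + 1) = y * q ^ n * q by ring]
      ring) (tendsto_qPochInf_mul_pow hq y).neg
  rw [h.tsum_eq]
  simp
  ring

/-- The integrand of the nonterminating `q`-Saalschütz formula. -/
noncomputable def saalKernel (q C D A B F x : ℂ) : ℂ :=
  qPochInf q (q * x / C) * qPochInf q (q * x / D) * qPochInf q (A * B * C * D * F * x) /
    (qPochInf q (A * x) * qPochInf q (B * x) * qPochInf q (F * x))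

theorem saalKernel_swap (q C D A B F x : ℂ) :
    saalKernel q C D A B F x = saalKernel q C D A F B x := by
  unfold saalKernel
  rw [show A * B * C * D * F * x = A * F * C * D * B * x by ring]
  ring

theorem saalKernel_rotate (q C D A B F x : ℂ) :
    saalKernel q C D A B F x = saalKernel q C D B F A x := by
  unfold saalKernel
  rw [show A * B * C * D * F * x = B * F * C * D * A * x by ring]
  ring

theorem bddFamily_saalKernel (hq : ‖q‖ < 1) {C D A B F y : ℂ} (hA : qPochInf q (A * y) ≠ 0)
    (hB : qPochInf q (B * y) ≠ 0) (hF : qPochInf q (F * y) ≠ 0) {ι : Type*} (m n : ι → ℕ) :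
    BddFamily fun i => saalKernel q C D A B (F * q ^ m i) (y * q ^ n i) := by
  have h : ∀ i, saalKernel q C D A B (F * q ^ m i) (y * q ^ n i) =
      qPochInf q (q * y / C * q ^ n i) * qPochInf q (q * y / D * q ^ n i) *
      qPochInf q (A * B * C * D * F * y * q ^ (m i + n i)) / qPochInf q (A * y * q ^ n i) /
      qPochInf q (B * y * q ^ n i) / qPochInf q (F * y * q ^ (m i + n i)) := by
    intro i
    rw [saalKernel, div_div, div_div, show q * (y * q ^ n i) / C = q * y / C * q ^ n i by ring,
      show q * (y * q ^ n i) / D = q * y / D * q ^ n i by ring, pow_add,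
      show A * B * C * D * (F * q ^ m i) * (y * q ^ n i) =
        A * B * C * D * F * y * (q ^ m i * q ^ n i) by ring,
      show F * q ^ m i * (y * q ^ n i) = F * y * (q ^ m i * q ^ n i) by ring,
      ← mul_assoc A, ← mul_assoc B]
    ring
  simp only [h]
  exact ((((((BddFamily.const_mul_pow hq _ _).comp_qPochInf hq).mul
    ((BddFamily.const_mul_pow hq _ _).comp_qPochInf hq)).mul
    ((BddFamily.const_mul_pow hq _ _).comp_qPochInf hq)).div_qPochInf_mul_pow hq
    hA _).div_qPochInf_mul_pow hq hB _).div_qPochInf_mul_pow hq hF _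

theorem summable_saalKernel (hq : ‖q‖ < 1) {C D A B F y : ℂ} (hA : qPochInf q (A * y) ≠ 0)
    (hB : qPochInf q (B * y) ≠ 0) (hF : qPochInf q (F * y) ≠ 0) :
    Summable fun n : ℕ => y * q ^ n * saalKernel q C D A B F (y * q ^ n) := by
  have h := ((bddFamily_saalKernel hq (C := C) (D := D) hA hB hF (fun _ => 0) id).mul
    (.const y)).summable_mul_pow hq
  exact h.congr fun n => by simp; ring

/-- One half of the contiguous relation: the boundary term is
`lim φ` with `φ x = (x/C, x/D, λx; q)_∞ / (Ax, Bx, Fx; q)_∞`. -/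
theorem jacksonSum_saalKernel_step (hq : ‖q‖ < 1) {C D A B F y : ℂ} (hC : C ≠ 0) (hD : D ≠ 0)
    (hA : qPochInf q (A * y) ≠ 0) (hB : qPochInf q (B * y) ≠ 0) (hF : qPochInf q (F * y) ≠ 0)
    (hy : y = C ∨ y = D) :
    (1 - C * F) * (1 - D * F) * jacksonSum q y (saalKernel q C D A B F) -
    (1 - A * C * D * F) * (1 - B * C * D * F) * jacksonSum q y (saalKernel q C D A B (F * q)) =
    - (C * D * F) := by
  have hFq : qPochInf q (F * q * y) ≠ 0 := by
    have := qPochInf_mul_pow_ne_zero hq hF 1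
    rwa [pow_one, show F * y * q = F * q * y by ring] at this
  have s1 := (summable_saalKernel hq (C := C) (D := D) hA hB hF).mul_left
    ((1 - C * F) * (1 - D * F))
  have s2 := (summable_saalKernel hq (C := C) (D := D) hA hB hFq).mul_left
    ((1 - A * C * D * F) * (1 - B * C * D * F))
  -- A q-primitive: `x` times the combination of the two kernels is `φ x - φ (x q)`. It vanishes at
  -- `y`, where `x / C` or `x / D` equals 1, and tends to `C * D * F` at 0.
  let φ : ℂ → ℂ := fun x => C * D * F * (qPochInf q (x / C) * qPochInf q (x / D) *
    qPochInf q (A * B * C * D * F * x) /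
    (qPochInf q (A * x) * qPochInf q (B * x) * qPochInf q (F * x)))
  have hφ : Tendsto (fun n : ℕ => φ (y * q ^ n)) atTop (𝓝 (C * D * F)) := by
    have ha : Tendsto (fun n : ℕ => y * q ^ n) atTop (𝓝 0) := by
      simpa using (tendsto_pow_atTop_nhds_zero_of_norm_lt_one hq).const_mul y
    have hc := continuous_qPochInf hq
    have : ContinuousAt φ 0 := by
      refine ContinuousAt.mul continuousAt_const (ContinuousAt.div ?_ ?_ ?_)
      · fun_prop
      · fun_prop
      · simp
    have h2 := this.tendsto.comp ha
    simpa [φ, Function.comp_def] using h2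
  have h := hasSum_of_telescoping (s1.sub s2) (g := fun n => φ (y * q ^ n)) (fun n => ?_) hφ
  · rw [jacksonSum, jacksonSum, ← tsum_mul_left, ← tsum_mul_left, ← s1.tsum_sub s2, h.tsum_eq]
    have : φ y = 0 := by
      rcases hy with rfl | rfl <;> simp [φ, hC, hD, qPochInf_one hq]
    simp [this]
  · have e : y * q ^ (n + 1) = y * q ^ n * q := by ring
    have hA' := qPochInf_mul_pow_ne_zero hq hA n
    have hB' := qPochInf_mul_pow_ne_zero hq hB n
    have hF' := qPochInf_mul_pow_ne_zero hq hF n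
    simp only [e]
    rw [mul_assoc] at hA' hB' hF'
    generalize y * q ^ n = x at *
    simp only [saalKernel, φ]
    have i1 := qPochInf_succ hq (x / C)
    have i2 := qPochInf_succ hq (x / D)
    have i3 := qPochInf_succ hq (A * B * C * D * F * x)
    have i4 := qPochInf_succ hq (A * x)
    have i5 := qPochInf_succ hq (B * x)
    have i6 := qPochInf_succ hq (F * x)
    rw [show q * x / C = x / C * q by ring, show q * x / D = x / D * q by ring,
      show A * B * C * D * (F * q) * x = A * B * C * D * F * x * q by ring,
      show F * q * x = F * x * q by ring, show x * q / C = x / C * q by ring,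
      show x * q / D = x / D * q by ring,
      show A * B * C * D * F * (x * q) = A * B * C * D * F * x * q by ring,
      ← mul_assoc A x q, ← mul_assoc B x q, ← mul_assoc F x q, i1, i2, i3, i4, i5, i6]
    rw [i4] at hA'
    rw [i5] at hB'
    rw [i6] at hF'
    have a1 := left_ne_zero_of_mul hA'
    have a2 := right_ne_zero_of_mul hA'
    have b1 := left_ne_zero_of_mul hB'
    have b2 := right_ne_zero_of_mul hB'
    have f1 := left_ne_zero_of_mul hF'
    have f2 := right_ne_zero_of_mul hF'
    generalize qPochInf q (x / C * q) = X1
    generalize qPochInf q (x / D * q) = X2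
    generalize qPochInf q (A * B * C * D * F * x * q) = X3
    generalize qPochInf q (A * x * q) = X4 at *
    generalize qPochInf q (B * x * q) = X5 at *
    generalize qPochInf q (F * x * q) = X6 at *
    generalize hua : 1 - A * x = ua at *
    generalize hub : 1 - B * x = ub at *
    generalize huf : 1 - F * x = uf at *
    field_simp
    subst hua hub huf
    ring

/-- The Jackson integral of the kernel from `D` to `C`, divided by `1 - q`. -/
noncomputable def saalIntegral (q C D A B F : ℂ) : ℂ :=
  jacksonSum q C (saalKernel q C D A B F) - jacksonSum q D (saalKernel q C D A B F)

theorem saalIntegral_swap (q C D A B F : ℂ) :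
    saalIntegral q C D A B F = saalIntegral q C D A F B := by
  simp only [saalIntegral, funext (saalKernel_swap q C D A B F)]

theorem saalIntegral_rotate (q C D A B F : ℂ) :
    saalIntegral q C D A B F = saalIntegral q C D B F A := by
  simp only [saalIntegral, funext (saalKernel_rotate q C D A B F)]

theorem tendsto_jacksonSum_saalKernel (hq : ‖q‖ < 1) {C D A B F y : ℂ}
    (hA : qPochInf q (A * y) ≠ 0) (hB : qPochInf q (B * y) ≠ 0) (hF : qPochInf q (F * y) ≠ 0) :
    Tendsto (fun m : ℕ => jacksonSum q y (saalKernel q C D A B (F * q ^ m))) atTop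
      (𝓝 (jacksonSum q y (saalKernel q C D A B 0))) := by
  obtain ⟨K, hK⟩ := bddFamily_saalKernel hq (C := C) (D := D) hA hB hF
    (ι := ℕ × ℕ) (fun p => p.1) (fun p => p.2)
  refine tendsto_tsum_of_dominated_convergence (bound := fun n => ‖y‖ * K * ‖q‖ ^ n)
    ((summable_geometric_of_lt_one (norm_nonneg q) hq).mul_left _) ?_ ?_
  · intro n
    refine Tendsto.const_mul _ ?_
    have ha : Tendsto (fun n : ℕ => F * q ^ n) atTop (𝓝 0) := by
      simpa using (tendsto_pow_atTop_nhds_zero_of_norm_lt_one hq).const_mul F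
    have hc := continuous_qPochInf hq
    have hA' := qPochInf_mul_pow_ne_zero hq hA n
    have hB' := qPochInf_mul_pow_ne_zero hq hB n
    rw [mul_assoc] at hA' hB'
    have : ContinuousAt (fun F => saalKernel q C D A B F (y * q ^ n)) 0 := by
      refine ContinuousAt.div ?_ ?_ ?_
      · fun_prop
      · fun_prop
      · simp [hA', hB']
    exact this.tendsto.comp ha
  · refine Eventually.of_forall fun m n => ?_
    have := hK (m, n)
    rw [norm_mul, norm_mul, norm_pow]
    calc _ ≤ ‖y‖ * ‖q‖ ^ n * K := by gcongr
      _ = _ := by ring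

/-- The inhomogeneous term `-(C * D * F)` is the same for the endpoints `C` and `D`, so the
difference of the Jackson sums obeys a homogeneous recurrence under `F ↦ F * q`. Iterate it and let
`F * q ^ m → 0`. -/
theorem saalIntegral_eq_mul_zero (hq : ‖q‖ < 1) {C D A B F : ℂ} (hC : C ≠ 0) (hD : D ≠ 0)
    (hAC : qPochInf q (A * C) ≠ 0) (hBC : qPochInf q (B * C) ≠ 0) (hFC : qPochInf q (F * C) ≠ 0)
    (hAD : qPochInf q (A * D) ≠ 0) (hBD : qPochInf q (B * D) ≠ 0) (hFD : qPochInf q (F * D) ≠ 0) :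
    qPochInf q (F * C) * qPochInf q (F * D) * saalIntegral q C D A B F =
    qPochInf q (A * C * D * F) * qPochInf q (B * C * D * F) * saalIntegral q C D A B 0 := by
  have step : ∀ m : ℕ, qPoch q (F * C) m * qPoch q (F * D) m * saalIntegral q C D A B F =
      qPoch q (A * C * D * F) m * qPoch q (B * C * D * F) m *
      saalIntegral q C D A B (F * q ^ m) := by
    intro m
    induction m with
    | zero => simp
    | succ m ih =>
      have h1 := qPochInf_mul_pow_ne_zero hq hFC m
      have h2 := qPochInf_mul_pow_ne_zero hq hFD m
      rw [mul_right_comm] at h1 h2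
      have e1 := jacksonSum_saalKernel_step hq hC hD hAC hBC h1 (Or.inl rfl)
      have e2 := jacksonSum_saalKernel_step hq hC hD hAD hBD h2 (Or.inr rfl)
      simp only [qPoch_succ]
      rw [pow_succ, ← mul_assoc F]
      simp only [saalIntegral] at ih ⊢
      linear_combination (1 - F * C * q ^ m) * (1 - F * D * q ^ m) * ih +
        qPoch q (A * C * D * F) m * qPoch q (B * C * D * F) m * (e1 - e2)
  have l1 := ((tendsto_qPoch hq (F * C)).mul (tendsto_qPoch hq (F * D))).mul_const
    (saalIntegral q C D A B F)
  have l2 := ((tendsto_qPoch hq (A * C * D * F)).mul (tendsto_qPoch hq (B * C * D * F))).mul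
    ((tendsto_jacksonSum_saalKernel hq (C := C) (D := D) hAC hBC hFC).sub
    (tendsto_jacksonSum_saalKernel hq (C := C) (D := D) hAD hBD hFD))
  exact tendsto_nhds_unique l1 (l2.congr fun m => (step m).symm)

/-- `saalIntegral_eq_mul_zero` is read backwards: for `A = B = 0` and `F = q / D` the factor `(q x /
D; q)_∞` cancels, and the Jackson sums of `(q x / C; q)_∞` telescope. -/
theorem saalIntegral_zero (hq0 : q ≠ 0) (hq : ‖q‖ < 1) {C D : ℂ} (hC : C ≠ 0) (hD : D ≠ 0) :
    saalIntegral q C D 0 0 0 =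
    C * qPochInf q q * qPochInf q (q * C / D) * qPochInf q (D / C) := by
  have hqq := qPochInf_ne_zero_of_norm_lt hq hq
  have tel : ∀ y z : ℂ, z ≠ 0 → jacksonSum q y (fun x => qPochInf q (q * x / z)) =
      z * (1 - qPochInf q (y / z)) := by
    intro y z hz
    rw [← tsum_mul_pow_mul_qPochInf hq, ← tsum_mul_left]
    refine tsum_congr fun n => ?_
    simp only []
    rw [show q * (y * q ^ n) / z = y / z * q ^ n * q by ring]
    field_simp
  have red : ∀ y F : ℂ, (∀ n : ℕ, qPochInf q (F * (y * q ^ n)) ≠ 0) →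
      ∀ z, (∀ x, saalKernel q C D 0 0 F x = qPochInf q (F * x) * qPochInf q (q * x / z) /
        qPochInf q (F * x)) →
      jacksonSum q y (saalKernel q C D 0 0 F) = jacksonSum q y (fun x => qPochInf q (q * x / z)) := by
    intro y F hF z hz
    refine tsum_congr fun n => ?_
    rw [hz, mul_div_cancel_left₀ _ (hF n)]
  -- Here `F = q / D` is inadmissible. The case cannot be discarded: by periodicity of `q ^ s`, `C /
  -- D` may be a power of `q` although `c - d` is not an integer. The choice `F = q / C` works
  -- instead and shows that both sides vanish.
  by_cases hdeg : qPochInf q (q * C / D) = 0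
  · have h1 : qPochInf q (q * D / C) ≠ 0 := by
      refine qPochInf_ne_zero hq fun n hn => ?_
      have h2 : ¬ ∀ n : ℕ, q * C / D * q ^ n ≠ 1 := fun h => qPochInf_ne_zero hq h hdeg
      push Not at h2
      obtain ⟨m, hm⟩ := h2
      -- The ratio `C / D` drops out of the product of the two vanishing conditions, so they cannot
      -- hold together.
      have h3 : q * (q * q ^ (n + m)) = 1 := by
        have : (q * D / C * q ^ n) * (q * C / D * q ^ m) = 1 := by rw [hn, hm, one_mul]
        rw [← this, pow_add]
        field_simp
      have h4 : ‖q * q ^ (n + m)‖ ≤ 1 := norm_mul_pow_le hq hq.le _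
      have h5 : ‖q‖ * ‖q * q ^ (n + m)‖ = 1 := by rw [← norm_mul, h3, norm_one]
      nlinarith [norm_nonneg q]
    have hFC : qPochInf q (q / C * C) ≠ 0 := by rwa [div_mul_cancel₀ _ hC]
    have hFD : qPochInf q (q / C * D) ≠ 0 := by rwa [div_mul_eq_mul_div]
    have h := saalIntegral_eq_mul_zero hq (A := 0) (B := 0) hC hD (by simp) (by simp) hFC
      (by simp) (by simp) hFD
    have hk : ∀ x, saalKernel q C D 0 0 (q / C) x =
        qPochInf q (q / C * x) * qPochInf q (q * x / D) / qPochInf q (q / C * x) := by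
      intro x
      simp [saalKernel, div_mul_eq_mul_div]
    rw [saalIntegral, red C _ (fun n => by
        rw [← mul_assoc]; exact qPochInf_mul_pow_ne_zero hq hFC n) D hk,
      red D _ (fun n => by
        rw [← mul_assoc]; exact qPochInf_mul_pow_ne_zero hq hFD n) D hk, tel _ _ hD, tel _ _ hD,
      div_self hD, qPochInf_one hq, qPochInf_succ hq (C / D)] at h
    simp only [zero_mul, qPochInf_zero, one_mul] at h
    rw [← h, hdeg, show C / D * q = q * C / D by ring, hdeg]
    ring
  · have hFC : qPochInf q (q / D * C) ≠ 0 := by rwa [div_mul_eq_mul_div]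
    have hFD : qPochInf q (q / D * D) ≠ 0 := by rwa [div_mul_cancel₀ _ hD]
    have h := saalIntegral_eq_mul_zero hq (A := 0) (B := 0) hC hD (by simp) (by simp) hFC
      (by simp) (by simp) hFD
    have hk : ∀ x, saalKernel q C D 0 0 (q / D) x =
        qPochInf q (q / D * x) * qPochInf q (q * x / C) / qPochInf q (q / D * x) := by
      intro x
      simp [saalKernel, div_mul_eq_mul_div, mul_comm (qPochInf q (q * x / C))]
    rw [saalIntegral, red C _ (fun n => by
        rw [← mul_assoc]; exact qPochInf_mul_pow_ne_zero hq hFC n) C hk,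
      red D _ (fun n => by
        rw [← mul_assoc]; exact qPochInf_mul_pow_ne_zero hq hFD n) C hk, tel _ _ hC, tel _ _ hC,
      div_self hC, qPochInf_one hq, div_mul_cancel₀ _ hD, div_mul_eq_mul_div] at h
    simp only [zero_mul, qPochInf_zero, one_mul] at h
    rw [← h]
    ring

/-- The nonterminating `q`-Saalschütz formula. -/
theorem saalIntegral_eq (hq0 : q ≠ 0) (hq : ‖q‖ < 1) {C D A B F : ℂ} (hC : C ≠ 0) (hD : D ≠ 0)
    (hAC : qPochInf q (A * C) ≠ 0) (hBC : qPochInf q (B * C) ≠ 0) (hFC : qPochInf q (F * C) ≠ 0)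
    (hAD : qPochInf q (A * D) ≠ 0) (hBD : qPochInf q (B * D) ≠ 0) (hFD : qPochInf q (F * D) ≠ 0) :
    saalIntegral q C D A B F =
    C * qPochInf q q * qPochInf q (q * C / D) * qPochInf q (D / C) *
      (qPochInf q (A * B * C * D) * qPochInf q (A * C * D * F) * qPochInf q (B * C * D * F)) /
      (qPochInf q (A * C) * qPochInf q (A * D) * (qPochInf q (B * C) * qPochInf q (B * D)) *
      (qPochInf q (F * C) * qPochInf q (F * D))) := by
  have z : ∀ x : ℂ, qPochInf q (0 * x) ≠ 0 := fun x => by simp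
  -- The kernel is symmetric in `A`, `B`, `F`, so the reduction applies to each in turn: first `F`,
  -- then `B`, then `A` is sent to 0.
  have h1 := saalIntegral_eq_mul_zero hq hC hD hAC hBC hFC hAD hBD hFD
  have h2 := saalIntegral_eq_mul_zero hq hC hD hAC (z C) hBC hAD (z D) hBD
  have h3 := saalIntegral_eq_mul_zero hq hC hD (z C) (z C) hAC (z D) (z D) hAD
  rw [saalIntegral_swap q C D A 0 B] at h2
  rw [← saalIntegral_rotate q C D A 0 0, saalIntegral_zero hq0 hq hC hD] at h3
  simp only [zero_mul, qPochInf_zero, mul_one, one_mul] at h2 h3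
  rw [eq_div_iff (by simp [*]), show A * B * C * D = A * C * D * B by ring]
  linear_combination (qPochInf q (A * C) * qPochInf q (A * D) * (qPochInf q (B * C) *
      qPochInf q (B * D))) * h1 + (qPochInf q (A * C * D * F) * qPochInf q (B * C * D * F) *
      (qPochInf q (A * C) * qPochInf q (A * D))) * h2 +
      (qPochInf q (A * C * D * F) * qPochInf q (B * C * D * F) * qPochInf q (A * C * D * B)) * h3

end QIntegral

/-! ### Moments of the q-Saalschütz kernel -/

section Moments

open Filter Topology Finset

variable {q : ℂ}

/-- `x (1 - C q ^ n / x)` is `-C q ^ n` times the first factor of `(q x / (C q ^ (n + 1)); q)_∞`.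
Thus the polynomial on the left amounts to the shift `C ↦ C q ^ n` in the kernel. -/
theorem pow_mul_qPoch_mul_qPochInf (hq0 : q ≠ 0) (hq : ‖q‖ < 1) {C x : ℂ} (hC : C ≠ 0)
    (hx : x ≠ 0) (n : ℕ) : x ^ n * qPoch q (C / x) n * qPochInf q (q * x / C) =
    (-C) ^ n * q ^ (n.choose 2) * qPochInf q (q * x / (C * q ^ n)) := by
  induction n with
  | zero => simp
  | succ n ih =>
    have hqn : q ^ n ≠ 0 := pow_ne_zero _ hq0
    have h1 := qPochInf_succ hq (q * x / (C * q ^ (n + 1)))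
    rw [show q * x / (C * q ^ (n + 1)) * q = q * x / (C * q ^ n) by rw [pow_succ]; field_simp] at h1
    rw [h1, qPoch_succ, Nat.choose_succ_succ' n 1, Nat.choose_one_right, pow_add]
    have h2 : (x : ℂ) * (1 - C / x * q ^ n) =
        -C * q ^ n * (1 - q * x / (C * q ^ (n + 1))) := by
      field_simp
      ring
    calc _ = (x ^ n * qPoch q (C / x) n * qPochInf q (q * x / C)) *
          (x * (1 - C / x * q ^ n)) := by ring
      _ = _ := by rw [ih, h2]; ring

/-- Quasi-periodicity of the theta function `(q C / D, D / C; q)_∞` under `C ↦ C q`. -/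
theorem theta_shift (hq0 : q ≠ 0) (hq : ‖q‖ < 1) {C D : ℂ} (hC : C ≠ 0) (hD : D ≠ 0) (n : ℕ) :
    (-C) ^ n * q ^ (n.choose 2) * q ^ n * qPochInf q (q * (C * q ^ n) / D) *
      qPochInf q (D / (C * q ^ n)) = D ^ n * qPochInf q (q * C / D) * qPochInf q (D / C) := by
  induction n with
  | zero => simp
  | succ n ih =>
    have hqn : q ^ n ≠ 0 := pow_ne_zero _ hq0
    have h1 := qPochInf_succ hq (D / (C * q ^ (n + 1)))
    have h2 := qPochInf_succ hq (q * (C * q ^ n) / D)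
    rw [show D / (C * q ^ (n + 1)) * q = D / (C * q ^ n) by rw [pow_succ]; field_simp] at h1
    rw [show q * (C * q ^ n) / D * q = q * (C * q ^ (n + 1)) / D by ring] at h2
    rw [h1, Nat.choose_succ_succ' n 1, Nat.choose_one_right, pow_add]
    have h3 : -C * q ^ (n + 1) * (1 - D / (C * q ^ (n + 1))) = D * (1 - q * (C * q ^ n) / D) := by
      field_simp
      ring
    calc _ = ((-C) ^ n * q ^ (n.choose 2) * q ^ n * qPochInf q (q * (C * q ^ (n + 1)) / D) *
          qPochInf q (D / (C * q ^ n))) * (-C * q ^ (n + 1) * (1 - D / (C * q ^ (n + 1)))) := by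
          ring
      _ = D * ((-C) ^ n * q ^ (n.choose 2) * q ^ n *
          ((1 - q * (C * q ^ n) / D) * qPochInf q (q * (C * q ^ (n + 1)) / D)) *
          qPochInf q (D / (C * q ^ n))) := by rw [h3]; ring
      _ = _ := by rw [← h2, ih]; ring

/-- The integrand whose Jackson integrals are the moments `∫ x ^ k / (λx; q)_k`. -/
noncomputable def momentKernel (q C D A B F : ℂ) (k : ℕ) (x : ℂ) : ℂ :=
  x ^ k * (qPochInf q (q * x / C) * qPochInf q (q * x / D) *
    qPochInf q (A * B * C * D * F * x * q ^ k) /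
    (qPochInf q (A * x) * qPochInf q (B * x) * qPochInf q (F * x)))

/-- q-Chu-Vandermonde, the case `c = 0` of the Saalschütz sum, expands `(C F; q)_k` in products `(C
/ x; q)_(p.1) (F x; q)_(p.2)`. The first factor turns `C` into `C q ^ p.1`, the second turns `F`
into `F q ^ p.2`; since `p.1 + p.2 = k`, the balancing parameter acquires exactly the `q ^ k`
already present. -/
theorem qPoch_mul_momentKernel (hq0 : q ≠ 0) (hq : ‖q‖ < 1) {C D A B F x : ℂ} (hC : C ≠ 0)
    (hx : x ≠ 0) (hFx : qPochInf q (F * x) ≠ 0) (k : ℕ) :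
    qPoch q (C * F) k * momentKernel q C D A B F k x =
    ∑ p ∈ HasAntidiagonal.antidiagonal k, qPoch q q k / (qPoch q q p.1 * qPoch q q p.2) *
      (C ^ p.2 * ((-C) ^ p.1 * q ^ (p.1.choose 2))) *
      saalKernel q (C * q ^ p.1) D A B (F * q ^ p.2) x := by
  have h0 := qPoch_self_ne_zero hq k
  have hs := sum_antidiagonal_saalschuetz hq (F * x) 0 (C / x) k
  simp only [mul_zero, zero_mul, qPoch_zero_left, mul_one] at hs
  rw [show F * x * (C / x) = C * F by field_simp, eq_div_iff h0] at hs
  rw [← hs, ← Finset.Nat.sum_antidiagonal_swap, Finset.sum_mul, Finset.sum_mul]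
  refine Finset.sum_congr rfl fun p hp => ?_
  rw [HasAntidiagonal.mem_antidiagonal] at hp
  simp only [Prod.fst_swap, Prod.snd_swap]
  have h1 := pow_mul_qPoch_mul_qPochInf hq0 hq hC hx p.1
  have h2 := qPochInf_eq hq (F * x) p.2
  have h3 : qPochInf q (F * x * q ^ p.2) ≠ 0 := qPochInf_mul_pow_ne_zero hq hFx _
  rw [momentKernel, saalKernel, show A * B * (C * q ^ p.1) * D * (F * q ^ p.2) * x =
    A * B * C * D * F * x * q ^ k by rw [← hp]; ring,
    show F * q ^ p.2 * x = F * x * q ^ p.2 by ring]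
  have h4 : qPoch q (F * x) p.2 / qPochInf q (F * x) = (qPochInf q (F * x * q ^ p.2))⁻¹ := by
    rw [div_eq_iff hFx, h2, mul_left_comm, inv_mul_cancel₀ h3, mul_one]
  calc _ = (x ^ p.1 * qPoch q (C / x) p.1 * qPochInf q (q * x / C)) *
        (qPoch q (F * x) p.2 / qPochInf q (F * x)) * ((C / x) ^ p.2 * x ^ p.2) *
        (qPoch q q k / (qPoch q q p.1 * qPoch q q p.2) * (qPochInf q (q * x / D) *
        qPochInf q (A * B * C * D * F * x * q ^ k) /
        (qPochInf q (A * x) * qPochInf q (B * x)))) := by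
        rw [← hp, pow_add]; ring
    _ = _ := by
        rw [h1, h4, ← mul_pow, div_mul_cancel₀ _ hx]
        ring

theorem jacksonSum_shift {y : ℂ} {h : ℂ → ℂ} (hs : Summable fun n : ℕ => y * q ^ n * h (y * q ^ n))
    {n : ℕ} (hz : ∀ i < n, h (y * q ^ i) = 0) : jacksonSum q y h = jacksonSum q (y * q ^ n) h := by
  rw [jacksonSum, ← hs.sum_add_tsum_nat_add n, Finset.sum_eq_zero (fun i hi => by
    rw [hz i (Finset.mem_range.1 hi), mul_zero]), zero_add]
  exact tsum_congr fun i => by rw [pow_add, mul_comm (q ^ i), ← mul_assoc y]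

/-- The shifted kernel vanishes at `x = C q ^ i` for `i < n`. So the sum from `C` may start at the
shifted endpoint, as the q-Saalschütz formula requires. -/
theorem jacksonSum_saalKernel_shift (hq0 : q ≠ 0) (hq : ‖q‖ < 1) {C D A B F : ℂ} (hC : C ≠ 0)
    (hA : qPochInf q (A * C) ≠ 0) (hB : qPochInf q (B * C) ≠ 0) (hF : qPochInf q (F * C) ≠ 0)
    (n : ℕ) : jacksonSum q C (saalKernel q (C * q ^ n) D A B F) =
    jacksonSum q (C * q ^ n) (saalKernel q (C * q ^ n) D A B F) := by
  refine jacksonSum_shift (summable_saalKernel hq hA hB hF) fun i hi => ?_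
  have hqn : ∀ n : ℕ, q ^ n ≠ 0 := fun n => pow_ne_zero _ hq0
  obtain ⟨j, rfl⟩ : ∃ j, n = i + j + 1 := ⟨n - i - 1, by omega⟩
  have : qPochInf q (q * (C * q ^ i) / (C * q ^ (i + j + 1))) = 0 := by
    refine qPochInf_eq_zero hq (n := j) ?_
    have := hqn i
    have := hqn j
    rw [show q ^ (i + j + 1) = q ^ i * q ^ j * q by ring]
    field_simp
  simp [saalKernel, this]

theorem jacksonSum_momentKernel (hq0 : q ≠ 0) (hq : ‖q‖ < 1) {C D A B F y : ℂ} (hC : C ≠ 0)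
    (hy : y ≠ 0) (hA : qPochInf q (A * y) ≠ 0) (hB : qPochInf q (B * y) ≠ 0)
    (hF : qPochInf q (F * y) ≠ 0) (k : ℕ) :
    qPoch q (C * F) k * jacksonSum q y (momentKernel q C D A B F k) =
    ∑ p ∈ HasAntidiagonal.antidiagonal k, qPoch q q k / (qPoch q q p.1 * qPoch q q p.2) *
      (C ^ p.2 * ((-C) ^ p.1 * q ^ (p.1.choose 2))) *
      jacksonSum q y (saalKernel q (C * q ^ p.1) D A B (F * q ^ p.2)) := by
  have hF' : ∀ j : ℕ, qPochInf q (F * q ^ j * y) ≠ 0 := fun j => by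
    rw [mul_right_comm]; exact qPochInf_mul_pow_ne_zero hq hF j
  have h1 : ∀ n : ℕ, qPoch q (C * F) k * (y * q ^ n * momentKernel q C D A B F k (y * q ^ n)) =
      ∑ p ∈ HasAntidiagonal.antidiagonal k, qPoch q q k / (qPoch q q p.1 * qPoch q q p.2) *
      (C ^ p.2 * ((-C) ^ p.1 * q ^ (p.1.choose 2))) *
      (y * q ^ n * saalKernel q (C * q ^ p.1) D A B (F * q ^ p.2) (y * q ^ n)) := by
    intro n
    have hFn := qPochInf_mul_pow_ne_zero hq hF n
    rw [mul_assoc] at hFn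
    rw [mul_left_comm, qPoch_mul_momentKernel hq0 hq hC
      (mul_ne_zero hy (pow_ne_zero _ hq0)) hFn k, Finset.mul_sum]
    exact Finset.sum_congr rfl fun p _ => by ring
  have h3 := hasSum_sum (s := HasAntidiagonal.antidiagonal k) fun p _ =>
    (summable_saalKernel (C := C * q ^ p.1) (D := D) hq hA hB (hF' p.2)).hasSum.mul_left
      (qPoch q q k / (qPoch q q p.1 * qPoch q q p.2) *
        (C ^ p.2 * ((-C) ^ p.1 * q ^ (p.1.choose 2))))
  have h4 := tsum_congr (L := .unconditional ℕ) h1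
  rw [tsum_mul_left, h3.tsum_eq] at h4
  exact h4

/-- Each term of the expansion is a q-Saalschütz integral. The shifts in `A C D F`, `B C D F` and `F
C` depend on `k` only, and `theta_shift` turns the power of `-C` into `D ^ p.1`. What remains is a
function of `p.1` times a function of `p.2`, so that the later sum over `k` decouples. -/
theorem moment_eq (hq0 : q ≠ 0) (hq : ‖q‖ < 1) {C D A B F : ℂ} (hC : C ≠ 0) (hD : D ≠ 0)
    (hAC : qPochInf q (A * C) ≠ 0) (hBC : qPochInf q (B * C) ≠ 0) (hFC : qPochInf q (F * C) ≠ 0)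
    (hAD : qPochInf q (A * D) ≠ 0) (hBD : qPochInf q (B * D) ≠ 0) (hFD : qPochInf q (F * D) ≠ 0)
    (k : ℕ) :
    qPoch q (A * C * D * F) k * qPoch q (B * C * D * F) k / qPoch q q k *
      (jacksonSum q C (momentKernel q C D A B F k) -
        jacksonSum q D (momentKernel q C D A B F k)) =
    C * qPochInf q q * qPochInf q (q * C / D) * qPochInf q (D / C) *
      (qPochInf q (A * C * D * F) * qPochInf q (B * C * D * F)) /
      (qPochInf q (A * D) * qPochInf q (B * D) * qPochInf q (F * C)) *
    ∑ p ∈ HasAntidiagonal.antidiagonal k, D ^ p.1 * C ^ p.2 / (qPoch q q p.1 * qPoch q q p.2) *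
      (qPochInf q (A * B * C * D * q ^ p.1) / (qPochInf q (A * C * q ^ p.1) *
        qPochInf q (B * C * q ^ p.1) * qPochInf q (F * D * q ^ p.2))) := by
  have hCF : qPoch q (C * F) k ≠ 0 := by
    rw [mul_comm C F]
    rw [qPochInf_eq hq _ k] at hFC
    exact left_ne_zero_of_mul hFC
  have h0 := qPoch_self_ne_zero hq
  apply mul_left_cancel₀ hCF
  rw [mul_left_comm, mul_sub, jacksonSum_momentKernel hq0 hq hC hC hAC hBC hFC,
    jacksonSum_momentKernel hq0 hq hC hD hAD hBD hFD, ← Finset.sum_sub_distrib, Finset.mul_sum,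
    Finset.mul_sum, Finset.mul_sum]
  refine Finset.sum_congr rfl fun p hp => ?_
  rw [HasAntidiagonal.mem_antidiagonal] at hp
  have hFC' : qPochInf q (F * q ^ p.2 * C) ≠ 0 := by
    rw [mul_right_comm]; exact qPochInf_mul_pow_ne_zero hq hFC _
  have hFD' : qPochInf q (F * q ^ p.2 * D) ≠ 0 := by
    rw [mul_right_comm]; exact qPochInf_mul_pow_ne_zero hq hFD _
  have n1 : qPochInf q (A * (C * q ^ p.1)) ≠ 0 := by
    rw [← mul_assoc]; exact qPochInf_mul_pow_ne_zero hq hAC _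
  have n2 : qPochInf q (B * (C * q ^ p.1)) ≠ 0 := by
    rw [← mul_assoc]; exact qPochInf_mul_pow_ne_zero hq hBC _
  have n3 : qPochInf q (F * q ^ p.2 * (C * q ^ p.1)) ≠ 0 := by
    rw [← mul_assoc]; exact qPochInf_mul_pow_ne_zero hq hFC' _
  have hI := saalIntegral_eq hq0 hq (mul_ne_zero hC (pow_ne_zero p.1 hq0)) hD n1 n2 n3 hAD hBD hFD'
  rw [saalIntegral] at hI
  rw [← mul_sub, jacksonSum_saalKernel_shift hq0 hq hC hAC hBC hFC', hI]
  have t := theta_shift hq0 hq hC hD p.1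
  have e1 := qPochInf_eq hq (A * C * D * F) k
  have e2 := qPochInf_eq hq (B * C * D * F) k
  have e3 := qPochInf_eq hq (F * C) k
  have e3' : qPochInf q (F * C * q ^ k) ≠ 0 := qPochInf_mul_pow_ne_zero hq hFC _
  rw [show A * (C * q ^ p.1) * D * (F * q ^ p.2) = A * C * D * F * q ^ k by rw [← hp]; ring,
    show B * (C * q ^ p.1) * D * (F * q ^ p.2) = B * C * D * F * q ^ k by rw [← hp]; ring,
    show F * q ^ p.2 * (C * q ^ p.1) = F * C * q ^ k by rw [← hp]; ring,
    show A * B * (C * q ^ p.1) * D = A * B * C * D * q ^ p.1 by ring,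
    show A * (C * q ^ p.1) = A * C * q ^ p.1 by ring,
    show B * (C * q ^ p.1) = B * C * q ^ p.1 by ring,
    show F * q ^ p.2 * D = F * D * q ^ p.2 by ring, e1, e2]
  have e4 : (qPochInf q (F * C * q ^ k))⁻¹ = qPoch q (C * F) k / qPochInf q (F * C) := by
    rw [mul_comm C F, inv_eq_one_div, div_eq_div_iff e3' hFC, one_mul, e3]
  have hk := h0 k
  have kk : qPoch q q k * (qPoch q q k)⁻¹ = 1 := mul_inv_cancel₀ hk
  calc _ = (qPoch q q k * (qPoch q q k)⁻¹) * ((-C) ^ p.1 * q ^ (p.1.choose 2) * q ^ p.1 *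
        qPochInf q (q * (C * q ^ p.1) / D) * qPochInf q (D / (C * q ^ p.1))) *
        ((qPochInf q (F * C * q ^ k))⁻¹ * (C * qPochInf q q * C ^ p.2 *
        (qPoch q (A * C * D * F) k * qPochInf q (A * C * D * F * q ^ k)) *
        (qPoch q (B * C * D * F) k * qPochInf q (B * C * D * F * q ^ k)) *
        qPochInf q (A * B * C * D * q ^ p.1) / (qPoch q q p.1 * qPoch q q p.2) /
        (qPochInf q (A * C * q ^ p.1) * qPochInf q (A * D) * (qPochInf q (B * C * q ^ p.1) *
        qPochInf q (B * D)) * qPochInf q (F * D * q ^ p.2)))) := by ring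
    _ = _ := by rw [kk, t, e4]; ring

end Moments

/-! ### The Jackson integral of the Barnes core -/

section JacksonIdentity

open Filter Topology Finset

variable {q : ℂ}

/-- The factor of the Barnes integrand that is a function of `x = q ^ s`, with the
denominators of the `₃φ₂` series absorbed into the infinite products. -/
noncomputable def barnesCore (q A B C D E F G x : ℂ) : ℂ :=
  qPochInf q (q * x / C) * qPochInf q (q * x / D) /
    (qPochInf q (A * x) * qPochInf q (B * x) * qPochInf q (F * x) * qPochInf q (G * x)) *
  ∑' n, qPoch q E n * qPoch q (A * x) n * qPoch q (B * x) n / qPoch q q n *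
    (qPochInf q (A * B * C * D * F * x * q ^ n) * qPochInf q (E * G * x * q ^ n)) *
    (C * D * F * G) ^ n

/-- In the transformation with `y = C D F / x` and `u = G x` the quantities `b y`, `c y` and `E y u`
are free of `x`, and `(G x; q)_∞` cancels. The variable survives only in the moment kernel. -/
theorem barnesCore_eq_tsum (hq : ‖q‖ < 1) (A B C D E F : ℂ) {G x : ℂ} (hx : x ≠ 0)
    (hGx : ‖G * x‖ < 1) (hw : ‖C * D * F * G‖ < 1) :
    qPochInf q (C * D * F * G) * barnesCore q A B C D E F G x =
    ∑' k, qPoch q E k * qPoch q (A * C * D * F) k * qPoch q (B * C * D * F) k / qPoch q q k *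
      qPochInf q (E * C * D * F * G * q ^ k) * G ^ k * momentKernel q C D A B F k x := by
  have hG0 := qPochInf_ne_zero_of_norm_lt hq hGx
  have h := tsum_phi32_transformation hq E (A * x) (B * x) (C * D * F / x) hGx
    (by rwa [show C * D * F / x * (G * x) = C * D * F * G by field_simp])
  rw [show C * D * F / x * (G * x) = C * D * F * G by field_simp,
    show A * x * (B * x) * (C * D * F / x) = A * B * C * D * F * x by field_simp,
    show A * x * (C * D * F / x) = A * C * D * F by field_simp,
    show B * x * (C * D * F / x) = B * C * D * F by field_simp,
    show E * (C * D * F / x) * (G * x) = E * C * D * F * G by field_simp] at h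
  simp only [← mul_assoc E G x] at h
  rw [barnesCore, mul_left_comm, h]
  rw [← mul_assoc, show qPochInf q (q * x / C) * qPochInf q (q * x / D) /
    (qPochInf q (A * x) * qPochInf q (B * x) * qPochInf q (F * x) * qPochInf q (G * x)) *
    qPochInf q (G * x) = qPochInf q (q * x / C) * qPochInf q (q * x / D) /
    (qPochInf q (A * x) * qPochInf q (B * x) * qPochInf q (F * x)) by
    rw [← div_div, div_mul_cancel₀ _ hG0], ← tsum_mul_left]
  refine tsum_congr fun k => ?_
  rw [momentKernel, mul_pow]
  ring

/-- This is the moment kernel without its factor `x ^ k`, bounded uniformly in `k` and in the node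
`y q ^ n`. -/
theorem bddFamily_momentKernel (hq : ‖q‖ < 1) {C D A B F y : ℂ} (hA : qPochInf q (A * y) ≠ 0)
    (hB : qPochInf q (B * y) ≠ 0) (hF : qPochInf q (F * y) ≠ 0) {ι : Type*} (k n : ι → ℕ) :
    BddFamily fun i => qPochInf q (q * (y * q ^ n i) / C) * qPochInf q (q * (y * q ^ n i) / D) *
      qPochInf q (A * B * C * D * F * (y * q ^ n i) * q ^ k i) /
      (qPochInf q (A * (y * q ^ n i)) * qPochInf q (B * (y * q ^ n i)) *
      qPochInf q (F * (y * q ^ n i))) := by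
  have h : ∀ i, qPochInf q (q * (y * q ^ n i) / C) * qPochInf q (q * (y * q ^ n i) / D) *
      qPochInf q (A * B * C * D * F * (y * q ^ n i) * q ^ k i) /
      (qPochInf q (A * (y * q ^ n i)) * qPochInf q (B * (y * q ^ n i)) *
      qPochInf q (F * (y * q ^ n i))) =
      qPochInf q (q * y / C * q ^ n i) * qPochInf q (q * y / D * q ^ n i) *
      qPochInf q (A * B * C * D * F * y * q ^ (n i + k i)) / qPochInf q (A * y * q ^ n i) /
      qPochInf q (B * y * q ^ n i) / qPochInf q (F * y * q ^ n i) := by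
    intro i
    rw [div_div, div_div, show q * (y * q ^ n i) / C = q * y / C * q ^ n i by ring,
      show q * (y * q ^ n i) / D = q * y / D * q ^ n i by ring, pow_add,
      ← mul_assoc A y, ← mul_assoc B y, ← mul_assoc F y, ← mul_assoc (A * B * C * D * F),
      ← mul_assoc (A * B * C * D * F * y)]
    ring
  simp only [h]
  exact ((((((BddFamily.const_mul_pow hq _ _).comp_qPochInf hq).mul
    ((BddFamily.const_mul_pow hq _ _).comp_qPochInf hq)).mul
    ((BddFamily.const_mul_pow hq _ _).comp_qPochInf hq)).div_qPochInf_mul_pow hq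
    hA _).div_qPochInf_mul_pow hq hB _).div_qPochInf_mul_pow hq hF _

theorem jacksonSum_barnesCore (hq0 : q ≠ 0) (hq : ‖q‖ < 1) {A B C D E F G y : ℂ} (hy : y ≠ 0)
    (hA : qPochInf q (A * y) ≠ 0) (hB : qPochInf q (B * y) ≠ 0) (hF : qPochInf q (F * y) ≠ 0)
    (hGy : ‖G * y‖ < 1) (hw : ‖C * D * F * G‖ < 1) :
    HasSum (fun k => qPoch q E k * qPoch q (A * C * D * F) k * qPoch q (B * C * D * F) k /
      qPoch q q k * qPochInf q (E * C * D * F * G * q ^ k) * G ^ k *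
      jacksonSum q y (momentKernel q C D A B F k))
      (qPochInf q (C * D * F * G) * jacksonSum q y (barnesCore q A B C D E F G)) := by
  let f : ℕ × ℕ → ℂ := fun p => qPoch q E p.1 * qPoch q (A * C * D * F) p.1 *
    qPoch q (B * C * D * F) p.1 / qPoch q q p.1 *
    qPochInf q (E * C * D * F * G * q ^ p.1) * G ^ p.1 *
    (y * q ^ p.2 * momentKernel q C D A B F p.1 (y * q ^ p.2))
  have hf : Summable f := by
    have b1 : BddFamily fun p : ℕ × ℕ => qPoch q E p.1 * qPoch q (A * C * D * F) p.1 *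
        qPoch q (B * C * D * F) p.1 / qPoch q q p.1 :=
      ((((BddFamily.const E).comp_qPoch hq _).mul
        ((BddFamily.const (A * C * D * F)).comp_qPoch hq _)).mul
        ((BddFamily.const (B * C * D * F)).comp_qPoch hq _)).div_qPoch_self hq _
    have b2 : BddFamily fun p : ℕ × ℕ => qPochInf q (E * C * D * F * G * q ^ p.1) :=
      (BddFamily.const_mul_pow hq (E * C * D * F * G) _).comp_qPochInf hq
    -- From `(y q ^ n) ^ k` the part `y ^ k` joins `G ^ k` to form the ratio `G y`, and `q ^ (n k)`
    -- is merely bounded; the weight `q ^ n` of the Jackson sum gives convergence in `n`.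
    have b3 : BddFamily fun p : ℕ × ℕ => y * q ^ (p.2 * p.1) := .const_mul_pow hq y _
    have hb := ((b1.mul b2).mul b3).mul (bddFamily_momentKernel hq (C := C) (D := D) hA hB hF
      (fun p : ℕ × ℕ => p.1) fun p => p.2)
    refine (hb.summable_mul_pow_mul_pow hGy hq).congr fun p => ?_
    simp only [f, momentKernel, mul_pow, pow_mul]
    ring
  have h1 : ∀ k, ∑' n, f (k, n) = qPoch q E k * qPoch q (A * C * D * F) k *
      qPoch q (B * C * D * F) k / qPoch q q k * qPochInf q (E * C * D * F * G * q ^ k) * G ^ k *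
      jacksonSum q y (momentKernel q C D A B F k) := fun k => by
    simp only [f]; rw [tsum_mul_left, jacksonSum]
  have h2 : ∀ n, ∑' k, f (k, n) =
      qPochInf q (C * D * F * G) * (y * q ^ n * barnesCore q A B C D E F G (y * q ^ n)) := by
    intro n
    have hG' : ‖G * (y * q ^ n)‖ < 1 := by
      rw [← mul_assoc]
      exact (norm_mul_pow_le hq le_rfl n).trans_lt hGy
    rw [mul_left_comm, barnesCore_eq_tsum hq A B C D E F (mul_ne_zero hy (pow_ne_zero _ hq0)) hG'
      hw, ← tsum_mul_left]
    exact tsum_congr fun k => by simp only [f]; ring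
  have h3 : HasSum (fun k => ∑' n, f (k, n)) (∑' k, ∑' n, f (k, n)) :=
    hf.prod.hasSum
  have hsw : Summable (Function.uncurry fun k n => f (k, n)) := hf
  rw [← hsw.tsum_comm] at h3
  simp only [h1, h2] at h3
  rwa [tsum_mul_left] at h3

/-- The Jackson integral behind the Barnes integral: its value is a single `₃φ₂` series. -/
theorem jacksonSum_barnesCore_sub (hq0 : q ≠ 0) (hq : ‖q‖ < 1) {A B C D E F G : ℂ}
    (hC : C ≠ 0) (hD : D ≠ 0)
    (hAC : qPochInf q (A * C) ≠ 0) (hBC : qPochInf q (B * C) ≠ 0) (hFC : qPochInf q (F * C) ≠ 0)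
    (hAD : qPochInf q (A * D) ≠ 0) (hBD : qPochInf q (B * D) ≠ 0) (hFD : qPochInf q (F * D) ≠ 0)
    (hGC : ‖G * C‖ < 1) (hGD : ‖G * D‖ < 1) (hw : ‖C * D * F * G‖ < 1) :
    jacksonSum q C (barnesCore q A B C D E F G) - jacksonSum q D (barnesCore q A B C D E F G) =
    C * qPochInf q q * qPochInf q (q * C / D) * qPochInf q (D / C) *
      (qPochInf q (A * C * D * F) * qPochInf q (B * C * D * F)) /
      (qPochInf q (A * D) * qPochInf q (B * D) * qPochInf q (F * C) * qPochInf q (F * D) *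
        qPochInf q (G * C)) *
    ∑' n, qPoch q E n / qPoch q q n * (qPochInf q (A * B * C * D * q ^ n) /
      (qPochInf q (A * C * q ^ n) * qPochInf q (B * C * q ^ n)) *
      qPochInf q (E * G * C * q ^ n)) * (G * D) ^ n := by
  have hw0 := qPochInf_ne_zero_of_norm_lt hq hw
  have hGC0 := qPochInf_ne_zero_of_norm_lt hq hGC
  apply mul_left_cancel₀ hw0
  rw [mul_sub, ← (jacksonSum_barnesCore hq0 hq hC hAC hBC hFC hGC hw).tsum_eq,
    ← (jacksonSum_barnesCore hq0 hq hD hAD hBD hFD hGD hw).tsum_eq,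
    ← (jacksonSum_barnesCore hq0 hq hC hAC hBC hFC hGC hw).summable.tsum_sub
      (jacksonSum_barnesCore hq0 hq hD hAD hBD hFD hGD hw).summable]
  -- With `k = p.1 + p.2`, the factor `(E; q)_k` is split so that the sum over `p.2` is a q-Gauss
  -- sum with `α = E q ^ p.1`, `β = F D` and `z = G C`; the sum over `p.1` is the series that
  -- remains.
  let f : ℕ × ℕ → ℂ := fun p => (qPoch q E p.1 * qPoch q (E * q ^ p.1) p.2 / qPoch q q p.1 *
    (1 / qPoch q q p.2) * qPochInf q (E * C * D * F * G * q ^ (p.1 + p.2)) *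
    (qPochInf q (A * B * C * D * q ^ p.1) / qPochInf q (A * C * q ^ p.1) /
    qPochInf q (B * C * q ^ p.1)) * (1 / qPochInf q (F * D * q ^ p.2))) *
    ((G * D) ^ p.1 * (G * C) ^ p.2)
  have hf : Summable f := by
    refine BddFamily.summable_mul_pow_mul_pow ?_ hGD hGC
    exact ((((((BddFamily.const E).comp_qPoch hq _).mul
      ((BddFamily.const_mul_pow hq _ _).comp_qPoch hq _)).div_qPoch_self hq _).mul
      ((BddFamily.const 1).div_qPoch_self hq _)).mul
      ((BddFamily.const_mul_pow hq _ _).comp_qPochInf hq)).mul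
      ((((BddFamily.const_mul_pow hq _ _).comp_qPochInf hq).div_qPochInf_mul_pow hq
      hAC _).div_qPochInf_mul_pow hq hBC _) |>.mul
      ((BddFamily.const 1).div_qPochInf_mul_pow hq hFD _)
  have h := tsum_tsum_eq_tsum_antidiagonal hf
  set κ := C * qPochInf q q * qPochInf q (q * C / D) * qPochInf q (D / C) *
      (qPochInf q (A * C * D * F) * qPochInf q (B * C * D * F)) with hκ
  have h1 : ∀ k, qPoch q E k * qPoch q (A * C * D * F) k * qPoch q (B * C * D * F) k /
      qPoch q q k * qPochInf q (E * C * D * F * G * q ^ k) * G ^ k *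
      jacksonSum q C (momentKernel q C D A B F k) - qPoch q E k * qPoch q (A * C * D * F) k *
      qPoch q (B * C * D * F) k / qPoch q q k * qPochInf q (E * C * D * F * G * q ^ k) * G ^ k *
      jacksonSum q D (momentKernel q C D A B F k) =
      κ / (qPochInf q (A * D) * qPochInf q (B * D) * qPochInf q (F * C)) *
      ∑ p ∈ HasAntidiagonal.antidiagonal k, f p := by
    intro k
    have hm := moment_eq hq0 hq hC hD hAC hBC hFC hAD hBD hFD k
    rw [← hκ] at hm
    rw [← mul_sub]
    calc _ = qPoch q E k * qPochInf q (E * C * D * F * G * q ^ k) * G ^ k *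
          (qPoch q (A * C * D * F) k * qPoch q (B * C * D * F) k / qPoch q q k *
          (jacksonSum q C (momentKernel q C D A B F k) -
          jacksonSum q D (momentKernel q C D A B F k))) := by ring
      _ = _ := by
        rw [hm, mul_left_comm, Finset.mul_sum]
        congr 1
        refine Finset.sum_congr rfl fun p hp => ?_
        rw [HasAntidiagonal.mem_antidiagonal] at hp
        subst hp
        simp only [f]
        rw [qPoch_add, mul_pow, mul_pow, pow_add G]
        ring
  have h2 : ∀ n, ∑' j, f (n, j) = qPochInf q (C * D * F * G) / (qPochInf q (F * D) *
      qPochInf q (G * C)) * (qPoch q E n / qPoch q q n * (qPochInf q (A * B * C * D * q ^ n) /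
      (qPochInf q (A * C * q ^ n) * qPochInf q (B * C * q ^ n)) *
      qPochInf q (E * G * C * q ^ n)) * (G * D) ^ n) := by
    intro n
    have hg := tsum_gauss hq (E * q ^ n) (F * D) hGC
    rw [show E * q ^ n * (G * C) = E * G * C * q ^ n by ring,
      show F * D * (G * C) = C * D * F * G by ring] at hg
    have : ∑' j, f (n, j) = (qPoch q E n / qPoch q q n * (qPochInf q (A * B * C * D * q ^ n) /
        (qPochInf q (A * C * q ^ n) * qPochInf q (B * C * q ^ n))) * (G * D) ^ n /
        qPochInf q (F * D)) * ∑' j, qPoch q (E * q ^ n) j *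
        qPoch q (F * D) j / qPoch q q j * qPochInf q (E * q ^ n * (F * D) * (G * C) * q ^ j) *
        (G * C) ^ j := by
      rw [← tsum_mul_left]
      refine tsum_congr fun j => ?_
      simp only [f]
      have e1 := qPochInf_eq hq (F * D) j
      have e2 : qPochInf q (F * D * q ^ j) ≠ 0 := qPochInf_mul_pow_ne_zero hq hFD _
      have e3 : 1 / qPochInf q (F * D * q ^ j) = qPoch q (F * D) j / qPochInf q (F * D) := by
        rw [div_eq_div_iff e2 hFD, one_mul, e1]
      rw [e3, show E * q ^ n * (F * D) * (G * C) * q ^ j = E * C * D * F * G * q ^ (n + j) by ring]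
      ring
    rw [this, hg]
    ring
  simp only [h1]
  rw [tsum_mul_left, ← h]
  simp only [h2]
  rw [tsum_mul_left]
  ring

end JacksonIdentity

/-! ### A residue theorem for abstract cycles -/

section Residues

open Filter Topology Finset

/-- The axioms of integration over a cycle with image in `Z` which enter the residue theorem. -/
structure IsCycleFunctional (Λ : (ℂ → ℂ) → ℂ) (Z : Set ℂ) : Prop where
  add : ∀ f g, ContinuousOn f Z → ContinuousOn g Z → Λ (fun z => f z + g z) = Λ f + Λ g
  const_mul : ∀ (c : ℂ) f, Λ (fun z => c * f z) = c * Λ f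
  congr : ∀ f g, Set.EqOn f g Z → Λ f = Λ g
  exact : ∀ f Φ, ContinuousOn f Z → (∀ z ∈ Z, HasDerivAt Φ (f z) z) → Λ f = 0

/-- A principal part of order at most `n` at `p`. -/
noncomputable def principalPart (p : ℂ) (n : ℕ) (a : ℕ → ℂ) (z : ℂ) : ℂ :=
  ∑ j ∈ range n, a j * ((z - p) ^ (j + 1))⁻¹

theorem differentiableAt_principalPart {p z : ℂ} (hz : z ≠ p) (n : ℕ) (a : ℕ → ℂ) :
    DifferentiableAt ℂ (principalPart p n a) z := by
  have h : z - p ≠ 0 := sub_ne_zero.2 hz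
  unfold principalPart
  refine DifferentiableAt.fun_sum fun j _ => ?_
  have h1 : DifferentiableAt ℂ (fun z => (z - p) ^ (j + 1)) z := by fun_prop
  exact (h1.fun_inv (pow_ne_zero _ h)).const_mul _

/-- Taylor expansion by divided differences: `h z = h p + (z - p) * dslope h p z`, repeated `n`
times. The clause for `n = 1` identifies the residue at a simple pole. -/
theorem exists_principalPart {p : ℂ} (n : ℕ) {h : ℂ → ℂ} (hh : AnalyticAt ℂ h p) :
    ∃ (a : ℕ → ℂ) (g : ℂ → ℂ), AnalyticAt ℂ g p ∧ (n = 1 → a 0 = h p) ∧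
      ∀ z ≠ p, h z * ((z - p) ^ n)⁻¹ = g z + principalPart p n a z := by
  induction n generalizing h with
  | zero => exact ⟨0, h, hh, by simp, by simp [principalPart]⟩
  | succ n ih =>
    have hd : AnalyticAt ℂ (dslope h p) p := by
      rw [Complex.analyticAt_iff_eventually_differentiableAt] at hh
      obtain ⟨s, hs, hso, hps⟩ := eventually_nhds_iff.1 hh
      have h1 : DifferentiableOn ℂ h s := fun z hz => (hs z hz).differentiableWithinAt
      exact ((Complex.differentiableOn_dslope (hso.mem_nhds hps)).2 h1).analyticAt
        (hso.mem_nhds hps)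
    obtain ⟨a, g, hg, -, hag⟩ := ih hd
    refine ⟨Function.update a n (h p), g, hg, fun hn => ?_, fun z hz => ?_⟩
    · obtain rfl : n = 0 := by omega
      simp
    · have hz' : z - p ≠ 0 := sub_ne_zero.2 hz
      have h2 : principalPart p (n + 1) (Function.update a n (h p)) z =
          principalPart p n a z + h p * ((z - p) ^ (n + 1))⁻¹ := by
        rw [principalPart, Finset.sum_range_succ, Function.update_self, principalPart]
        congr 1
        refine Finset.sum_congr rfl fun j hj => ?_
        rw [Function.update_of_ne (Finset.mem_range.1 hj).ne]
      rw [h2, ← add_assoc, ← hag z hz, dslope_of_ne _ hz, slope_def_field]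
      field_simp
      ring

/-- The powers `(z - p) ^ (-m)` with `m ≥ 2` have primitives off `p`, so only the coefficient of `(z
- p)⁻¹` counts. For `n = 0` that coefficient is not part of the function, hence the condition `hn`.
-/
theorem IsCycleFunctional.apply_principalPart {Λ : (ℂ → ℂ) → ℂ} {Z : Set ℂ}
    (hΛ : IsCycleFunctional Λ Z) {p : ℂ} (hp : p ∉ Z) (n : ℕ) (a : ℕ → ℂ)
    (hn : n = 0 → a 0 = 0) : Λ (principalPart p n a) = a 0 * Λ (fun z => (z - p)⁻¹) := by
  have hne : ∀ z ∈ Z, z ≠ p := fun z hz h => hp (h ▸ hz)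
  induction n with
  | zero =>
    have := hΛ.const_mul 0 fun z => (z - p)⁻¹
    have h2 : principalPart p 0 a = fun z => 0 * (z - p)⁻¹ := by
      funext z; simp [principalPart]
    rw [h2, this, hn rfl]
  | succ n ih =>
    have h1 : principalPart p (n + 1) a =
        fun z => principalPart p n a z + a n * ((z - p) ^ (n + 1))⁻¹ := by
      funext z
      rw [principalPart, Finset.sum_range_succ, principalPart]
    have hc : ∀ m : ℕ, ContinuousOn (fun z => ((z - p) ^ m)⁻¹) Z := fun m =>
      ContinuousOn.inv₀ (by fun_prop) fun z hz => pow_ne_zero _ (sub_ne_zero.2 (hne z hz))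
    have hcp : ContinuousOn (principalPart p n a) Z := fun z hz =>
      (differentiableAt_principalPart (hne z hz) n a).continuousAt.continuousWithinAt
    have hcn : ContinuousOn (fun z => a n * ((z - p) ^ (n + 1))⁻¹) Z :=
      continuousOn_const.mul (hc (n + 1))
    rw [h1, hΛ.add _ _ hcp hcn, hΛ.const_mul]
    cases n with
    | zero =>
      have h2 := hΛ.const_mul 0 fun z => (z - p)⁻¹
      have h3 : principalPart p 0 a = fun z => 0 * (z - p)⁻¹ := by
        funext z; simp [principalPart]
      rw [h3, h2]
      simp
    | succ n =>
      rw [ih (by simp), hΛ.exact (fun z => ((z - p) ^ (n + 1 + 1))⁻¹)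
        (fun z => -((n : ℂ) + 1)⁻¹ * ((z - p) ^ (n + 1))⁻¹) (hc _) ?_, mul_zero, add_zero]
      intro z hz
      have hz' : z - p ≠ 0 := sub_ne_zero.2 (hne z hz)
      have hn1 : (n : ℂ) + 1 ≠ 0 := by exact_mod_cast Nat.succ_ne_zero n
      have h5 := ((((hasDerivAt_id z).sub_const p).pow (n + 1)).inv
        (pow_ne_zero _ hz')).const_mul (-((n : ℂ) + 1)⁻¹)
      refine HasDerivAt.congr_deriv h5 ?_
      simp only [id, Pi.pow_apply, Nat.add_sub_cancel]
      push_cast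
      field_simp
      ring

/-- The residue theorem for a cycle in a disc, in the form in which poles that the cycle does not
enclose may have any order, and the other ones are simple. -/
theorem IsCycleFunctional.eq_sum_residues {Λ : (ℂ → ℂ) → ℂ} {Z : Set ℂ}
    (hΛ : IsCycleFunctional Λ Z) {c : ℂ} {R : ℝ} (hZ : Z ⊆ Metric.ball c R) (r : ℂ → ℂ)
    (S : Finset ℂ) : ∀ f : ℂ → ℂ, (∀ p ∈ S, p ∉ Z) →
    DifferentiableOn ℂ f (Metric.ball c R \ S) →
    (∀ p ∈ S, (MeromorphicAt f p ∧ Λ (fun z => (z - p)⁻¹) = 0) ∨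
      Tendsto (fun z => (z - p) * f z) (𝓝[≠] p) (𝓝 (r p))) →
    (∀ p ∈ S, p ∈ Metric.ball c R) →
    Λ f = ∑ p ∈ S, r p * Λ (fun z => (z - p)⁻¹) := by
  classical
  induction S using Finset.induction_on with
  | empty =>
    intro f _ hf _ _
    simp only [Finset.coe_empty, Set.sdiff_empty] at hf
    obtain ⟨Φ, hΦ⟩ := hf.isExactOn_ball
    rw [hΛ.exact f Φ (hf.continuousOn.mono hZ) fun z hz => hΦ z (hZ hz), Finset.sum_empty]
  | insert p S hpS ih =>
    intro f hSZ hf hpole hSU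
    have hpZ := hSZ p (Finset.mem_insert_self _ _)
    have hopen : ∀ S' : Finset ℂ, IsOpen (Metric.ball c R \ (S' : Set ℂ)) := fun S' =>
      Metric.isOpen_ball.sdiff S'.finite_toSet.isClosed
    have hpU := hSU p (Finset.mem_insert_self _ _)
    have hpunct : ∀ᶠ z in 𝓝[≠] p, DifferentiableAt ℂ f z := by
      have h1 : Metric.ball c R \ (S : Set ℂ) ∈ 𝓝 p := (hopen S).mem_nhds ⟨hpU, by simpa⟩
      filter_upwards [mem_nhdsWithin_of_mem_nhds h1, self_mem_nhdsWithin] with z hz hzp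
      refine hf.differentiableAt ((hopen _).mem_nhds ⟨hz.1, ?_⟩)
      simp only [Finset.coe_insert, Set.mem_insert_iff, not_or]
      exact ⟨hzp, hz.2⟩
    -- Subtracting the principal part at `p` leaves a function that extends across `p`, to which the
    -- induction applies. If `p` is not enclosed, `a 0` need not be `r p`, but both are multiplied
    -- by 0.
    obtain ⟨n, a, g, hg, han, hag, hnn⟩ : ∃ (n : ℕ) (a : ℕ → ℂ) (g : ℂ → ℂ), AnalyticAt ℂ g p ∧
        (a 0 * Λ (fun z => (z - p)⁻¹) = r p * Λ (fun z => (z - p)⁻¹)) ∧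
        (∀ᶠ z in 𝓝[≠] p, f z = g z + principalPart p n a z) ∧ n ≠ 0 := by
      rcases hpole p (Finset.mem_insert_self _ _) with ⟨⟨n, hn⟩, h0⟩ | ht
      -- The additional power of `z - p` makes the length of the principal part nonzero.
      · have hn' : AnalyticAt ℂ (fun z => (z - p) ^ (n + 1) * f z) p := by
          have : AnalyticAt ℂ (fun z => (z - p)) p := by fun_prop
          have := this.mul hn
          refine this.congr (Eventually.of_forall fun z => ?_)
          simp only [Pi.mul_apply, smul_eq_mul]
          ring
        obtain ⟨a, g, hg, -, h⟩ := exists_principalPart (n + 1) hn'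
        refine ⟨n + 1, a, g, hg, by rw [h0]; simp, ?_, by simp⟩
        filter_upwards [self_mem_nhdsWithin] with z hz
        have hz' : z - p ≠ 0 := sub_ne_zero.2 hz
        rw [← h z hz]
        field_simp
      · have hh : AnalyticAt ℂ (Function.update (fun z => (z - p) * f z) p (r p)) p := by
          refine Complex.analyticAt_of_differentiable_on_punctured_nhds_of_continuousAt ?_ ?_
          · filter_upwards [hpunct, self_mem_nhdsWithin] with z hz hzp
            have h1 : DifferentiableAt ℂ (fun z => (z - p) * f z) z := by fun_prop
            refine h1.congr_of_eventuallyEq ?_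
            filter_upwards [isOpen_ne.mem_nhds hzp] with w hw
            rw [Function.update_of_ne hw]
          · exact continuousAt_update_same.2 ht
        obtain ⟨a, g, hg, ha, h⟩ := exists_principalPart 1 hh
        refine ⟨1, a, g, hg, by rw [ha rfl, Function.update_self], ?_, by simp⟩
        filter_upwards [self_mem_nhdsWithin] with z hz
        have hz' : z - p ≠ 0 := sub_ne_zero.2 hz
        rw [← h z hz, Function.update_of_ne hz]
        field_simp
    set PP := principalPart p n a with hPP
    set f₂ : ℂ → ℂ := Function.update (fun z => f z - PP z) p (g p) with hf₂
    have hf₂ne : ∀ z, z ≠ p → f₂ z = f z - PP z := fun z hz => by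
      rw [hf₂, Function.update_of_ne hz]
    have hf₂d : DifferentiableOn ℂ f₂ (Metric.ball c R \ S) := by
      intro z hz
      refine DifferentiableAt.differentiableWithinAt ?_
      by_cases hzp : z = p
      · subst hzp
        refine hg.differentiableAt.congr_of_eventuallyEq ?_
        have h1 := eventually_nhdsWithin_iff.1 hag
        filter_upwards [h1] with w hw
        by_cases hwz : w = z
        · rw [hwz, hf₂, Function.update_self]
        · rw [hf₂ne w hwz, hw hwz, add_sub_cancel_right]
      · have h1 : DifferentiableAt ℂ (fun z => f z - PP z) z := by
          refine DifferentiableAt.sub (hf.differentiableAt ((hopen _).mem_nhds ⟨hz.1, ?_⟩))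
            (differentiableAt_principalPart hzp n a)
          simp only [Finset.coe_insert, Set.mem_insert_iff, not_or]
          exact ⟨hzp, hz.2⟩
        refine h1.congr_of_eventuallyEq ?_
        filter_upwards [isOpen_ne.mem_nhds hzp] with w hw using hf₂ne w hw
    have hne : ∀ z ∈ Z, z ≠ p := fun z hz h => hpZ (h ▸ hz)
    have hZS : Z ⊆ Metric.ball c R \ S := fun z hz =>
      ⟨hZ hz, fun hzS => hSZ z (Finset.mem_insert_of_mem hzS) hz⟩
    have hsplit : Λ f = Λ f₂ + Λ PP := by
      rw [← hΛ.add f₂ PP (hf₂d.continuousOn.mono hZS) fun z hz =>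
        (differentiableAt_principalPart (hne z hz) n a).continuousAt.continuousWithinAt]
      exact hΛ.congr _ _ fun z hz => by simp [hf₂ne z (hne z hz)]
    rw [Finset.sum_insert hpS, hsplit, hPP, hΛ.apply_principalPart hpZ n a (fun h => absurd h hnn), han,
      add_comm]
    congr 1
    refine ih f₂ (fun p' hp' => hSZ p' (Finset.mem_insert_of_mem hp')) hf₂d (fun p' hp' => ?_)
      fun p' hp' => hSU p' (Finset.mem_insert_of_mem hp')
    have hpp : p' ≠ p := fun h => hpS (h ▸ hp')
    have hPPd : AnalyticAt ℂ PP p' := by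
      rw [Complex.analyticAt_iff_eventually_differentiableAt]
      filter_upwards [isOpen_ne.mem_nhds hpp] with w hw using differentiableAt_principalPart hw n a
    have hev : ∀ᶠ z in 𝓝[≠] p', f z - PP z = f₂ z := by
      filter_upwards [mem_nhdsWithin_of_mem_nhds (isOpen_ne.mem_nhds hpp)] with w hw using
        (hf₂ne w hw).symm
    rcases hpole p' (Finset.mem_insert_of_mem hp') with ⟨hm, h0⟩ | ht
    · exact Or.inl ⟨(hm.sub hPPd.meromorphicAt).congr hev, h0⟩
    · refine Or.inr ?_
      have h1 : Tendsto (fun z => (z - p') * PP z) (𝓝[≠] p') (𝓝 0) := by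
        have : ContinuousAt (fun z => (z - p') * PP z) p' := by
          have := hPPd.continuousAt
          fun_prop
        have := this.tendsto.mono_left (nhdsWithin_le_nhds (s := {p'}ᶜ))
        simpa using this
      have h2 := ht.sub h1
      rw [sub_zero] at h2
      refine h2.congr' ?_
      filter_upwards [hev] with z hz
      rw [← hz]
      ring

end Residues

/-! ### Curve integrals, branches of the logarithm and the sides of the contour -/

section Contour

open Filter Topology Set MeasureTheory

/-- A Lipschitz curve which is differentiable except at countably many times. -/
structure IsRegularCurve (δ : ℝ → ℂ) : Prop where
  lipschitz : ∃ K : NNReal, LipschitzWith K δ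
  diff : ∃ S : Set ℝ, S.Countable ∧ ∀ t ∉ S, DifferentiableAt ℝ δ t

/-- The integral of `f` along the part of `δ` between the times `a` and `b`. -/
noncomputable def curveInt (f : ℂ → ℂ) (δ : ℝ → ℂ) (a b : ℝ) : ℂ :=
  ∫ t in a..b, f (δ t) * deriv δ t

theorem IsRegularCurve.continuous {δ : ℝ → ℂ} (hδ : IsRegularCurve δ) : Continuous δ :=
  hδ.lipschitz.choose_spec.continuous

theorem IsRegularCurve.intervalIntegrable {δ : ℝ → ℂ} (hδ : IsRegularCurve δ) {f : ℂ → ℂ}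
    {a b : ℝ} (hf : ContinuousOn f (δ '' uIcc a b)) :
    IntervalIntegrable (fun t => f (δ t) * deriv δ t) volume a b := by
  obtain ⟨K, hK⟩ := hδ.lipschitz
  have h1 : IntervalIntegrable (deriv δ) volume a b := by
    refine (intervalIntegrable_const (c := (K : ℝ))).mono_fun
      (measurable_deriv δ).aestronglyMeasurable (Eventually.of_forall fun t => ?_)
    simpa using norm_deriv_le_of_lipschitz hK
  exact h1.continuousOn_mul (hf.comp hδ.continuous.continuousOn (mapsTo_image _ _))

theorem IsRegularCurve.curveInt_eq_sub {δ : ℝ → ℂ} (hδ : IsRegularCurve δ) {f Φ : ℂ → ℂ} {a b : ℝ}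
    (hf : ContinuousOn f (δ '' uIcc a b)) (hΦ : ∀ t ∈ uIcc a b, HasDerivAt Φ (f (δ t)) (δ t)) :
    curveInt f δ a b = Φ (δ b) - Φ (δ a) := by
  obtain ⟨S, hS, hd⟩ := hδ.diff
  refine integral_eq_of_hasDerivAt_off_countable (Φ ∘ δ) _ hS
    (fun t ht => ((hΦ t ht).continuousAt.comp hδ.continuous.continuousAt).continuousWithinAt)
    (fun t ht => ?_) (hδ.intervalIntegrable hf)
  exact (hΦ t (Ioo_subset_Icc_self ht.1)).comp t (hd t ht.2).hasDerivAt

theorem curveInt_const_mul (c : ℂ) (f : ℂ → ℂ) (δ : ℝ → ℂ) (a b : ℝ) :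
    curveInt (fun z => c * f z) δ a b = c * curveInt f δ a b := by
  simp only [curveInt, mul_assoc, intervalIntegral.integral_const_mul]

theorem curveInt_congr {f g : ℂ → ℂ} {δ : ℝ → ℂ} {a b : ℝ} (h : EqOn f g (δ '' uIcc a b)) :
    curveInt f δ a b = curveInt g δ a b :=
  intervalIntegral.integral_congr fun t ht => by simp only [h (mem_image_of_mem _ ht)]

theorem IsRegularCurve.curveInt_add {δ : ℝ → ℂ} (hδ : IsRegularCurve δ) {f g : ℂ → ℂ} {a b : ℝ}
    (hf : ContinuousOn f (δ '' uIcc a b)) (hg : ContinuousOn g (δ '' uIcc a b)) :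
    curveInt (fun z => f z + g z) δ a b = curveInt f δ a b + curveInt g δ a b := by
  simp only [curveInt, add_mul]
  exact intervalIntegral.integral_add (hδ.intervalIntegrable hf) (hδ.intervalIntegrable hg)

theorem isRegularCurve_line (w v : ℂ) : IsRegularCurve fun t : ℝ => w + t * v := by
  refine ⟨⟨‖v‖₊, LipschitzWith.of_dist_le_mul fun s t => ?_⟩, ∅, countable_empty, fun t _ => ?_⟩
  · rw [dist_eq_norm, dist_eq_norm, add_sub_add_left_eq_sub, ← sub_mul, norm_mul, mul_comm,
      ← Complex.ofReal_sub, Complex.norm_real, coe_nnnorm]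
  · exact ((((hasDerivAt_id t).ofReal_comp).mul_const v).const_add w).differentiableAt

theorem deriv_line (w v : ℂ) (t : ℝ) : deriv (fun t : ℝ => w + t * v) t = v := by
  have := (((hasDerivAt_id t).ofReal_comp).mul_const v).const_add w
  simpa using this.deriv

theorem IsBarnesContour.isRegularCurve {γ : ℝ → ℂ} (hγ : IsBarnesContour γ) :
    IsRegularCurve γ := by
  obtain ⟨S, hS⟩ := hγ.piecewise_contDiff
  exact ⟨hγ.lipschitz, S, S.countable_toSet, fun t ht =>
    (hS t ht).differentiableAt (by norm_num)⟩

/-- The curve runs along vertical lines outside `[-T, T]`. -/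
structure IsVerticalOutside (γ : ℝ → ℂ) (σ₁ σ₂ T : ℝ) : Prop where
  pos : 0 < T
  bot : ∀ t, T ≤ t → γ (-t) = σ₁ - t * Complex.I
  top : ∀ t, T ≤ t → γ t = σ₂ + t * Complex.I

theorem IsBarnesContour.exists_isVerticalOutside {γ : ℝ → ℂ} (hγ : IsBarnesContour γ) :
    ∃ σ₁ σ₂ T, IsVerticalOutside γ σ₁ σ₂ T := by
  obtain ⟨σ₁, h1⟩ := hγ.eventually_atBot
  obtain ⟨σ₂, h2⟩ := hγ.eventually_atTop
  obtain ⟨B, hB⟩ := Filter.eventually_atBot.1 h1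
  obtain ⟨A, hA⟩ := Filter.eventually_atTop.1 h2
  refine ⟨σ₁, σ₂, max 1 (max A (-B)), by positivity, fun t ht => ?_, fun t ht => ?_⟩
  · have : -B ≤ t := le_trans (le_trans (le_max_right _ _) (le_max_right _ _)) ht
    rw [hB _ (by linarith)]
    push_cast
    ring
  · exact hA _ (le_trans (le_trans (le_max_left _ _) (le_max_right _ _)) ht)

theorem IsVerticalOutside.mono {γ : ℝ → ℂ} {σ₁ σ₂ T T' : ℝ} (h : IsVerticalOutside γ σ₁ σ₂ T)
    (hT : T ≤ T') : IsVerticalOutside γ σ₁ σ₂ T' :=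
  ⟨h.pos.trans_le hT, fun t ht => h.bot t (hT.trans ht), fun t ht => h.top t (hT.trans ht)⟩

theorem curveInt_inv_sub (γ : ℝ → ℂ) (p : ℂ) (a b : ℝ) :
    curveInt (fun z => (z - p)⁻¹) γ a b = ∫ t in a..b, deriv γ t / (γ t - p) :=
  intervalIntegral.integral_congr fun t _ => by simp only [div_eq_inv_mul]

/-- The factor `u` rotates the cut: `log (u * (z - p))` is a primitive off the ray from `p` in the
direction `-1 / u`. -/
theorem IsRegularCurve.curveInt_inv_sub_eq_log {δ : ℝ → ℂ} (hδ : IsRegularCurve δ) {u p : ℂ}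
    {a b : ℝ} (h : ∀ t ∈ uIcc a b, u * (δ t - p) ∈ Complex.slitPlane) :
    curveInt (fun z => (z - p)⁻¹) δ a b =
      Complex.log (u * (δ b - p)) - Complex.log (u * (δ a - p)) := by
  have hne : ∀ t ∈ uIcc a b, u * (δ t - p) ≠ 0 := fun t ht => Complex.slitPlane_ne_zero (h t ht)
  refine hδ.curveInt_eq_sub (Φ := fun z => Complex.log (u * (z - p))) ?_ fun t ht => ?_
  · rintro _ ⟨t, ht, rfl⟩
    have : δ t - p ≠ 0 := right_ne_zero_of_mul (hne t ht)
    exact ContinuousAt.continuousWithinAt (by fun_prop (disch := exact this))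
  · have h1 : HasDerivAt (fun z => u * (z - p)) u (δ t) := by
      simpa using ((hasDerivAt_id (δ t)).sub_const p).const_mul u
    have h2 := h1.clog (h t ht)
    have h3 := left_ne_zero_of_mul (hne t ht)
    rwa [div_mul_eq_div_div, div_self h3, one_div] at h2

/-- For large `T` the logarithm splits as `log T + log (w / T + v)`. -/
theorem tendsto_log_add_mul_sub_log {w v : ℂ} (hv : v ∈ Complex.slitPlane) :
    Tendsto (fun T : ℝ => Complex.log (w + T * v) - Real.log T) atTop (𝓝 (Complex.log v)) := by
  have h1 : Tendsto (fun T : ℝ => w / T + v) atTop (𝓝 v) := by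
    have : Tendsto (fun T : ℝ => w * ((T⁻¹ : ℝ) : ℂ)) atTop (𝓝 (w * ((0 : ℝ) : ℂ))) :=
      ((Complex.continuous_ofReal.tendsto _).comp tendsto_inv_atTop_zero).const_mul w
    simp only [Complex.ofReal_zero, mul_zero] at this
    simpa [div_eq_mul_inv] using this.add_const v
  refine ((continuousAt_clog hv).tendsto.comp h1).congr' ?_
  filter_upwards [eventually_gt_atTop 0, h1.eventually (Complex.isOpen_slitPlane.mem_nhds hv)]
    with T hT hs
  have hT' : (T : ℂ) ≠ 0 := by exact_mod_cast hT.ne'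
  have h2 : w + T * v = T * (w / T + v) := by field_simp
  rw [h2, Complex.log_ofReal_mul hT (Complex.slitPlane_ne_zero hs), add_sub_cancel_left,
    Function.comp]

/-- The increment of the branch `log (u * (γ - p))` along `γ` tends to `± π i`, according to the
sign of the real part of `u`. -/
theorem IsVerticalOutside.tendsto_log_sub_log {γ : ℝ → ℂ} {σ₁ σ₂ T₀ : ℝ}
    (h : IsVerticalOutside γ σ₁ σ₂ T₀) {u : ℂ} (p : ℂ) (hu : u.re ≠ 0) :
    Tendsto (fun T : ℝ => Complex.log (u * (γ T - p)) - Complex.log (u * (γ (-T) - p))) atTop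
      (𝓝 ((if 0 < u.re then 1 else -1) * (Real.pi * Complex.I))) := by
  have hs : ∀ v : ℂ, v.im ≠ 0 → v ∈ Complex.slitPlane := fun v hv =>
    Complex.mem_slitPlane_iff.2 (Or.inr hv)
  have h1 := tendsto_log_add_mul_sub_log (w := u * (σ₂ - p)) (hs (u * Complex.I) (by simpa))
  have h2 := tendsto_log_add_mul_sub_log (w := u * (σ₁ - p)) (hs (-(u * Complex.I)) (by simpa))
  -- The ends of the curve run in the directions `I` and `-I`. The arguments of `u * I` and `-(u *
  -- I)` differ by `±π`, with the sign of `(u * I).im = u.re`.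
  have h3 : Complex.log (u * Complex.I) - Complex.log (-(u * Complex.I)) =
      (if 0 < u.re then 1 else -1) * (Real.pi * Complex.I) := by
    rw [Complex.log, Complex.log, norm_neg, add_sub_add_left_eq_sub]
    split_ifs with h0
    · rw [Complex.arg_neg_eq_arg_sub_pi_of_im_pos (by simpa)]
      push_cast
      ring
    · rw [Complex.arg_neg_eq_arg_add_pi_of_im_neg (by simpa using lt_of_le_of_ne (not_lt.1 h0) hu)]
      push_cast
      ring
  rw [← h3]
  refine (h1.sub h2).congr' ?_
  filter_upwards [eventually_ge_atTop T₀] with T hT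
  rw [h.top T hT, h.bot T hT, sub_sub_sub_cancel_right]
  congr 2 <;> ring

/-- The winding integral up to time `T`, for a branch of the logarithm which is regular on the two
ends of the curve. -/
theorem IsVerticalOutside.curveInt_inv_sub_eq {γ : ℝ → ℂ} {σ₁ σ₂ T₀ : ℝ}
    (h : IsVerticalOutside γ σ₁ σ₂ T₀) (hγ : IsRegularCurve γ) {u p ℓ : ℂ} (hu : u.re ≠ 0)
    (hp : p ∉ range γ)
    (ht : ∀ t, T₀ ≤ t → u * (γ t - p) ∈ Complex.slitPlane)
    (hb : ∀ t, T₀ ≤ t → u * (γ (-t) - p) ∈ Complex.slitPlane)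
    (hℓ : Tendsto (fun T : ℝ => ∫ t in (-T)..T, deriv γ t / (γ t - p)) atTop (𝓝 ℓ)) {T : ℝ}
    (hT : T₀ ≤ T) :
    curveInt (fun z => (z - p)⁻¹) γ (-T) T =
      Complex.log (u * (γ T - p)) - Complex.log (u * (γ (-T) - p)) +
        (ℓ - (if 0 < u.re then 1 else -1) * (Real.pi * Complex.I)) := by
  have hc : ∀ s : Set ℂ, s ⊆ range γ → ContinuousOn (fun z => (z - p)⁻¹) s := fun s hs =>
    ContinuousOn.inv₀ (by fun_prop) fun z hz h => hp (sub_eq_zero.1 h ▸ hs hz)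
  have hi : ∀ a b : ℝ, IntervalIntegrable (fun t => (γ t - p)⁻¹ * deriv γ t) volume a b :=
    fun a b => hγ.intervalIntegrable (hc _ (image_subset_range _ _))
  -- Enlarging `T` adds only pieces of the ends, where the logarithm is a primitive. The defect is
  -- therefore constant, and its value is found as `T' → ∞`.
  have key : ∀ T', T ≤ T' → curveInt (fun z => (z - p)⁻¹) γ (-T) T -
      (Complex.log (u * (γ T - p)) - Complex.log (u * (γ (-T) - p))) =
      curveInt (fun z => (z - p)⁻¹) γ (-T') T' -
      (Complex.log (u * (γ T' - p)) - Complex.log (u * (γ (-T') - p))) := by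
    intro T' hT'
    have e1 : curveInt (fun z => (z - p)⁻¹) γ (-T') T' =
        curveInt (fun z => (z - p)⁻¹) γ (-T') (-T) + curveInt (fun z => (z - p)⁻¹) γ (-T) T +
          curveInt (fun z => (z - p)⁻¹) γ T T' := by
      unfold curveInt
      rw [intervalIntegral.integral_add_adjacent_intervals (hi _ _) (hi _ _),
        intervalIntegral.integral_add_adjacent_intervals (hi _ _) (hi _ _)]
    rw [e1, hγ.curveInt_inv_sub_eq_log (u := u) (a := T) (b := T') fun t h' => ht t ?_,
      hγ.curveInt_inv_sub_eq_log (u := u) (a := -T') (b := -T) fun t h' => ?_]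
    · ring
    · rw [uIcc_of_le (by linarith)] at h'
      have := hb (-t) (by linarith [h'.2])
      rwa [neg_neg] at this
    · rw [uIcc_of_le hT'] at h'
      linarith [h'.1]
  have hlim := hℓ.sub (h.tendsto_log_sub_log p hu)
  have hconst : Tendsto (fun _ : ℝ => curveInt (fun z => (z - p)⁻¹) γ (-T) T -
      (Complex.log (u * (γ T - p)) - Complex.log (u * (γ (-T) - p)))) atTop
      (𝓝 (ℓ - (if 0 < u.re then 1 else -1) * (Real.pi * Complex.I))) := by
    refine hlim.congr' ?_
    filter_upwards [eventually_ge_atTop T] with T' hT'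
    rw [key T' hT', curveInt_inv_sub]
  have := tendsto_nhds_unique tendsto_const_nhds hconst
  rw [← this]
  ring

/-- The ray from `p` in the direction `-1 / u` runs to the right and misses the contour, so one
branch of the logarithm serves for the whole curve and shows that the argument changes by `-π`. -/
theorem IsVerticalOutside.not_liesLeftOf {γ : ℝ → ℂ} {σ₁ σ₂ T₀ : ℝ}
    (h : IsVerticalOutside γ σ₁ σ₂ T₀) (hγ : IsRegularCurve γ) {u p : ℂ} (hu : u.re < 0)
    (hs : ∀ t, u * (γ t - p) ∈ Complex.slitPlane) : ¬ LiesLeftOf γ p := by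
  rintro ⟨-, hl⟩
  have h1 := (h.tendsto_log_sub_log p hu.ne).congr fun T =>
    (hγ.curveInt_inv_sub_eq_log (a := -T) (b := T) fun t _ => hs t).symm
  simp only [curveInt_inv_sub] at h1
  have h2 := tendsto_nhds_unique hl h1
  rw [if_neg hu.not_gt, neg_one_mul, eq_neg_iff_add_eq_zero, ← two_mul] at h2
  simp [Real.pi_ne_zero] at h2

theorem not_liesLeftOf_and_liesRightOf {γ : ℝ → ℂ} {p : ℂ} (hl : LiesLeftOf γ p)
    (hr : LiesRightOf γ p) : False := by
  have h2 := tendsto_nhds_unique hl.2 hr.2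
  rw [eq_neg_iff_add_eq_zero, ← two_mul] at h2
  simp [Real.pi_ne_zero] at h2

end Contour

/-! ### Closing the contour and shifting it to a vertical line -/

section BoxCycle

open Filter Topology Set MeasureTheory

/-- Integration along `γ` from time `-T` to time `T`, and back to the starting point through
`M + iT` and `M - iT`. -/
noncomputable def boxCycle (γ : ℝ → ℂ) (σ₁ σ₂ M T : ℝ) (f : ℂ → ℂ) : ℂ :=
  curveInt f γ (-T) T -
    (curveInt f (fun t => -(T * Complex.I) + t * 1) σ₁ M +
      curveInt f (fun t => M + t * Complex.I) (-T) T +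
      curveInt f (fun t => T * Complex.I + t * 1) M σ₂)

theorem isCycleFunctional_boxCycle {γ : ℝ → ℂ} (hγ : IsRegularCurve γ) {σ₁ σ₂ M T : ℝ}
    (hb : γ (-T) = σ₁ - T * Complex.I) (ht : γ T = σ₂ + T * Complex.I) :
    IsCycleFunctional (boxCycle γ σ₁ σ₂ M T)
      (γ '' uIcc (-T) T ∪ (fun t : ℝ => -(T * Complex.I) + t * 1) '' uIcc σ₁ M ∪
        (fun t : ℝ => M + t * Complex.I) '' uIcc (-T) T ∪
        (fun t : ℝ => T * Complex.I + t * 1) '' uIcc M σ₂) := by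
  have h1 := isRegularCurve_line (-(T * Complex.I)) 1
  have h2 := isRegularCurve_line M Complex.I
  have h3 := isRegularCurve_line (T * Complex.I) 1
  refine ⟨fun f g hf hg => ?_, fun c f => ?_, fun f g hfg => ?_, fun f Φ hf hΦ => ?_⟩
  · unfold boxCycle
    rw [hγ.curveInt_add (hf.mono fun z hz => Or.inl (Or.inl (Or.inl hz)))
        (hg.mono fun z hz => Or.inl (Or.inl (Or.inl hz))),
      h1.curveInt_add (hf.mono fun z hz => Or.inl (Or.inl (Or.inr hz)))
        (hg.mono fun z hz => Or.inl (Or.inl (Or.inr hz))),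
      h2.curveInt_add (hf.mono fun z hz => Or.inl (Or.inr hz))
        (hg.mono fun z hz => Or.inl (Or.inr hz)),
      h3.curveInt_add (hf.mono fun z hz => Or.inr hz) (hg.mono fun z hz => Or.inr hz)]
    ring
  · simp only [boxCycle, curveInt_const_mul]
    ring
  · unfold boxCycle
    rw [curveInt_congr (hfg.mono fun z hz => Or.inl (Or.inl (Or.inl hz))),
      curveInt_congr (hfg.mono fun z hz => Or.inl (Or.inl (Or.inr hz))),
      curveInt_congr (hfg.mono fun z hz => Or.inl (Or.inr hz)),
      curveInt_congr (hfg.mono fun z hz => Or.inr hz)]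
  · unfold boxCycle
    rw [hγ.curveInt_eq_sub (Φ := Φ) (hf.mono fun z hz => Or.inl (Or.inl (Or.inl hz)))
        fun t ht => hΦ _ (Or.inl (Or.inl (Or.inl (mem_image_of_mem _ ht)))),
      h1.curveInt_eq_sub (Φ := Φ) (hf.mono fun z hz => Or.inl (Or.inl (Or.inr hz)))
        fun t ht => hΦ _ (Or.inl (Or.inl (Or.inr (mem_image_of_mem _ ht)))),
      h2.curveInt_eq_sub (Φ := Φ) (hf.mono fun z hz => Or.inl (Or.inr hz))
        fun t ht => hΦ _ (Or.inl (Or.inr (mem_image_of_mem _ ht))),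
      h3.curveInt_eq_sub (Φ := Φ) (hf.mono fun z hz => Or.inr hz)
        fun t ht => hΦ _ (Or.inr (mem_image_of_mem _ ht)), hb, ht]
    have e1 : (σ₁ : ℂ) - T * Complex.I = -(T * Complex.I) + σ₁ * 1 := by ring
    have e2 : (M : ℂ) + ((-T : ℝ) : ℂ) * Complex.I = -(T * Complex.I) + M * 1 := by
      push_cast; ring
    have e3 : (M : ℂ) + T * Complex.I = T * Complex.I + M * 1 := by ring
    have e4 : (σ₂ : ℂ) + T * Complex.I = T * Complex.I + σ₂ * 1 := by ring
    rw [e1, e2, e3, e4]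
    ring

/-- The cut misses the three sides and the ends of the curve. The logarithms cancel around the
closed path, and only the defect of the middle part of `γ` is left. -/
theorem IsVerticalOutside.boxCycle_inv_sub {γ : ℝ → ℂ} {σ₁ σ₂ T₀ : ℝ}
    (h : IsVerticalOutside γ σ₁ σ₂ T₀) (hγ : IsRegularCurve γ) {u p ℓ : ℂ} (hu : u.re ≠ 0)
    (hp : p ∉ range γ)
    (ht : ∀ t, T₀ ≤ t → u * (γ t - p) ∈ Complex.slitPlane)
    (hb : ∀ t, T₀ ≤ t → u * (γ (-t) - p) ∈ Complex.slitPlane)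
    (hℓ : Tendsto (fun T : ℝ => ∫ t in (-T)..T, deriv γ t / (γ t - p)) atTop (𝓝 ℓ)) {M T : ℝ}
    (hT : T₀ ≤ T)
    (h1 : ∀ t ∈ uIcc σ₁ M, u * (-(T * Complex.I) + t * 1 - p) ∈ Complex.slitPlane)
    (h2 : ∀ t ∈ uIcc (-T) T, u * (M + t * Complex.I - p) ∈ Complex.slitPlane)
    (h3 : ∀ t ∈ uIcc M σ₂, u * (T * Complex.I + t * 1 - p) ∈ Complex.slitPlane) :
    boxCycle γ σ₁ σ₂ M T (fun z => (z - p)⁻¹) =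
      ℓ - (if 0 < u.re then 1 else -1) * (Real.pi * Complex.I) := by
  unfold boxCycle
  rw [h.curveInt_inv_sub_eq hγ hu hp ht hb hℓ hT,
    (isRegularCurve_line _ _).curveInt_inv_sub_eq_log (u := u) h1,
    (isRegularCurve_line _ _).curveInt_inv_sub_eq_log (u := u) h2,
    (isRegularCurve_line _ _).curveInt_inv_sub_eq_log (u := u) h3, h.bot T hT, h.top T hT]
  have e1 : (σ₁ : ℂ) - T * Complex.I = -(T * Complex.I) + σ₁ * 1 := by ring
  have e2 : (M : ℂ) + ((-T : ℝ) : ℂ) * Complex.I = -(T * Complex.I) + M * 1 := by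
    push_cast; ring
  have e3 : (M : ℂ) + T * Complex.I = T * Complex.I + M * 1 := by ring
  have e4 : (σ₂ : ℂ) + T * Complex.I = T * Complex.I + σ₂ * 1 := by ring
  rw [e1, e2, e3, e4]
  ring

/-- The sides and the ends of the curve all lie to the right of `p`, so the cut running to the left
(`u = 1`) is admissible whatever the height of `p`. -/
theorem IsVerticalOutside.boxCycle_inv_sub_of_left {γ : ℝ → ℂ} {σ₁ σ₂ T₀ M T : ℝ}
    (h : IsVerticalOutside γ σ₁ σ₂ T₀) (hγ : IsRegularCurve γ) {p : ℂ} (hp : LiesLeftOf γ p)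
    (h1 : p.re < σ₁) (h2 : p.re < σ₂) (hM : p.re < M) (hT : T₀ ≤ T) :
    boxCycle γ σ₁ σ₂ M T (fun z => (z - p)⁻¹) = 0 := by
  have hs : ∀ v : ℂ, 0 < v.re → 1 * v ∈ Complex.slitPlane := fun v hv => by
    rw [one_mul]; exact Complex.mem_slitPlane_iff.2 (Or.inl hv)
  rw [h.boxCycle_inv_sub hγ (u := 1) (by simp) hp.1 (fun t ht => hs _ ?_) (fun t ht => hs _ ?_)
    hp.2 hT (fun t ht => hs _ ?_) (fun t ht => hs _ ?_) (fun t ht => hs _ ?_)]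
  · simp
  · rw [h.top t ht]; simpa
  · rw [h.bot t ht]; simpa
  · simpa using lt_of_lt_of_le (lt_min h1 hM) ht.1
  · simpa
  · simpa using lt_of_lt_of_le (lt_min hM h2) ht.1

/-- The cut is horizontal and points away from the line `Re s = M`: `u = 1` for `p` before the line,
`u = -1` beyond it. The value is negative because the cycle runs clockwise around `p`. -/
theorem IsVerticalOutside.boxCycle_inv_sub_of_right {γ : ℝ → ℂ} {σ₁ σ₂ T₀ M T : ℝ}
    (h : IsVerticalOutside γ σ₁ σ₂ T₀) (hγ : IsRegularCurve γ) {p : ℂ} (hp : LiesRightOf γ p)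
    (him : |p.im| < T₀) (hM : p.re ≠ M) (hT : T₀ ≤ T) :
    boxCycle γ σ₁ σ₂ M T (fun z => (z - p)⁻¹) =
      if p.re < M then -(2 * Real.pi * Complex.I) else 0 := by
  obtain ⟨hi1, hi2⟩ := abs_lt.1 him
  have hs : ∀ u : ℝ, u ≠ 0 → ∀ v : ℂ, v.im ≠ 0 → (u : ℂ) * v ∈ Complex.slitPlane :=
    fun u hu v hv => Complex.mem_slitPlane_iff.2 (Or.inr (by simpa using ⟨hu, hv⟩))
  have key : ∀ u : ℝ, 0 < u * (M - p.re) →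
      boxCycle γ σ₁ σ₂ M T (fun z => (z - p)⁻¹) =
      -(Real.pi * Complex.I) - (if 0 < u then 1 else -1) * (Real.pi * Complex.I) := by
    intro u hu
    have hu0 : u ≠ 0 := by rintro rfl; simp at hu
    rw [h.boxCycle_inv_sub hγ (u := u) (by simpa) hp.1 (fun t ht => hs u hu0 _ ?_)
      (fun t ht => hs u hu0 _ ?_) hp.2 hT (fun t ht => hs u hu0 _ ?_) (fun t ht => ?_)
      (fun t ht => hs u hu0 _ ?_), Complex.ofReal_re]
    · rw [h.top t ht]; simp; linarith
    · rw [h.bot t ht]; simp; linarith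
    · simp; linarith
    · exact Complex.mem_slitPlane_iff.2 (Or.inl (by simpa using hu))
    · simp; linarith
  split_ifs with h1
  · rw [key 1 (by linarith), if_pos one_pos]
    ring
  · rw [key (-1) (by linarith [lt_of_le_of_ne (not_lt.1 h1) hM.symm]), if_neg (by norm_num)]
    ring

/-- The cycle winds only around the poles of `PR` before the line. Poles of `PL` may have any order
since decreasing sequences may coincide; with winding number 0 this is harmless. -/
theorem IsVerticalOutside.boxCycle_eq {γ : ℝ → ℂ} {σ₁ σ₂ T₀ M : ℝ}
    (h : IsVerticalOutside γ σ₁ σ₂ T₀) (hγ : IsRegularCurve γ) (h1 : σ₁ < M) (h2 : σ₂ < M)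
    {F r : ℂ → ℂ} {PL PR : Set ℂ}
    (hL : ∀ p ∈ PL, LiesLeftOf γ p ∧ p.re < σ₁ ∧ p.re < σ₂ ∧ MeromorphicAt F p)
    (hR : ∀ p ∈ PR, LiesRightOf γ p ∧ |p.im| < T₀ ∧ p.re ≠ M ∧
      Tendsto (fun z => (z - p) * F z) (𝓝[≠] p) (𝓝 (r p)))
    (hfin : ∀ R : ℝ, ((PL ∪ PR) ∩ Metric.ball 0 R).Finite)
    (hdiff : ∀ z ∉ PL ∪ PR, DifferentiableAt ℂ F z)
    {S : Finset ℂ} (hS : ∀ p, p ∈ S ↔ p ∈ PR ∧ p.re < M) {T : ℝ} (hT : T₀ ≤ T) :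
    boxCycle γ σ₁ σ₂ M T F = -(2 * Real.pi * Complex.I) * ∑ p ∈ S, r p := by
  classical
  have hcyc := isCycleFunctional_boxCycle hγ (M := M) (h.bot T hT) (h.top T hT)
  set Z : Set ℂ := γ '' uIcc (-T) T ∪ (fun t : ℝ => -(T * Complex.I) + t * 1) '' uIcc σ₁ M ∪
        (fun t : ℝ => M + t * Complex.I) '' uIcc (-T) T ∪
        (fun t : ℝ => T * Complex.I + t * 1) '' uIcc M σ₂ with hZ
  -- The set of all poles may be infinite, so a ball is chosen that contains the cycle and every
  -- pole that contributes.
  have hcomp : IsCompact (Z ∪ S) := by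
    refine (((IsCompact.union ?_ ?_).union ?_).union ?_).union S.finite_toSet.isCompact
    · exact isCompact_uIcc.image hγ.continuous
    · exact isCompact_uIcc.image (isRegularCurve_line _ _).continuous
    · exact isCompact_uIcc.image (isRegularCurve_line _ _).continuous
    · exact isCompact_uIcc.image (isRegularCurve_line _ _).continuous
  obtain ⟨R, hR0⟩ := hcomp.isBounded.subset_ball 0
  set S' := (hfin R).toFinset with hS'
  have hmem : ∀ p, p ∈ S' ↔ p ∈ PL ∪ PR ∧ p ∈ Metric.ball 0 R := fun p => by simp [hS']
  have hLZ : ∀ p ∈ PL, p ∉ Z := by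
    rintro p hp hz
    obtain ⟨⟨hp1, -⟩, hp2, hp3, -⟩ := hL p hp
    rcases hz with ((⟨t, -, rfl⟩ | ⟨t, ht, rfl⟩) | ⟨t, ht, rfl⟩) | ⟨t, ht, rfl⟩
    · exact hp1 (mem_range_self _)
    · rw [uIcc_of_le h1.le] at ht
      simp at hp2
      linarith [ht.1]
    · simp at hp2
      linarith
    · rw [uIcc_of_ge h2.le] at ht
      simp at hp3
      linarith [ht.1]
  have hRZ : ∀ p ∈ PR, p ∉ Z := by
    rintro p hp hz
    obtain ⟨⟨hp1, -⟩, hp2, hp3, -⟩ := hR p hp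
    rcases hz with ((⟨t, -, rfl⟩ | ⟨t, ht, rfl⟩) | ⟨t, ht, rfl⟩) | ⟨t, ht, rfl⟩
    · exact hp1 (mem_range_self _)
    · simp at hp2
      linarith [le_abs_self T]
    · simp at hp3
    · simp at hp2
      linarith [le_abs_self T]
  rw [hcyc.eq_sum_residues (c := 0) (R := R) (subset_union_left.trans hR0) r S' F
    (fun p hp => (((hmem p).1 hp).1.elim (hLZ p) (hRZ p)))
    (fun z hz => (hdiff z fun hz' => hz.2 ((hmem z).2 ⟨hz', hz.1⟩)).differentiableWithinAt)
    (fun p hp => ((hmem p).1 hp).1.imp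
      (fun hp' => ⟨(hL p hp').2.2.2, h.boxCycle_inv_sub_of_left hγ (hL p hp').1 (hL p hp').2.1
        (hL p hp').2.2.1 ((hL p hp').2.1.trans h1) hT⟩) fun hp' => (hR p hp').2.2.2)
    fun p hp => ((hmem p).1 hp).2, Finset.mul_sum]
  symm
  refine Finset.sum_subset_zero_on_sdiff (fun p hp => (hmem p).2 ⟨Or.inr ((hS p).1 hp).1,
    hR0 (Or.inr hp)⟩) (fun p hp => ?_) fun p hp => ?_
  · obtain ⟨hp1, hp2⟩ := Finset.mem_sdiff.1 hp
    rcases ((hmem p).1 hp1).1 with hp' | hp'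
    · rw [h.boxCycle_inv_sub_of_left hγ (hL p hp').1 (hL p hp').2.1
        (hL p hp').2.2.1 ((hL p hp').2.1.trans h1) hT, mul_zero]
    · rw [h.boxCycle_inv_sub_of_right hγ (hR p hp').1 (hR p hp').2.1 (hR p hp').2.2.1 hT,
        if_neg fun hlt => hp2 ((hS p).2 ⟨hp', hlt⟩), mul_zero]
  · obtain ⟨hp', hlt⟩ := (hS p).1 hp
    rw [h.boxCycle_inv_sub_of_right hγ (hR p hp').1 (hR p hp').2.1 (hR p hp').2.2.1 hT,
        if_pos hlt, mul_comm]

/-- Shifting the contour to the vertical line through `M`. -/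
theorem IsVerticalOutside.integral_eq {γ : ℝ → ℂ} {σ₁ σ₂ T₀ M : ℝ}
    (h : IsVerticalOutside γ σ₁ σ₂ T₀) (hγ : IsRegularCurve γ) (h1 : σ₁ < M) (h2 : σ₂ < M)
    {F r : ℂ → ℂ} {PL PR : Set ℂ}
    (hL : ∀ p ∈ PL, LiesLeftOf γ p ∧ p.re < σ₁ ∧ p.re < σ₂ ∧ MeromorphicAt F p)
    (hR : ∀ p ∈ PR, LiesRightOf γ p ∧ |p.im| < T₀ ∧ p.re ≠ M ∧
      Tendsto (fun z => (z - p) * F z) (𝓝[≠] p) (𝓝 (r p)))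
    (hfin : ∀ R : ℝ, ((PL ∪ PR) ∩ Metric.ball 0 R).Finite)
    (hdiff : ∀ z ∉ PL ∪ PR, DifferentiableAt ℂ F z)
    {S : Finset ℂ} (hS : ∀ p, p ∈ S ↔ p ∈ PR ∧ p.re < M)
    (hγi : Integrable fun t : ℝ => F (γ t) * deriv γ t)
    (hMi : Integrable fun t : ℝ => F (M + t * Complex.I))
    {B : ℝ → ℝ} (hB : Tendsto B atTop (𝓝 0))
    (hFB : ∀ s : ℂ, min σ₁ σ₂ ≤ s.re → T₀ ≤ |s.im| → ‖F s‖ ≤ B |s.im|) :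
    ∫ t : ℝ, F (γ t) * deriv γ t = (∫ t : ℝ, F (M + t * Complex.I)) * Complex.I -
      2 * Real.pi * Complex.I * ∑ p ∈ S, r p := by
  have l1 : Tendsto (fun T : ℝ => curveInt F γ (-T) T) atTop (𝓝 (∫ t, F (γ t) * deriv γ t)) :=
    intervalIntegral_tendsto_integral hγi tendsto_neg_atTop_atBot tendsto_id
  have l2 : Tendsto (fun T : ℝ => curveInt F (fun t => M + t * Complex.I) (-T) T) atTop
      (𝓝 ((∫ t : ℝ, F (M + t * Complex.I)) * Complex.I)) := by
    have := (intervalIntegral_tendsto_integral hMi tendsto_neg_atTop_atBot tendsto_id).mul_const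
      Complex.I
    refine this.congr fun T => ?_
    simp only [curveInt, deriv_line, intervalIntegral.integral_mul_const, id]
  have l3 : Tendsto (fun T : ℝ => curveInt F (fun t => -(T * Complex.I) + t * 1) σ₁ M) atTop
      (𝓝 0) := by
    have hz : Tendsto (fun T => B T * |M - σ₁|) atTop (𝓝 0) := by simpa using hB.mul_const _
    refine squeeze_zero_norm' ?_ hz
    filter_upwards [eventually_ge_atTop T₀] with T hT
    have hT0 : |T| = T := abs_of_pos (h.pos.trans_le hT)
    refine intervalIntegral.norm_integral_le_of_norm_le_const fun t ht => ?_
    rw [uIoc_of_le h1.le] at ht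
    rw [deriv_line, mul_one]
    refine (hFB _ ?_ ?_).trans_eq ?_
    · simpa using Or.inl ht.1.le
    · simpa [hT0] using hT
    · simp [hT0]
  have l4 : Tendsto (fun T : ℝ => curveInt F (fun t => T * Complex.I + t * 1) M σ₂) atTop
      (𝓝 0) := by
    have hz : Tendsto (fun T => B T * |σ₂ - M|) atTop (𝓝 0) := by simpa using hB.mul_const _
    refine squeeze_zero_norm' ?_ hz
    filter_upwards [eventually_ge_atTop T₀] with T hT
    have hT0 : |T| = T := abs_of_pos (h.pos.trans_le hT)
    refine intervalIntegral.norm_integral_le_of_norm_le_const fun t ht => ?_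
    rw [uIoc_of_ge h2.le] at ht
    rw [deriv_line, mul_one]
    refine (hFB _ ?_ ?_).trans_eq ?_
    · simpa using Or.inr ht.1.le
    · simpa [hT0] using hT
    · simp [hT0]
  have l5 := l1.sub ((l3.add l2).add l4)
  have l6 : Tendsto (fun T : ℝ => boxCycle γ σ₁ σ₂ M T F) atTop
      (𝓝 (-(2 * Real.pi * Complex.I) * ∑ p ∈ S, r p)) := by
    refine tendsto_const_nhds.congr' ?_
    filter_upwards [eventually_ge_atTop T₀] with T hT
    exact (h.boxCycle_eq hγ h1 h2 hL hR hfin hdiff hS hT).symm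
  have := tendsto_nhds_unique l5 l6
  linear_combination this

end BoxCycle

/-! ### The position of the decreasing poles -/

section LeftPoles

open Filter Topology Set MeasureTheory

/-- If `σ₂ ≤ ρ`, a sufficiently high point `p` of the family is on the upper end or to the right of
it. In the second case the ray from `p` in the direction `1 + I` misses the contour, being to the
right of the upper end and above the rest, and so `p` is not on the left. -/
theorem IsVerticalOutside.re_lt_top {γ : ℝ → ℂ} {σ₁ σ₂ T₀ : ℝ}
    (h : IsVerticalOutside γ σ₁ σ₂ T₀) (hγ : IsRegularCurve γ) {ρ : ℝ}
    (hp : ∀ y : ℝ, ∃ p : ℂ, p.re = ρ ∧ y ≤ p.im ∧ LiesLeftOf γ p) : ρ < σ₂ := by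
  by_contra! hρ
  obtain ⟨B, hB⟩ := ((isCompact_Icc (a := -T₀) (b := T₀)).image hγ.continuous).isBounded.exists_norm_le
  obtain ⟨p, rfl, hpim, hpl⟩ := hp (max T₀ (B + 1))
  have hp1 : T₀ ≤ p.im := (le_max_left _ _).trans hpim
  have hp2 : B + 1 ≤ p.im := (le_max_right _ _).trans hpim
  have h0 := h.pos
  rcases hρ.eq_or_lt with hρ | hρ
  · refine hpl.1 ⟨p.im, ?_⟩
    rw [h.top _ hp1, hρ, Complex.re_add_im]
  · refine h.not_liesLeftOf hγ (u := -1 + Complex.I) (by simp) (fun t => ?_) hpl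
    have key : ¬ ((γ t - p).re = (γ t - p).im ∧ 0 ≤ (γ t - p).re) := by
      rintro ⟨e1, e2⟩
      simp only [Complex.sub_re, Complex.sub_im] at e1 e2
      rcases le_total t (-T₀) with ht | ht
      · have := h.bot (-t) (by linarith)
        rw [neg_neg] at this
        rw [this] at e1 e2
        simp at e1 e2
        linarith
      rcases le_total T₀ t with ht' | ht'
      · rw [h.top t ht'] at e2
        simp at e2
        linarith
      · have := (Complex.abs_im_le_norm _).trans (hB _ (mem_image_of_mem γ ⟨ht, ht'⟩))
        linarith [le_abs_self (γ t).im]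
    rw [Complex.mem_slitPlane_iff]
    by_contra! hh
    simp only [Complex.mul_re, Complex.mul_im, Complex.add_re, Complex.add_im, Complex.neg_re,
      Complex.neg_im, Complex.one_re, Complex.one_im, Complex.I_re, Complex.I_im] at hh
    exact key ⟨by linarith [hh.2], by linarith [hh.1, hh.2]⟩

/-- The mirror image of `re_lt_top`, with the ray in the direction `1 - I`. -/
theorem IsVerticalOutside.re_lt_bot {γ : ℝ → ℂ} {σ₁ σ₂ T₀ : ℝ}
    (h : IsVerticalOutside γ σ₁ σ₂ T₀) (hγ : IsRegularCurve γ) {ρ : ℝ}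
    (hp : ∀ y : ℝ, ∃ p : ℂ, p.re = ρ ∧ p.im ≤ y ∧ LiesLeftOf γ p) : ρ < σ₁ := by
  by_contra! hρ
  obtain ⟨B, hB⟩ := ((isCompact_Icc (a := -T₀) (b := T₀)).image hγ.continuous).isBounded.exists_norm_le
  obtain ⟨p, rfl, hpim, hpl⟩ := hp (min (-T₀) (-(B + 1)))
  have hp1 : p.im ≤ -T₀ := hpim.trans (min_le_left _ _)
  have hp2 : p.im ≤ -(B + 1) := hpim.trans (min_le_right _ _)
  have h0 := h.pos
  rcases hρ.eq_or_lt with hρ | hρ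
  · refine hpl.1 ⟨p.im, ?_⟩
    have := h.bot (-p.im) (by linarith)
    rw [neg_neg] at this
    rw [this, hρ]
    push_cast
    rw [neg_mul, sub_neg_eq_add, Complex.re_add_im]
  · refine h.not_liesLeftOf hγ (u := -1 - Complex.I) (by simp) (fun t => ?_) hpl
    have key : ¬ ((γ t - p).re = -(γ t - p).im ∧ 0 ≤ (γ t - p).re) := by
      rintro ⟨e1, e2⟩
      simp only [Complex.sub_re, Complex.sub_im] at e1 e2
      rcases le_total t (-T₀) with ht | ht
      · have := h.bot (-t) (by linarith)
        rw [neg_neg] at this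
        rw [this] at e2
        simp at e2
        linarith
      rcases le_total T₀ t with ht' | ht'
      · rw [h.top t ht'] at e1 e2
        simp at e1 e2
        linarith
      · have := (Complex.abs_im_le_norm _).trans (hB _ (mem_image_of_mem γ ⟨ht, ht'⟩))
        linarith [neg_abs_le (γ t).im]
    rw [Complex.mem_slitPlane_iff]
    by_contra! hh
    simp only [Complex.mul_re, Complex.mul_im, Complex.sub_re, Complex.sub_im, Complex.neg_re,
      Complex.neg_im, Complex.one_re, Complex.one_im, Complex.I_re, Complex.I_im] at hh
    refine key ⟨?_, ?_⟩ <;> simp only [Complex.sub_re, Complex.sub_im] <;> linarith [hh.1, hh.2]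

theorem cpow_add_ofReal {q : ℝ} (hq0 : 0 < q) (x y : ℂ) :
    (q : ℂ) ^ (x + y) = (q : ℂ) ^ x * (q : ℂ) ^ y :=
  Complex.cpow_add _ _ (by exact_mod_cast hq0.ne')

theorem mem_decreasingPoles_iff {q : ℝ} (hq0 : 0 < q) (hq1 : q < 1) (x s : ℂ) :
    s ∈ decreasingPoles q x ↔ ∃ n : ℕ, (q : ℂ) ^ (x + s) * (q : ℂ) ^ n = 1 := by
  have hq : (q : ℂ) ≠ 0 := by exact_mod_cast hq0.ne'
  have hl : ((Real.log q : ℝ) : ℂ) ≠ 0 := by exact_mod_cast (Real.log_neg hq0 hq1).ne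
  refine exists_congr fun n => ?_
  rw [← Complex.cpow_natCast, ← Complex.cpow_add _ _ hq, Complex.cpow_def_of_ne_zero hq,
    Complex.exp_eq_one_iff, ← Complex.ofReal_log hq0.le]
  refine exists_congr fun m => ⟨fun h => ?_, fun h => ?_⟩
  · rw [h]; field_simp; ring
  · field_simp
    linear_combination h

theorem add_mem_decreasingPoles {q : ℝ} {x s : ℂ} (hs : s ∈ decreasingPoles q x) (m : ℤ) :
    s + 2 * (Real.pi : ℂ) * Complex.I * (m : ℂ) / ((Real.log q : ℝ) : ℂ) ∈ decreasingPoles q x := by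
  obtain ⟨n, k, rfl⟩ := hs
  exact ⟨n, k + m, by push_cast; ring⟩

/-- Every decreasing pole recurs with the same real part at arbitrarily large and small heights, by
the period `2πi / log q`, so it can be compared with both ends of the contour. -/
theorem re_decreasingPole_lt {q : ℝ} (hq0 : 0 < q) (hq1 : q < 1) {γ : ℝ → ℂ} {σ₁ σ₂ T₀ : ℝ}
    (h : IsVerticalOutside γ σ₁ σ₂ T₀) (hγ : IsRegularCurve γ) {x s : ℂ}
    (hx : ∀ p ∈ decreasingPoles q x, LiesLeftOf γ p) (hs : s ∈ decreasingPoles q x) :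
    s.re < σ₁ ∧ s.re < σ₂ := by
  have hl : Real.log q < 0 := Real.log_neg hq0 hq1
  have him : ∀ m : ℤ, (s + 2 * (Real.pi : ℂ) * Complex.I * (m : ℂ) / ((Real.log q : ℝ) : ℂ)) =
      s + ((2 * Real.pi / Real.log q * m : ℝ) : ℂ) * Complex.I := by
    intro m; push_cast; ring
  have hneg : 2 * Real.pi / Real.log q < 0 := div_neg_of_pos_of_neg Real.two_pi_pos hl
  constructor
  · refine h.re_lt_bot hγ fun y => ?_
    obtain ⟨m, hm⟩ := exists_int_gt ((y - s.im) / (2 * Real.pi / Real.log q))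
    refine ⟨_, ?_, ?_, hx _ (add_mem_decreasingPoles hs m)⟩
    · rw [him]; simp
    · rw [him]
      rw [div_lt_iff_of_neg hneg] at hm
      simp
      linarith
  · refine h.re_lt_top hγ fun y => ?_
    obtain ⟨m, hm⟩ := exists_int_lt ((y - s.im) / (2 * Real.pi / Real.log q))
    refine ⟨_, ?_, ?_, hx _ (add_mem_decreasingPoles hs m)⟩
    · rw [him]; simp
    · rw [him]
      rw [lt_div_iff_of_neg hneg] at hm
      simp
      linarith

theorem countable_decreasingPoles (q : ℝ) (x : ℂ) : (decreasingPoles q x).Countable := by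
  have : decreasingPoles q x ⊆ range fun nm : ℕ × ℤ =>
      -x - (nm.1 : ℂ) + 2 * (Real.pi : ℂ) * Complex.I * (nm.2 : ℂ) / ((Real.log q : ℝ) : ℂ) := by
    rintro _ ⟨n, m, rfl⟩
    exact ⟨(n, m), rfl⟩
  exact (countable_range _).mono this

theorem finite_decreasingPoles_inter_ball {q : ℝ} (hq0 : 0 < q) (hq1 : q < 1) (x : ℂ) (R : ℝ) :
    (decreasingPoles q x ∩ Metric.ball 0 R).Finite := by
  have hl : Real.log q < 0 := Real.log_neg hq0 hq1
  obtain ⟨N, hN⟩ := exists_nat_gt (R + ‖x‖)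
  obtain ⟨K, hK⟩ := exists_nat_gt ((R + ‖x‖) * |Real.log q| / (2 * Real.pi))
  refine ((Finset.range N ×ˢ Finset.Icc (-K : ℤ) K).finite_toSet.image fun nm : ℕ × ℤ =>
      -x - (nm.1 : ℂ) + 2 * (Real.pi : ℂ) * Complex.I * (nm.2 : ℂ) / ((Real.log q : ℝ) : ℂ)).subset ?_
  rintro _ ⟨⟨n, m, rfl⟩, hb⟩
  refine ⟨(n, m), ?_, rfl⟩
  have e : (-x - (n : ℂ) + 2 * (Real.pi : ℂ) * Complex.I * (m : ℂ) / ((Real.log q : ℝ) : ℂ)) + x =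
      ((-n : ℝ) : ℂ) + ((2 * Real.pi / Real.log q * m : ℝ) : ℂ) * Complex.I := by
    push_cast; ring
  rw [mem_ball_zero_iff] at hb
  have hb' := (norm_add_le _ x).trans_lt (add_lt_add_left hb ‖x‖)
  rw [e] at hb'
  have h1 := (Complex.abs_re_le_norm _).trans_lt hb'
  have h2 := (Complex.abs_im_le_norm _).trans_lt hb'
  simp only [Complex.add_re, Complex.add_im, Complex.ofReal_re, Complex.ofReal_im, Complex.mul_re,
    Complex.mul_im, Complex.I_re, Complex.I_im, mul_zero, mul_one, sub_zero, add_zero, zero_add,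
    abs_neg, Nat.abs_cast] at h1 h2
  rw [abs_mul, abs_div, abs_of_pos Real.two_pi_pos, div_mul_eq_mul_div, div_lt_iff₀ (by simpa using hl.ne)] at h2
  have h3 : |(m : ℝ)| < K := by
    refine lt_trans ?_ hK
    rw [lt_div_iff₀ Real.two_pi_pos]
    linarith
  simp only [Finset.coe_product, mem_prod, Finset.mem_coe, Finset.mem_range, Finset.mem_Icc]
  obtain ⟨h4, h5⟩ := abs_lt.1 h3
  refine ⟨by exact_mod_cast h1.trans hN, ?_, ?_⟩
  · exact_mod_cast h4.le
  · exact_mod_cast h5.le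

theorem finite_increasingPoles_inter_ball (x : ℂ) (R : ℝ) :
    (increasingPoles x ∩ Metric.ball 0 R).Finite := by
  obtain ⟨N, hN⟩ := exists_nat_gt (R + ‖x‖)
  refine ((Finset.range N).finite_toSet.image fun n : ℕ => x + (n : ℂ)).subset ?_
  rintro _ ⟨⟨n, rfl⟩, hb⟩
  refine ⟨n, ?_, rfl⟩
  rw [mem_ball_zero_iff] at hb
  have : (n : ℝ) ≤ ‖x + n‖ + ‖x‖ := by
    have := norm_sub_le (x + n) x
    simpa using this
  rw [Finset.mem_coe, Finset.mem_range]
  exact_mod_cast (this.trans_lt (by linarith)).trans hN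

theorem qPochInf_cpow_ne_zero {q : ℝ} (hq0 : 0 < q) (hq1 : q < 1) {x s : ℂ}
    (hs : s ∉ decreasingPoles q x) : qPochInf q ((q : ℂ) ^ x * (q : ℂ) ^ s) ≠ 0 := by
  have hq : ‖(q : ℂ)‖ < 1 := by rwa [Complex.norm_real, Real.norm_of_nonneg hq0.le]
  refine qPochInf_ne_zero hq fun n h => hs ((mem_decreasingPoles_iff hq0 hq1 x s).2 ⟨n, ?_⟩)
  rwa [cpow_add_ofReal hq0]

end LeftPoles

/-! ### Removing the removable singularities of the sine quotients -/

section RegularisedQuotient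

open Filter Topology Set MeasureTheory

/-- The quotient `f / g`, with the removable singularities at the simple zeros of `g` that are
zeros of `f` removed. -/
noncomputable def regQuot (f g : ℂ → ℂ) (z : ℂ) : ℂ :=
  if g z = 0 then deriv f z / deriv g z else f z / g z

theorem regQuot_of_ne {f g : ℂ → ℂ} {z : ℂ} (h : g z ≠ 0) : regQuot f g z = f z / g z := if_neg h

theorem eventually_ne_zero_of_simple {g : ℂ → ℂ} (hg : Differentiable ℂ g) {z : ℂ}
    (h : g z = 0 → deriv g z ≠ 0) : ∀ᶠ w in 𝓝[≠] z, g w ≠ 0 := by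
  by_cases h0 : g z = 0
  · have := (hg z).hasDerivAt.eventually_ne (h h0) (c := 0)
    exact this
  · exact ((hg z).continuousAt.eventually_ne h0).filter_mono nhdsWithin_le_nhds

theorem meromorphicAt_regQuot {f g : ℂ → ℂ} (hf : Differentiable ℂ f) (hg : Differentiable ℂ g)
    {z : ℂ} (h : g z = 0 → deriv g z ≠ 0) : MeromorphicAt (regQuot f g) z := by
  refine (((hf.analyticAt z).meromorphicAt.div (hg.analyticAt z).meromorphicAt)).congr ?_
  filter_upwards [eventually_ne_zero_of_simple hg h] with w hw
  rw [regQuot_of_ne hw, Pi.div_apply]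

/-- At a common zero `f / g` is the quotient of the two `dslope`s, whose value there is the quotient
of the derivatives. -/
theorem differentiableAt_regQuot {f g : ℂ → ℂ} (hf : Differentiable ℂ f) (hg : Differentiable ℂ g)
    {z : ℂ} (h : g z = 0 → f z = 0 ∧ deriv g z ≠ 0) : DifferentiableAt ℂ (regQuot f g) z := by
  by_cases h0 : g z = 0
  · obtain ⟨hf0, hg1⟩ := h h0
    have hd : ∀ k : ℂ → ℂ, Differentiable ℂ k → Differentiable ℂ (dslope k z) := fun k hk => by
      rw [← differentiableOn_univ] at hk ⊢
      exact (Complex.differentiableOn_dslope univ_mem).2 hk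
    have h1 : DifferentiableAt ℂ (fun w => dslope f z w / dslope g z w) z :=
      (hd f hf z).div (hd g hg z) (by rwa [dslope_same])
    refine h1.congr_of_eventuallyEq ?_
    have h2 := eventually_nhdsWithin_iff.1 (eventually_ne_zero_of_simple hg fun _ => hg1)
    filter_upwards [h2] with w hw
    by_cases hwz : w = z
    · rw [hwz, dslope_same, dslope_same, regQuot, if_pos h0]
    · rw [regQuot_of_ne (hw hwz), dslope_of_ne _ hwz, dslope_of_ne _ hwz, slope_def_field,
        slope_def_field, hf0, h0, sub_zero, sub_zero, div_div_div_cancel_right₀ (sub_ne_zero.2 hwz)]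
  · have h1 : DifferentiableAt ℂ (fun w => f w / g w) z := (hf z).div (hg z) h0
    refine h1.congr_of_eventuallyEq ?_
    filter_upwards [(hg z).continuousAt.eventually_ne h0] with w hw using regQuot_of_ne hw

theorem tendsto_sub_mul_regQuot {f g : ℂ → ℂ} (hf : Differentiable ℂ f) (hg : Differentiable ℂ g)
    {z : ℂ} (h0 : g z = 0) (h1 : deriv g z ≠ 0) :
    Tendsto (fun w => (w - z) * regQuot f g w) (𝓝[≠] z) (𝓝 (f z / deriv g z)) := by
  have h2 := (hasDerivAt_iff_tendsto_slope.1 (hg z).hasDerivAt)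
  have h3 := ((hf z).continuousAt.tendsto.mono_left nhdsWithin_le_nhds).div h2 h1
  refine h3.congr' ?_
  filter_upwards [eventually_ne_zero_of_simple hg fun _ => h1, self_mem_nhdsWithin] with w hw hwz
  have : w - z ≠ 0 := sub_ne_zero.2 hwz
  rw [regQuot_of_ne hw, Pi.div_apply, slope_def_field, h0, sub_zero]
  field_simp

/-- `‖sin (x + iy)‖ ^ 2 = sin x ^ 2 + sinh y ^ 2`. A linear bound is enough, since two sines then
give integrable decay `1 / y ^ 2`. -/
theorem abs_im_le_norm_sin (w : ℂ) : |w.im| ≤ ‖Complex.sin (Real.pi * w)‖ := by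
  have key : ∀ z : ℂ, |z.im| ≤ ‖Complex.sin z‖ := by
    intro z
    have h1 : |Real.sinh z.im| ≤ ‖Complex.sin z‖ := by
      rw [← sq_le_sq₀ (abs_nonneg _) (norm_nonneg _), sq_abs, ← Complex.normSq_eq_norm_sq,
        Complex.sin_eq, Complex.normSq_apply]
      simp only [Complex.add_re, Complex.add_im, Complex.mul_re, Complex.mul_im, Complex.I_re,
        Complex.I_im, ← Complex.ofReal_sin, ← Complex.ofReal_cos, ← Complex.ofReal_cosh,
        ← Complex.ofReal_sinh, Complex.ofReal_re, Complex.ofReal_im]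
      have := Real.sin_sq_add_cos_sq z.re
      have h2 := Real.cosh_sq z.im
      nlinarith [sq_nonneg (Real.sin z.re)]
    refine le_trans ?_ h1
    rw [Real.abs_sinh]
    exact Real.self_le_sinh_iff.2 (abs_nonneg _)
  refine le_trans ?_ (key _)
  rw [Complex.im_ofReal_mul, abs_mul, abs_of_pos Real.pi_pos]
  nlinarith [Real.pi_gt_three, abs_nonneg w.im]

theorem sin_sub_nat_mul_pi (z : ℂ) (n : ℕ) :
    Complex.sin (z - n * Real.pi) = (-1) ^ n * Complex.sin z := by
  have := Complex.sin_antiperiodic.sub_nat_mul_eq n (x := z)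
  simpa using this

theorem cos_sub_nat_mul_pi (z : ℂ) (n : ℕ) :
    Complex.cos (z - n * Real.pi) = (-1) ^ n * Complex.cos z := by
  have := Complex.cos_antiperiodic.sub_nat_mul_eq n (x := z)
  simpa using this

theorem differentiable_sin_pi_sub (c : ℂ) :
    Differentiable ℂ fun s => Complex.sin (Real.pi * (c - s)) := by fun_prop

theorem deriv_sin_pi_sub (c s : ℂ) : deriv (fun s => Complex.sin (Real.pi * (c - s))) s =
    -(Real.pi * Complex.cos (Real.pi * (c - s))) := by
  have h1 : HasDerivAt (fun s : ℂ => Real.pi * (c - s)) (Real.pi * -1 : ℂ) s :=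
    ((hasDerivAt_id s).const_sub c).const_mul _
  rw [h1.csin.deriv]
  ring

theorem deriv_sin_pi_sub_ne_zero {c s : ℂ} (h : Complex.sin (Real.pi * (c - s)) = 0) :
    deriv (fun s => Complex.sin (Real.pi * (c - s))) s ≠ 0 := by
  rw [deriv_sin_pi_sub, neg_ne_zero]
  refine mul_ne_zero (by exact_mod_cast Real.pi_ne_zero) fun h' => ?_
  have := Complex.sin_sq_add_cos_sq (Real.pi * (c - s))
  rw [h, h'] at this
  simp at this

theorem sin_pi_mul_eq_zero_iff {w : ℂ} : Complex.sin (Real.pi * w) = 0 ↔ ∃ k : ℤ, w = k := by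
  rw [Complex.sin_eq_zero_iff]
  have hpi : (Real.pi : ℂ) ≠ 0 := by exact_mod_cast Real.pi_ne_zero
  refine exists_congr fun k => ⟨fun h => mul_left_cancel₀ hpi (h.trans (mul_comm _ _)), ?_⟩
  rintro rfl
  exact mul_comm _ _

theorem differentiable_qPochInf_cpow {q : ℝ} (hq0 : 0 < q) (hq1 : q < 1) (x : ℂ) :
    Differentiable ℂ fun s => qPochInf q ((q : ℂ) ^ (x + s)) := by
  have hq : ‖(q : ℂ)‖ < 1 := by rwa [Complex.norm_real, Real.norm_of_nonneg hq0.le]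
  have h : Differentiable ℂ fun s : ℂ => (q : ℂ) ^ (x + s) := fun s =>
    DifferentiableAt.const_cpow (by fun_prop) (Or.inl (by exact_mod_cast hq0.ne'))
  exact (differentiable_qPochInf hq).comp h

/-- The quotient `(q^(1-c+s); q)_∞ / sin π(c - s)`, which has poles at `c, c + 1, …` only. -/
noncomputable def sineQuot (q : ℝ) (c : ℂ) : ℂ → ℂ :=
  regQuot (fun s => qPochInf q ((q : ℂ) ^ (1 - c + s))) fun s => Complex.sin (Real.pi * (c - s))

theorem sineQuot_of_ne {q : ℝ} {c s : ℂ} (h : Complex.sin (Real.pi * (c - s)) ≠ 0) :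
    sineQuot q c s = qPochInf q ((q : ℂ) ^ (1 - c + s)) / Complex.sin (Real.pi * (c - s)) :=
  regQuot_of_ne h

theorem meromorphicAt_sineQuot {q : ℝ} (hq0 : 0 < q) (hq1 : q < 1) (c s : ℂ) :
    MeromorphicAt (sineQuot q c) s :=
  meromorphicAt_regQuot (differentiable_qPochInf_cpow hq0 hq1 _) (differentiable_sin_pi_sub c)
    deriv_sin_pi_sub_ne_zero

theorem differentiableAt_sineQuot {q : ℝ} (hq0 : 0 < q) (hq1 : q < 1) {c s : ℂ}
    (hs : s ∉ increasingPoles c) : DifferentiableAt ℂ (sineQuot q c) s := by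
  have hq : ‖(q : ℂ)‖ < 1 := by rwa [Complex.norm_real, Real.norm_of_nonneg hq0.le]
  refine differentiableAt_regQuot (differentiable_qPochInf_cpow hq0 hq1 _)
    (differentiable_sin_pi_sub c) fun h => ⟨?_, deriv_sin_pi_sub_ne_zero h⟩
  obtain ⟨k, hk⟩ := sin_pi_mul_eq_zero_iff.1 h
  -- Here `c - s = k`. For `k ≤ 0` the point belongs to the increasing sequence; for `k = m + 1` the
  -- factor `1 - q ^ (1 - c + s + m)` of the numerator vanishes.
  rcases le_or_gt k 0 with hk0 | hk0
  · refine absurd ⟨k.natAbs, ?_⟩ hs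
    have : (k.natAbs : ℂ) = ((k.natAbs : ℤ) : ℂ) := (Int.cast_natCast _).symm
    rw [this, Int.ofNat_natAbs_of_nonpos hk0]
    push_cast
    linear_combination -hk
  · obtain ⟨m, rfl⟩ : ∃ m : ℕ, k = m + 1 := ⟨(k - 1).toNat, by omega⟩
    refine qPochInf_eq_zero hq (n := m) ?_
    rw [← Complex.cpow_natCast, ← cpow_add_ofReal hq0]
    have : 1 - c + s + (m : ℂ) = 0 := by push_cast at hk; linear_combination -hk
    rw [this, Complex.cpow_zero]

theorem tendsto_sub_mul_sineQuot {q : ℝ} (hq0 : 0 < q) (hq1 : q < 1) (c : ℂ) (n : ℕ) :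
    Tendsto (fun s => (s - (c + n)) * sineQuot q c s) (𝓝[≠] (c + n))
      (𝓝 (-((-1) ^ n * qPochInf q ((q : ℂ) ^ (1 - c + (c + n))) / Real.pi))) := by
  have e : ((Real.pi : ℂ) * (c - (c + n))) = 0 - n * Real.pi := by ring
  have h0 : Complex.sin (Real.pi * (c - (c + n))) = 0 := by
    rw [e, sin_sub_nat_mul_pi, Complex.sin_zero, mul_zero]
  have h := tendsto_sub_mul_regQuot (differentiable_qPochInf_cpow hq0 hq1 (1 - c))
    (differentiable_sin_pi_sub c) h0 (deriv_sin_pi_sub_ne_zero h0)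
  unfold sineQuot
  convert h using 2
  rw [deriv_sin_pi_sub, e, cos_sub_nat_mul_pi, Complex.cos_zero, mul_one]
  have hpi : (Real.pi : ℂ) ≠ 0 := by exact_mod_cast Real.pi_ne_zero
  rcases neg_one_pow_eq_or ℂ n with h | h <;> rw [h] <;> ring_nf

/-- The sign `(-1) ^ n` cancels that of the residue of `sineQuot q c` at `c + n`; hence the residues
form a Jackson sum without alternating signs. -/
theorem sineQuot_add_nat {q : ℝ} {c d : ℂ} (h : ∀ k : ℤ, c - d ≠ k) (n : ℕ) :
    sineQuot q d (c + n) = (-1) ^ n * qPochInf q ((q : ℂ) ^ (1 - d + (c + n))) /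
      Complex.sin (Real.pi * (d - c)) := by
  have hs : Complex.sin (Real.pi * (d - c)) ≠ 0 := fun h0 => by
    obtain ⟨k, hk⟩ := sin_pi_mul_eq_zero_iff.1 h0
    exact h (-k) (by push_cast; linear_combination -hk)
  have e : Complex.sin (Real.pi * (d - (c + n))) =
      (-1) ^ n * Complex.sin (Real.pi * (d - c)) := by
    rw [← sin_sub_nat_mul_pi]
    congr 1
    ring
  have hm : ((-1 : ℂ)) ^ n ≠ 0 := pow_ne_zero _ (by norm_num)
  rw [sineQuot_of_ne (by rw [e]; exact mul_ne_zero hm hs), e]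
  rcases neg_one_pow_eq_or ℂ n with h | h <;> rw [h]
  · simp
  · ring

end RegularisedQuotient

/-! ### Regularity and boundedness of the core -/

section CoreRegularity

open Filter Topology Set

variable {q : ℂ}

/-- The series factor of `barnesCore`. -/
noncomputable def barnesSeries (q A B C D E F G x : ℂ) : ℂ :=
  ∑' n, qPoch q E n * qPoch q (A * x) n * qPoch q (B * x) n / qPoch q q n *
    (qPochInf q (A * B * C * D * F * x * q ^ n) * qPochInf q (E * G * x * q ^ n)) *
    (C * D * F * G) ^ n

theorem differentiable_barnesSeries (hq : ‖q‖ < 1) (A B C D E F G : ℂ)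
    (hw : ‖C * D * F * G‖ < 1) : Differentiable ℂ (barnesSeries q A B C D E F G) := by
  intro x
  set U : Set ℂ := Metric.ball 0 (‖x‖ + 1)
  have bx : BddFamily fun p : ℕ × U => (p.2 : ℂ) :=
    ⟨‖x‖ + 1, fun p => (mem_ball_zero_iff.1 p.2.2).le⟩
  have bq : BddFamily fun p : ℕ × U => q ^ p.1 := .pow_of_norm_lt hq _
  have b1 : BddFamily fun p : ℕ × U => qPoch q E p.1 := (BddFamily.const E).comp_qPoch hq _
  have b2 : BddFamily fun p : ℕ × U => qPoch q (A * p.2) p.1 :=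
    ((BddFamily.const A).mul bx).comp_qPoch hq _
  have b3 : BddFamily fun p : ℕ × U => qPoch q (B * p.2) p.1 :=
    ((BddFamily.const B).mul bx).comp_qPoch hq _
  have b4 : BddFamily fun p : ℕ × U => qPochInf q (A * B * C * D * F * p.2 * q ^ p.1) :=
    (((BddFamily.const (A * B * C * D * F)).mul bx).mul bq).comp_qPochInf hq
  have b5 : BddFamily fun p : ℕ × U => qPochInf q (E * G * p.2 * q ^ p.1) :=
    (((BddFamily.const (E * G)).mul bx).mul bq).comp_qPochInf hq
  obtain ⟨K, hK⟩ := (((b1.mul b2).mul b3).div_qPoch_self hq fun p => p.1).mul (b4.mul b5)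
  have hd := differentiable_qPochInf hq
  have := Complex.differentiableOn_tsum_of_summable_norm (U := U)
    (F := fun n x => qPoch q E n * qPoch q (A * x) n * qPoch q (B * x) n / qPoch q q n *
      (qPochInf q (A * B * C * D * F * x * q ^ n) * qPochInf q (E * G * x * q ^ n)) *
      (C * D * F * G) ^ n)
    ((summable_geometric_of_lt_one (norm_nonneg _) hw).mul_left K) (fun n => ?_)
    Metric.isOpen_ball fun n x hx => ?_
  · exact this.differentiableAt (Metric.isOpen_ball.mem_nhds (by simp))
  · have h1 : ∀ y : ℂ, Differentiable ℂ fun x => qPoch q (y * x) n := fun y =>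
      (differentiable_qPoch q n).comp (by fun_prop)
    have h2 : ∀ y : ℂ, Differentiable ℂ fun x => qPochInf q (y * x * q ^ n) := fun y =>
      hd.comp (by fun_prop)
    have h3 := h1 A
    have h4 := h1 B
    have h5 := h2 (A * B * C * D * F)
    have h6 := h2 (E * G)
    simp only [div_eq_mul_inv]
    exact Differentiable.differentiableOn (by fun_prop)
  · rw [norm_mul, norm_pow]
    exact mul_le_mul_of_nonneg_right (hK (n, ⟨x, hx⟩)) (by positivity)

theorem barnesCore_eq (A B C D E F G x : ℂ) : barnesCore q A B C D E F G x =
    qPochInf q (q * x / C) * qPochInf q (q * x / D) /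
    (qPochInf q (A * x) * qPochInf q (B * x) * qPochInf q (F * x) * qPochInf q (G * x)) *
    barnesSeries q A B C D E F G x := rfl

/-- No denominator vanishes on this closed disc, so the core is continuous on a compact set. With `ρ
= q ^ σ` the disc contains the image of the half-plane `σ ≤ Re s` under `s ↦ q ^ s`. -/
theorem exists_norm_barnesCore_le (hq : ‖q‖ < 1) {A B C D E F G : ℂ} (hw : ‖C * D * F * G‖ < 1)
    {ρ : ℝ} (hA : ‖A‖ * ρ < 1) (hB : ‖B‖ * ρ < 1) (hF : ‖F‖ * ρ < 1) (hG : ‖G‖ * ρ < 1) :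
    ∃ K, ∀ x : ℂ, ‖x‖ ≤ ρ → ‖barnesCore q A B C D E F G x‖ ≤ K := by
  have hd := differentiable_qPochInf hq
  have hc : ∀ y : ℂ, Continuous fun x => qPochInf q (y * x) := fun y =>
    hd.continuous.comp (by fun_prop)
  have hc' : ∀ y : ℂ, Continuous fun x => qPochInf q (q * x / y) := fun y =>
    hd.continuous.comp (by fun_prop)
  have hne : ∀ y : ℂ, ‖y‖ * ρ < 1 → ∀ x ∈ Metric.closedBall (0 : ℂ) ρ, qPochInf q (y * x) ≠ 0 :=
    fun y hy x hx => qPochInf_ne_zero_of_norm_lt hq <| by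
      rw [norm_mul]
      exact (mul_le_mul_of_nonneg_left (mem_closedBall_zero_iff.1 hx) (norm_nonneg _)).trans_lt hy
  have hcont : ContinuousOn (barnesCore q A B C D E F G) (Metric.closedBall 0 ρ) := by
    have h1 : ContinuousOn (fun x => qPochInf q (q * x / C) * qPochInf q (q * x / D))
      (Metric.closedBall 0 ρ) := ((hc' C).mul (hc' D)).continuousOn
    exact (h1.div ((((hc A).mul (hc B)).mul (hc F)).mul (hc G)).continuousOn fun x hx =>
      mul_ne_zero (mul_ne_zero (mul_ne_zero (hne A hA x hx) (hne B hB x hx)) (hne F hF x hx))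
        (hne G hG x hx)).mul (differentiable_barnesSeries hq A B C D E F G hw).continuous.continuousOn
  obtain ⟨K, hK⟩ := (isCompact_closedBall (0 : ℂ) ρ).exists_bound_of_continuousOn hcont
  exact ⟨K, fun x hx => hK x (mem_closedBall_zero_iff.2 hx)⟩

end CoreRegularity

/-! ### Exceptional points on the contour, and an integrability criterion -/

section CurveNull

open Filter Topology Set MeasureTheory

/-- A passage through `p` with nonzero derivative happens at an isolated time, and a discrete set of
times is countable, hence null. The curve may rest at `p` for a long time, but then `deriv γ` is 0.
-/
theorem ae_deriv_eq_zero_of_mem_countable (γ : ℝ → ℂ) {E : Set ℂ} (hE : E.Countable) :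
    ∀ᵐ t : ℝ, γ t ∈ E → deriv γ t = 0 := by
  have h1 : ∀ p : ℂ, {t : ℝ | γ t = p ∧ deriv γ t ≠ 0}.Countable := fun p => by
    have : DiscreteTopology {t : ℝ | γ t = p ∧ deriv γ t ≠ 0} := by
      rw [discreteTopology_subtype_iff]
      rintro t ⟨ht, hd⟩
      have h2 := (differentiableAt_of_deriv_ne_zero hd).hasDerivAt.eventually_ne (c := p) hd
      rw [← le_bot_iff]
      intro s _
      have h3 : {z | γ z ≠ p} ∩ {t : ℝ | γ t = p ∧ deriv γ t ≠ 0} ∈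
          𝓝[≠] t ⊓ 𝓟 {t : ℝ | γ t = p ∧ deriv γ t ≠ 0} :=
        inter_mem_inf h2 (mem_principal_self _)
      exact mem_of_superset h3 fun x hx => absurd hx.2.1 hx.1
    exact TopologicalSpace.separableSpace_iff_countable.1 inferInstance
  have h2 := (hE.biUnion fun p _ => h1 p).measure_zero volume
  refine (measure_eq_zero_iff_ae_notMem.1 h2).mono fun t ht hγ => ?_
  by_contra hd
  exact ht (mem_biUnion hγ ⟨rfl, hd⟩)

/-- Integrability of a function on the line with decay `1 / t ^ 2`. -/
theorem integrable_of_le_div_sq {f : ℝ → ℂ} (hf : AEStronglyMeasurable f) {T C K : ℝ}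
    (hT : 1 ≤ T) (h1 : ∀ t, |t| ≤ T → ‖f t‖ ≤ C) (h2 : ∀ t, T ≤ |t| → ‖f t‖ ≤ K / t ^ 2) :
    Integrable f := by
  refine (integrable_inv_one_add_sq.const_mul (|C| * (1 + T ^ 2) + 2 * |K|)).mono' hf
    (Eventually.of_forall fun t => ?_)
  have hp : 0 < 1 + t ^ 2 := by positivity
  rw [← div_eq_mul_inv, le_div_iff₀ hp]
  rcases le_total |t| T with ht | ht
  · have h3 : t ^ 2 ≤ T ^ 2 := sq_le_sq' (by linarith [neg_abs_le t]) ((le_abs_self t).trans ht)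
    have h4 : ‖f t‖ ≤ |C| := (h1 t ht).trans (le_abs_self C)
    calc ‖f t‖ * (1 + t ^ 2) ≤ |C| * (1 + T ^ 2) :=
          mul_le_mul h4 (by linarith) hp.le (abs_nonneg _)
      _ ≤ _ := by linarith [abs_nonneg K]
  · have h5 : 1 ≤ t ^ 2 := by
      rw [← sq_abs]
      exact one_le_pow₀ (hT.trans ht)
    have h6 : ‖f t‖ ≤ |K| / t ^ 2 :=
      (h2 t ht).trans (div_le_div_of_nonneg_right (le_abs_self K) (by positivity))
    calc ‖f t‖ * (1 + t ^ 2) ≤ |K| / t ^ 2 * (2 * t ^ 2) :=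
          mul_le_mul h6 (by linarith) hp.le (by positivity)
      _ = 2 * |K| := by
        have : t ^ 2 ≠ 0 := by positivity
        rw [div_mul_eq_mul_div, div_eq_iff this]
        ring
      _ ≤ _ := by nlinarith [abs_nonneg C, mul_nonneg (abs_nonneg C) (sq_nonneg T)]

end CurveNull

/-! ### The regularised integrand and its residues -/

section RegularisedIntegrand

open Filter Topology Set MeasureTheory

/-- The integrand with its removable singularities removed. -/
noncomputable def barnesReg (q : ℝ) (a b c d e f g s : ℂ) : ℂ :=
  sineQuot q c s * sineQuot q d s * (Real.pi * (q : ℂ) ^ s *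
    barnesSeries q ((q : ℂ) ^ a) ((q : ℂ) ^ b) ((q : ℂ) ^ c) ((q : ℂ) ^ d) ((q : ℂ) ^ e)
      ((q : ℂ) ^ f) ((q : ℂ) ^ g) ((q : ℂ) ^ s) /
    (qPochInf q ((q : ℂ) ^ (a + s)) * qPochInf q ((q : ℂ) ^ (b + s)) *
      qPochInf q ((q : ℂ) ^ (f + s)) * qPochInf q ((q : ℂ) ^ (g + s))))

variable {q : ℝ} {a b c d e f g : ℂ}

theorem norm_ofReal_lt_one (hq0 : 0 < q) (hq1 : q < 1) : ‖(q : ℂ)‖ < 1 := by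
  rwa [Complex.norm_real, Real.norm_of_nonneg hq0.le]

theorem differentiable_cpow_ofReal (hq0 : 0 < q) : Differentiable ℂ fun s : ℂ => (q : ℂ) ^ s :=
  fun _ => DifferentiableAt.const_cpow (by fun_prop) (Or.inl (by exact_mod_cast hq0.ne'))

theorem qPochInf_cpow_add_ne_zero (hq0 : 0 < q) (hq1 : q < 1) {x s : ℂ}
    (hs : s ∉ decreasingPoles q x) : qPochInf q ((q : ℂ) ^ (x + s)) ≠ 0 := by
  rw [cpow_add_ofReal hq0]
  exact qPochInf_cpow_ne_zero hq0 hq1 hs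

theorem cpow_one_sub_add (hq0 : 0 < q) (x s : ℂ) :
    (q : ℂ) ^ (1 - x + s) = q * (q : ℂ) ^ s / (q : ℂ) ^ x := by
  rw [sub_eq_add_neg, cpow_add_ofReal hq0, cpow_add_ofReal hq0, Complex.cpow_neg, Complex.cpow_one]
  ring

theorem barnesReg_eq_barnesCore (hq0 : 0 < q) {s : ℂ}
    (hc : Complex.sin (Real.pi * (c - s)) ≠ 0) (hd : Complex.sin (Real.pi * (d - s)) ≠ 0) :
    barnesReg q a b c d e f g s = Real.pi * (q : ℂ) ^ s *
      barnesCore q ((q : ℂ) ^ a) ((q : ℂ) ^ b) ((q : ℂ) ^ c) ((q : ℂ) ^ d) ((q : ℂ) ^ e)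
      ((q : ℂ) ^ f) ((q : ℂ) ^ g) ((q : ℂ) ^ s) /
      (Complex.sin (Real.pi * (c - s)) * Complex.sin (Real.pi * (d - s))) := by
  rw [barnesReg, sineQuot_of_ne hc, sineQuot_of_ne hd, barnesCore_eq, cpow_one_sub_add hq0,
    cpow_one_sub_add hq0, cpow_add_ofReal hq0 a, cpow_add_ofReal hq0 b, cpow_add_ofReal hq0 f,
    cpow_add_ofReal hq0 g]
  ring

theorem qPochInf_mul_pow_eq_div {q x : ℂ} (hq : ‖q‖ < 1) (hx : qPochInf q x ≠ 0) (n : ℕ) :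
    qPochInf q (x * q ^ n) = qPochInf q x / qPoch q x n := by
  have h := qPochInf_eq hq x n
  have h0 : qPoch q x n ≠ 0 := fun h0 => hx (by rw [h, h0, zero_mul])
  rw [h, mul_div_cancel_left₀ _ h0]

theorem barnesSeries_eq_phi32 {q A B C D E F G x : ℂ} (hq : ‖q‖ < 1)
    (h1 : qPochInf q (A * B * C * D * F * x) ≠ 0) (h2 : qPochInf q (E * G * x) ≠ 0) :
    barnesSeries q A B C D E F G x = qPochInf q (A * B * C * D * F * x) * qPochInf q (E * G * x) *
      phi32 q E (A * x) (B * x) (E * G * x) (A * B * C * D * F * x) (C * D * F * G) := by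
  rw [phi32, ← tsum_mul_left]
  refine tsum_congr fun n => ?_
  rw [qPochInf_mul_pow_eq_div hq h1, qPochInf_mul_pow_eq_div hq h2]
  ring

theorem barnesIntegrand_eq_barnesReg (hq0 : 0 < q) (hq1 : q < 1) {s : ℂ}
    (hc : Complex.sin (Real.pi * (c - s)) ≠ 0) (hd : Complex.sin (Real.pi * (d - s)) ≠ 0)
    (h1 : s ∉ decreasingPoles q (a + b + c + d + f)) (h2 : s ∉ decreasingPoles q (e + g)) :
    barnesIntegrand q a b c d e f g s = barnesReg q a b c d e f g s := by
  have h1' := qPochInf_cpow_ne_zero hq0 hq1 h1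
  have h2' := qPochInf_cpow_ne_zero hq0 hq1 h2
  rw [barnesIntegrand, barnesReg, sineQuot_of_ne hc, sineQuot_of_ne hd]
  simp only [cpow_add_ofReal hq0 _ s, cpow_add_ofReal hq0 _ f, cpow_add_ofReal hq0 _ d,
    cpow_add_ofReal hq0 _ c, cpow_add_ofReal hq0 _ b, cpow_add_ofReal hq0 _ g] at h1' h2' ⊢
  rw [barnesSeries_eq_phi32 (norm_ofReal_lt_one hq0 hq1) h1' h2']
  ring

/-- The contour may meet the cancelled zeros `c - 1, c - 2, …` of the sine, or points where a lower
parameter makes the series degenerate. There `barnesIntegrand` has junk values from division by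
zero, but the set is countable. -/
theorem ae_barnesIntegrand_eq (hq0 : 0 < q) (hq1 : q < 1) (a b c d e f g : ℂ) (γ : ℝ → ℂ) :
    ∀ᵐ t : ℝ, barnesIntegrand q a b c d e f g (γ t) * deriv γ t =
      barnesReg q a b c d e f g (γ t) * deriv γ t := by
  have hs : ∀ c : ℂ, {s : ℂ | Complex.sin (Real.pi * (c - s)) = 0}.Countable := fun c => by
    refine (countable_range fun k : ℤ => c - (k : ℂ)).mono fun s hs => ?_
    obtain ⟨k, hk⟩ := sin_pi_mul_eq_zero_iff.1 hs
    exact ⟨k, by simp only; rw [← hk]; ring⟩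
  filter_upwards [ae_deriv_eq_zero_of_mem_countable γ ((hs c).union (hs d)),
    ae_deriv_eq_zero_of_mem_countable γ ((countable_decreasingPoles q (a + b + c + d + f)).union
      (countable_decreasingPoles q (e + g)))] with t h1 h2
  by_cases hd : deriv γ t = 0
  · rw [hd, mul_zero, mul_zero]
  · have h1' := fun h => hd (h1 h)
    have h2' := fun h => hd (h2 h)
    rw [barnesIntegrand_eq_barnesReg hq0 hq1 (fun h => h1' (Or.inl h)) (fun h => h1' (Or.inr h))
      (fun h => h2' (Or.inl h)) fun h => h2' (Or.inr h)]

theorem differentiable_barnesSeries_cpow (hq0 : 0 < q) (hq1 : q < 1) (A B C D E F G : ℂ)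
    (hw : ‖C * D * F * G‖ < 1) :
    Differentiable ℂ fun s : ℂ => barnesSeries q A B C D E F G ((q : ℂ) ^ s) :=
  (differentiable_barnesSeries (norm_ofReal_lt_one hq0 hq1) A B C D E F G hw).comp
    (differentiable_cpow_ofReal hq0)

theorem norm_cpow_mul_lt_one (hq0 : 0 < q) (hw : ‖(q : ℂ) ^ (c + d + f + g)‖ < 1) :
    ‖(q : ℂ) ^ c * (q : ℂ) ^ d * (q : ℂ) ^ f * (q : ℂ) ^ g‖ < 1 := by
  simpa only [cpow_add_ofReal hq0] using hw

theorem differentiableAt_barnesReg_factor (hq0 : 0 < q) (hq1 : q < 1)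
    (hw : ‖(q : ℂ) ^ (c + d + f + g)‖ < 1) {s : ℂ}
    (hs : s ∉ decreasingPoles q a ∪ decreasingPoles q b ∪ decreasingPoles q f ∪
      decreasingPoles q g) :
    DifferentiableAt ℂ (fun s : ℂ => Real.pi * (q : ℂ) ^ s *
      barnesSeries q ((q : ℂ) ^ a) ((q : ℂ) ^ b) ((q : ℂ) ^ c) ((q : ℂ) ^ d) ((q : ℂ) ^ e)
        ((q : ℂ) ^ f) ((q : ℂ) ^ g) ((q : ℂ) ^ s) /
      (qPochInf q ((q : ℂ) ^ (a + s)) * qPochInf q ((q : ℂ) ^ (b + s)) *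
        qPochInf q ((q : ℂ) ^ (f + s)) * qPochInf q ((q : ℂ) ^ (g + s)))) s := by
  simp only [mem_union, not_or] at hs
  obtain ⟨⟨⟨h1, h2⟩, h3⟩, h4⟩ := hs
  have hp := differentiable_qPochInf_cpow hq0 hq1
  have hS := differentiable_barnesSeries_cpow hq0 hq1 ((q : ℂ) ^ a) ((q : ℂ) ^ b) _ _ ((q : ℂ) ^ e)
    _ _ (norm_cpow_mul_lt_one hq0 hw)
  exact ((((differentiable_cpow_ofReal hq0).const_mul _).mul hS) s).div
    ((((hp a).mul (hp b)).mul (hp f)).mul (hp g) s)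
    (mul_ne_zero (mul_ne_zero (mul_ne_zero (qPochInf_cpow_add_ne_zero hq0 hq1 h1)
      (qPochInf_cpow_add_ne_zero hq0 hq1 h2)) (qPochInf_cpow_add_ne_zero hq0 hq1 h3))
      (qPochInf_cpow_add_ne_zero hq0 hq1 h4))

theorem differentiableAt_barnesReg (hq0 : 0 < q) (hq1 : q < 1)
    (hw : ‖(q : ℂ) ^ (c + d + f + g)‖ < 1) {s : ℂ}
    (hs : s ∉ (decreasingPoles q a ∪ decreasingPoles q b ∪ decreasingPoles q f ∪
      decreasingPoles q g) ∪ (increasingPoles c ∪ increasingPoles d)) :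
    DifferentiableAt ℂ (barnesReg q a b c d e f g) s := by
  rw [mem_union, not_or] at hs
  have hs2 := not_or.1 hs.2
  exact ((differentiableAt_sineQuot hq0 hq1 hs2.1).mul
    (differentiableAt_sineQuot hq0 hq1 hs2.2)).mul (differentiableAt_barnesReg_factor hq0 hq1 hw hs.1)

theorem meromorphicAt_barnesReg (hq0 : 0 < q) (hq1 : q < 1)
    (hw : ‖(q : ℂ) ^ (c + d + f + g)‖ < 1) (s : ℂ) :
    MeromorphicAt (barnesReg q a b c d e f g) s := by
  have hp := differentiable_qPochInf_cpow hq0 hq1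
  have hS := differentiable_barnesSeries_cpow hq0 hq1 ((q : ℂ) ^ a) ((q : ℂ) ^ b) _ _ ((q : ℂ) ^ e)
    _ _ (norm_cpow_mul_lt_one hq0 hw)
  exact ((meromorphicAt_sineQuot hq0 hq1 c s).mul (meromorphicAt_sineQuot hq0 hq1 d s)).mul
    ((((((differentiable_cpow_ofReal hq0).const_mul _).mul hS).analyticAt s).meromorphicAt).div
    ((((hp a).mul (hp b)).mul (hp f)).mul (hp g) |>.analyticAt s).meromorphicAt)

theorem barnesSeries_swap (q A B C D E F G x : ℂ) :
    barnesSeries q A B D C E F G x = barnesSeries q A B C D E F G x := by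
  rw [barnesSeries, barnesSeries, show A * B * D * C * F * x = A * B * C * D * F * x by ring,
    mul_comm D C]

theorem barnesCore_swap (q A B C D E F G x : ℂ) :
    barnesCore q A B D C E F G x = barnesCore q A B C D E F G x := by
  rw [barnesCore_eq, barnesCore_eq, barnesSeries_swap, mul_comm (qPochInf q (q * x / D))]

theorem barnesReg_swap (s : ℂ) : barnesReg q a b d c e f g s = barnesReg q a b c d e f g s := by
  rw [barnesReg, barnesReg, barnesSeries_swap, mul_comm (sineQuot q d s)]

theorem tendsto_sub_mul_barnesReg (hq0 : 0 < q) (hq1 : q < 1)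
    (hw : ‖(q : ℂ) ^ (c + d + f + g)‖ < 1) (hcd : ∀ k : ℤ, c - d ≠ k) (n : ℕ)
    (hs : c + n ∉ decreasingPoles q a ∪ decreasingPoles q b ∪ decreasingPoles q f ∪
      decreasingPoles q g) :
    Tendsto (fun s => (s - (c + n)) * barnesReg q a b c d e f g s) (𝓝[≠] (c + n))
      (𝓝 (-((q : ℂ) ^ (c + n) * barnesCore q ((q : ℂ) ^ a) ((q : ℂ) ^ b) ((q : ℂ) ^ c)
        ((q : ℂ) ^ d) ((q : ℂ) ^ e) ((q : ℂ) ^ f) ((q : ℂ) ^ g) ((q : ℂ) ^ (c + n)) /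
        Complex.sin (Real.pi * (d - c))))) := by
  have hd : c + n ∉ increasingPoles d := by
    rintro ⟨m, hm⟩
    exact hcd (m - n) (by push_cast; linear_combination hm)
  have h1 := tendsto_sub_mul_sineQuot hq0 hq1 c n
  have h2 := (differentiableAt_sineQuot hq0 hq1 hd).continuousAt.tendsto.mono_left
    (nhdsWithin_le_nhds (s := {c + (n : ℂ)}ᶜ))
  have h3 := (differentiableAt_barnesReg_factor (c := c) (d := d) (e := e) hq0 hq1 hw
    hs).continuousAt.tendsto.mono_left (nhdsWithin_le_nhds (s := {c + (n : ℂ)}ᶜ))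
  have h4 := (h1.mul h2).mul h3
  rw [sineQuot_add_nat hcd] at h4
  have hpi : (Real.pi : ℂ) ≠ 0 := by exact_mod_cast Real.pi_ne_zero
  convert h4 using 2
  · rw [barnesReg]
    ring
  · rw [barnesCore_eq, cpow_one_sub_add hq0,
      cpow_one_sub_add hq0, cpow_add_ofReal hq0 a, cpow_add_ofReal hq0 b, cpow_add_ofReal hq0 f,
      cpow_add_ofReal hq0 g]
    generalize (q : ℂ) ^ (c + (n : ℂ)) = x
    have hm : ((-1 : ℂ) ^ n) * (-1) ^ n = 1 := by rw [← mul_pow]; simp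
    field_simp
    rcases neg_one_pow_eq_or ℂ n with h | h <;> rw [h] <;> ring

end RegularisedIntegrand

/-! ### The contour integral as a difference of Jackson sums -/

section ContourIntegral

open Filter Topology Set MeasureTheory

variable {q : ℝ} {a b c d e f g : ℂ}

theorem norm_cpow_ofReal (hq0 : 0 < q) (s : ℂ) : ‖(q : ℂ) ^ s‖ = q ^ s.re :=
  Complex.norm_cpow_eq_rpow_re_of_pos hq0 s

theorem norm_barnesReg_le (hq0 : 0 < q) {s : ℂ} {K : ℝ}
    (hc : Complex.sin (Real.pi * (c - s)) ≠ 0) (hd : Complex.sin (Real.pi * (d - s)) ≠ 0)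
    (hK : ‖barnesCore q ((q : ℂ) ^ a) ((q : ℂ) ^ b) ((q : ℂ) ^ c) ((q : ℂ) ^ d) ((q : ℂ) ^ e)
      ((q : ℂ) ^ f) ((q : ℂ) ^ g) ((q : ℂ) ^ s)‖ ≤ K) :
    ‖barnesReg q a b c d e f g s‖ ≤ Real.pi * q ^ s.re * K *
      ‖(Complex.sin (Real.pi * (c - s)) * Complex.sin (Real.pi * (d - s)))⁻¹‖ := by
  rw [barnesReg_eq_barnesCore hq0 hc hd, div_eq_mul_inv, norm_mul, norm_mul, norm_mul,
    norm_cpow_ofReal hq0, Complex.norm_real, Real.norm_of_nonneg Real.pi_pos.le]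
  gcongr

theorem norm_inv_sin_mul_sin_le {y : ℝ} {s : ℂ} (hy : |s.im| = y) (hy0 : 0 < y)
    (hc : 2 * |c.im| ≤ y) (hd : 2 * |d.im| ≤ y) :
    Complex.sin (Real.pi * (c - s)) ≠ 0 ∧ Complex.sin (Real.pi * (d - s)) ≠ 0 ∧
    ‖(Complex.sin (Real.pi * (c - s)) * Complex.sin (Real.pi * (d - s)))⁻¹‖ ≤ 4 / y ^ 2 := by
  have key : ∀ c : ℂ, 2 * |c.im| ≤ y → y / 2 ≤ ‖Complex.sin (Real.pi * (c - s))‖ := by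
    intro c hc
    refine le_trans ?_ (abs_im_le_norm_sin _)
    rw [Complex.sub_im, abs_sub_comm]
    linarith [abs_sub_abs_le_abs_sub s.im c.im]
  have hc' := key c hc
  have hd' := key d hd
  have hy2 : 0 < y / 2 := by linarith
  refine ⟨norm_pos_iff.1 (hy2.trans_le hc'), norm_pos_iff.1 (hy2.trans_le hd'), ?_⟩
  rw [norm_inv, norm_mul]
  calc (‖Complex.sin (Real.pi * (c - s))‖ * ‖Complex.sin (Real.pi * (d - s))‖)⁻¹
      ≤ (y / 2 * (y / 2))⁻¹ := by gcongr
    _ = 4 / y ^ 2 := by field_simp; norm_num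

/-- Both `x - 1/3` and `x - 2/3` meet the first condition; they are incongruent modulo 1, so `y`
rules out at most one. -/
theorem exists_forall_sub_ne_int (x y : ℝ) :
    ∃ θ : ℝ, (∀ k : ℤ, x - θ ≠ k) ∧ ∀ k : ℤ, y - θ ≠ k := by
  have hfrac : ∀ k m : ℤ, ∀ r : ℝ, 0 < r → r < 1 → (k : ℝ) - m ≠ r := by
    intro k m r h0 h1 h
    have h2 : (0 : ℤ) < k - m := by exact_mod_cast (by rw [Int.cast_sub, h]; exact h0 :
      (0 : ℝ) < ((k - m : ℤ) : ℝ))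
    have h3 : k - m < 1 := by exact_mod_cast (by rw [Int.cast_sub, h]; exact_mod_cast h1 :
      ((k - m : ℤ) : ℝ) < ((1 : ℤ) : ℝ))
    omega
  by_cases h : ∃ k : ℤ, y - (x - 1 / 3) = k
  · obtain ⟨k, hk⟩ := h
    refine ⟨x - 2 / 3, fun m hm => hfrac m 0 (2 / 3) (by norm_num) (by norm_num) ?_,
      fun m hm => hfrac m k (1 / 3) (by norm_num) (by norm_num) ?_⟩
    · rw [← hm]; norm_num
    · rw [← hm, ← hk]; ring
  · refine ⟨x - 1 / 3, fun m hm => hfrac m 0 (1 / 3) (by norm_num) (by norm_num) ?_,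
      fun m hm => h ⟨m, hm⟩⟩
    rw [← hm]; norm_num

theorem sin_pi_mul_ne_zero_of_re {w : ℂ} (h : ∀ k : ℤ, w.re ≠ k) :
    Complex.sin (Real.pi * w) ≠ 0 := fun h0 => by
  obtain ⟨k, hk⟩ := sin_pi_mul_eq_zero_iff.1 h0
  exact h k (by rw [hk]; simp)

theorem summable_jackson {C : ℂ} {Q : ℂ} (hQ : ‖Q‖ < 1) {h : ℂ → ℂ} {ρ K : ℝ} (hρ : 0 < ρ)
    (hK : ∀ x, ‖x‖ ≤ ρ → ‖h x‖ ≤ K) : Summable fun n : ℕ => C * Q ^ n * h (C * Q ^ n) := by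
  refine Summable.of_norm_bounded_eventually_nat
    ((summable_geometric_of_lt_one (norm_nonneg Q) hQ).mul_left (‖C‖ * K)) ?_
  have h1 : Tendsto (fun n : ℕ => ‖C * Q ^ n‖) atTop (𝓝 0) := by
    have := ((tendsto_pow_atTop_nhds_zero_of_norm_lt_one hQ).const_mul C).norm
    simpa only [mul_zero, norm_zero] using this
  filter_upwards [h1.eventually_le_const hρ] with n hn
  rw [norm_mul, norm_mul, norm_pow, mul_right_comm]
  have := hK _ hn
  gcongr

/-- The sum of the residues at the increasing poles to the left of the line `Re s = M`. -/
theorem sum_increasingPoles (hcd : ∀ k : ℤ, c - d ≠ k) (M : ℝ) :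
    ∃ S : Finset ℂ, (∀ p, p ∈ S ↔ p ∈ increasingPoles c ∪ increasingPoles d ∧ p.re < M) ∧
      ∀ r : ℂ → ℂ, ∑ p ∈ S, r p = ∑ n ∈ Finset.range ⌈M - c.re⌉₊, r (c + n) +
        ∑ n ∈ Finset.range ⌈M - d.re⌉₊, r (d + n) := by
  classical
  -- `c + n` lies before the line exactly when `n < M - c.re`, that is, `n < ⌈M - c.re⌉₊`.
  refine ⟨(Finset.range ⌈M - c.re⌉₊).image (fun n : ℕ => c + n) ∪
    (Finset.range ⌈M - d.re⌉₊).image (fun n : ℕ => d + n), fun p => ?_, fun r => ?_⟩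
  · have key : ∀ c : ℂ, p ∈ (Finset.range ⌈M - c.re⌉₊).image (fun n : ℕ => c + (n : ℂ)) ↔
        p ∈ increasingPoles c ∧ p.re < M := by
      intro c
      simp only [Finset.mem_image, Finset.mem_range, Nat.lt_ceil]
      constructor
      · rintro ⟨n, hn, rfl⟩
        exact ⟨⟨n, rfl⟩, by simp; linarith⟩
      · rintro ⟨⟨n, rfl⟩, hn⟩
        exact ⟨n, by simp at hn; linarith, rfl⟩
    rw [Finset.mem_union, key, key, mem_union, or_and_right]
  · rw [Finset.sum_union, Finset.sum_image, Finset.sum_image]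
    · intro m _ n _ h
      simpa using h
    · intro m _ n _ h
      simpa using h
    · rw [Finset.disjoint_left]
      intro p h1 h2
      obtain ⟨m, -, rfl⟩ := Finset.mem_image.1 h1
      obtain ⟨n, -, h⟩ := Finset.mem_image.1 h2
      exact hcd (n - m) (by push_cast; linear_combination -h)

theorem continuous_inv_sin_mul_sin {θ : ℝ} (hc : ∀ k : ℤ, c.re - θ ≠ k)
    (hd : ∀ k : ℤ, d.re - θ ≠ k) :
    Continuous fun t : ℝ => (Complex.sin (Real.pi * (c - (θ + t * Complex.I))) *
      Complex.sin (Real.pi * (d - (θ + t * Complex.I))))⁻¹ := by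
  refine Continuous.inv₀ (by fun_prop) fun t => mul_ne_zero ?_ ?_
  · exact sin_pi_mul_ne_zero_of_re fun k => by simpa using hc k
  · exact sin_pi_mul_ne_zero_of_re fun k => by simpa using hd k

theorem integrable_inv_sin_mul_sin {θ : ℝ} (hc : ∀ k : ℤ, c.re - θ ≠ k)
    (hd : ∀ k : ℤ, d.re - θ ≠ k) :
    Integrable fun t : ℝ => (Complex.sin (Real.pi * (c - (θ + t * Complex.I))) *
      Complex.sin (Real.pi * (d - (θ + t * Complex.I))))⁻¹ := by
  have hcont := continuous_inv_sin_mul_sin hc hd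
  set T : ℝ := 1 + 2 * |c.im| + 2 * |d.im| with hT
  have h1 := abs_nonneg c.im
  have h2 := abs_nonneg d.im
  obtain ⟨B, hB⟩ := (isCompact_Icc (a := -T) (b := T)).exists_bound_of_continuousOn
    hcont.continuousOn
  refine integrable_of_le_div_sq hcont.aestronglyMeasurable (T := T) (C := B) (K := 4)
    (by linarith) (fun t ht => hB t (abs_le.1 ht)) fun t ht => ?_
  have := (norm_inv_sin_mul_sin_le (c := c) (d := d) (s := θ + t * Complex.I) (y := |t|)
    (by simp) (by linarith) (by linarith) (by linarith)).2.2
  rwa [sq_abs] at this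

/-- The contour integral as a difference of two Jackson integrals. -/
theorem integral_barnesReg (hq0 : 0 < q) (hq1 : q < 1) (hw : ‖(q : ℂ) ^ (c + d + f + g)‖ < 1)
    (hcd : ∀ k : ℤ, c - d ≠ k) {γ : ℝ → ℂ} (hγ : IsBarnesContour γ)
    (hleft : ∀ p ∈ decreasingPoles q a ∪ decreasingPoles q b ∪ decreasingPoles q f ∪
      decreasingPoles q g, LiesLeftOf γ p)
    (hright : ∀ p ∈ increasingPoles c ∪ increasingPoles d, LiesRightOf γ p) :
    Integrable (fun t : ℝ => barnesReg q a b c d e f g (γ t) * deriv γ t) ∧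
    ∫ t : ℝ, barnesReg q a b c d e f g (γ t) * deriv γ t =
      2 * Real.pi * Complex.I / Complex.sin (Real.pi * (d - c)) *
      (jacksonSum q ((q : ℂ) ^ c) (barnesCore q ((q : ℂ) ^ a) ((q : ℂ) ^ b) ((q : ℂ) ^ c)
          ((q : ℂ) ^ d) ((q : ℂ) ^ e) ((q : ℂ) ^ f) ((q : ℂ) ^ g)) -
        jacksonSum q ((q : ℂ) ^ d) (barnesCore q ((q : ℂ) ^ a) ((q : ℂ) ^ b) ((q : ℂ) ^ c)
          ((q : ℂ) ^ d) ((q : ℂ) ^ e) ((q : ℂ) ^ f) ((q : ℂ) ^ g))) := by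
  set F := barnesReg q a b c d e f g with hF
  set PL := decreasingPoles q a ∪ decreasingPoles q b ∪ decreasingPoles q f ∪
      decreasingPoles q g with hPL
  set PR := increasingPoles c ∪ increasingPoles d with hPR
  set core := barnesCore q ((q : ℂ) ^ a) ((q : ℂ) ^ b) ((q : ℂ) ^ c)
          ((q : ℂ) ^ d) ((q : ℂ) ^ e) ((q : ℂ) ^ f) ((q : ℂ) ^ g) with hcore
  have hQ := norm_ofReal_lt_one hq0 hq1
  have hreg := hγ.isRegularCurve
  obtain ⟨σ₁, σ₂, T₁, hv₁⟩ := hγ.exists_isVerticalOutside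
  -- Beyond this height the curve is vertical, there are no increasing poles, and the bound
  -- `norm_inv_sin_mul_sin_le` applies.
  set T₀ : ℝ := max T₁ (1 + 2 * |c.im| + 2 * |d.im|) with hT₀
  have hv := hv₁.mono (le_max_left T₁ (1 + 2 * |c.im| + 2 * |d.im|))
  rw [← hT₀] at hv
  have hcim := abs_nonneg c.im
  have hdim := abs_nonneg d.im
  have hT1 : 1 + 2 * |c.im| + 2 * |d.im| ≤ T₀ := le_max_right _ _
  set σ : ℝ := min σ₁ σ₂ with hσ
  -- position of the poles
  have hdisj : ∀ p ∈ PR, p ∉ PL := fun p hp hp' =>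
    not_liesLeftOf_and_liesRightOf (hleft p hp') (hright p hp)
  have hLre : ∀ p ∈ PL, p.re < σ₁ ∧ p.re < σ₂ := by
    rintro p (((hp | hp) | hp) | hp)
    · exact re_decreasingPole_lt hq0 hq1 hv hreg
        (fun p hp => hleft p (Or.inl (Or.inl (Or.inl hp)))) hp
    · exact re_decreasingPole_lt hq0 hq1 hv hreg
        (fun p hp => hleft p (Or.inl (Or.inl (Or.inr hp)))) hp
    · exact re_decreasingPole_lt hq0 hq1 hv hreg
        (fun p hp => hleft p (Or.inl (Or.inr hp))) hp
    · exact re_decreasingPole_lt hq0 hq1 hv hreg (fun p hp => hleft p (Or.inr hp)) hp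
  have hneg : ∀ x : ℂ, -x ∈ decreasingPoles q x := fun x => ⟨0, 0, by simp⟩
  -- The pole `-x` has real part below `σ`; this is the condition for the core to be bounded on `σ ≤
  -- Re s`.
  have hdisc : ∀ x : ℂ, decreasingPoles q x ⊆ PL → ‖(q : ℂ) ^ x‖ * q ^ σ < 1 := by
    intro x hx
    have h1 := hLre _ (hx (hneg x))
    have h2 : -x.re < σ := lt_min h1.1 h1.2
    rw [norm_cpow_ofReal hq0, ← Real.rpow_add hq0]
    exact Real.rpow_lt_one hq0.le hq1 (by linarith)
  obtain ⟨K, hK⟩ := exists_norm_barnesCore_le (A := (q : ℂ) ^ a) (B := (q : ℂ) ^ b)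
    (E := (q : ℂ) ^ e) hQ (norm_cpow_mul_lt_one hq0 hw)
    (hdisc a fun p hp => Or.inl (Or.inl (Or.inl hp)))
    (hdisc b fun p hp => Or.inl (Or.inl (Or.inr hp))) (hdisc f fun p hp => Or.inl (Or.inr hp))
    (hdisc g fun p hp => Or.inr hp)
  have hρ : 0 < q ^ σ := Real.rpow_pos_of_pos hq0 σ
  have hK0 : 0 ≤ K := (norm_nonneg _).trans (hK 0 (by simpa using hρ.le))
  have hKs : ∀ s : ℂ, σ ≤ s.re → ‖core ((q : ℂ) ^ s)‖ ≤ K := fun s hs => hK _ <| by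
    rw [norm_cpow_ofReal hq0]
    exact Real.rpow_le_rpow_of_exponent_ge hq0 hq1.le hs
  have hdiff : ∀ z ∉ PL ∪ PR, DifferentiableAt ℂ F z := fun z hz =>
    differentiableAt_barnesReg hq0 hq1 hw hz
  -- decay
  set B : ℝ → ℝ := fun y => Real.pi * q ^ σ * K * (4 / y ^ 2) with hBdef
  have hFB : ∀ s : ℂ, σ ≤ s.re → T₀ ≤ |s.im| → ‖F s‖ ≤ B |s.im| := by
    intro s hs hT
    obtain ⟨h1, h2, h3⟩ := norm_inv_sin_mul_sin_le (c := c) (d := d) (s := s) rfl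
      (by linarith) (by linarith) (by linarith)
    refine (norm_barnesReg_le hq0 h1 h2 (hKs s hs)).trans ?_
    have h4 : q ^ s.re ≤ q ^ σ := Real.rpow_le_rpow_of_exponent_ge hq0 hq1.le hs
    have h5 := Real.pi_pos
    simp only [hBdef]
    gcongr
  have hB : Tendsto B atTop (𝓝 0) := by
    have h1 : Tendsto (fun y : ℝ => 4 / y ^ 2) atTop (𝓝 0) :=
      tendsto_const_nhds.div_atTop (tendsto_pow_atTop (by norm_num))
    simpa using h1.const_mul (Real.pi * q ^ σ * K)
  -- integrability along the contour
  have hγi : Integrable fun t : ℝ => F (γ t) * deriv γ t := by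
    have hcont : Continuous fun t => F (γ t) := by
      refine continuous_iff_continuousAt.2 fun t => ?_
      refine ContinuousAt.comp (hdiff _ ?_).continuousAt hreg.continuous.continuousAt
      rintro (hp | hp)
      · exact (hleft _ hp).1 (mem_range_self t)
      · exact (hright _ hp).1 (mem_range_self t)
    obtain ⟨L, hL⟩ := hreg.lipschitz
    have hL' : ∀ t, ‖deriv γ t‖ ≤ L := fun t => norm_deriv_le_of_lipschitz hL
    obtain ⟨C, hC⟩ := (isCompact_Icc (a := -T₀) (b := T₀)).exists_bound_of_continuousOn
      hcont.continuousOn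
    refine integrable_of_le_div_sq (T := T₀) (C := C * L) (K := Real.pi * q ^ σ * K * 4 * L)
      (hcont.aestronglyMeasurable.mul (measurable_deriv γ).aestronglyMeasurable) (by linarith)
      (fun t ht => ?_) fun t ht => ?_
    · rw [norm_mul]
      exact mul_le_mul (hC t (abs_le.1 ht)) (hL' t) (norm_nonneg _)
        ((norm_nonneg _).trans (hC t (abs_le.1 ht)))
    · have hre : σ ≤ (γ t).re ∧ (γ t).im = t := by
        rcases le_abs'.1 ht with ht | ht
        · have := hv.bot (-t) (by linarith)
          rw [neg_neg] at this
          rw [this]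
          simp [hσ]
        · rw [hv.top t ht]
          simp [hσ]
      have h1 := hFB (γ t) hre.1 (by rwa [hre.2])
      rw [hre.2] at h1
      rw [norm_mul]
      refine (mul_le_mul h1 (hL' t) (norm_nonneg _) ((norm_nonneg _).trans h1)).trans_eq ?_
      simp only [hBdef, sq_abs]
      ring
  refine ⟨hγi, ?_⟩
  -- residues
  have hsin : Complex.sin (Real.pi * (d - c)) ≠ 0 := fun h0 => by
    obtain ⟨k, hk⟩ := sin_pi_mul_eq_zero_iff.1 h0
    exact hcd (-k) (by push_cast; linear_combination -hk)
  classical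
  -- The residues have opposite signs at the two sequences, since exchanging `c` and `d` changes the
  -- sign of `sin π(d - c)`. The sequences are disjoint because `c - d` is not an integer.
  set r : ℂ → ℂ := fun p => (if p ∈ increasingPoles c then -1 else 1) *
    ((q : ℂ) ^ p * core ((q : ℂ) ^ p) / Complex.sin (Real.pi * (d - c))) with hr
  have hdc : ∀ k : ℤ, d - c ≠ k := fun k hk =>
    hcd (-k) (by push_cast; linear_combination -hk)
  have hrc : ∀ n : ℕ, r (c + n) =
      -((q : ℂ) ^ (c + n) * core ((q : ℂ) ^ (c + n)) / Complex.sin (Real.pi * (d - c))) :=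
    fun n => by simp only [hr, if_pos (show c + (n : ℂ) ∈ increasingPoles c from ⟨n, rfl⟩)]; ring
  have hrd : ∀ n : ℕ, r (d + n) =
      (q : ℂ) ^ (d + n) * core ((q : ℂ) ^ (d + n)) / Complex.sin (Real.pi * (d - c)) := by
    intro n
    have : d + (n : ℂ) ∉ increasingPoles c := by
      rintro ⟨m, hm⟩
      exact hcd (n - m) (by push_cast; linear_combination -hm)
    simp only [hr, if_neg this, one_mul]
  have hres : ∀ p ∈ PR, Tendsto (fun z => (z - p) * F z) (𝓝[≠] p) (𝓝 (r p)) := by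
    intro p hp
    have hpL := hdisj p hp
    rcases hp with ⟨n, rfl⟩ | ⟨n, rfl⟩
    · rw [hrc]
      exact tendsto_sub_mul_barnesReg hq0 hq1 hw hcd n hpL
    · rw [hrd]
      have hw' : ‖(q : ℂ) ^ (d + c + f + g)‖ < 1 := by rwa [add_comm d c]
      have := tendsto_sub_mul_barnesReg (e := e) hq0 hq1 hw' hdc n hpL
      simp only [barnesReg_swap, barnesCore_swap] at this
      rw [show (Real.pi : ℂ) * (c - d) = -(Real.pi * (d - c)) by ring, Complex.sin_neg, div_neg,
        neg_neg] at this
      exact this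
  have hfin : ∀ R : ℝ, ((PL ∪ PR) ∩ Metric.ball 0 R).Finite := by
    intro R
    simp only [hPL, hPR, union_inter_distrib_right]
    exact ((((finite_decreasingPoles_inter_ball hq0 hq1 a R).union
      (finite_decreasingPoles_inter_ball hq0 hq1 b R)).union
      (finite_decreasingPoles_inter_ball hq0 hq1 f R)).union
      (finite_decreasingPoles_inter_ball hq0 hq1 g R)).union
      ((finite_increasingPoles_inter_ball c R).union (finite_increasingPoles_inter_ball d R))
  -- the vertical lines
  obtain ⟨θ, hθc, hθd⟩ := exists_forall_sub_ne_int c.re d.re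
  have hθcN : ∀ (N : ℕ) (k : ℤ), c.re - (θ + N) ≠ k := fun N k hk =>
    hθc (k + N) (by push_cast; linarith)
  have hθdN : ∀ (N : ℕ) (k : ℤ), d.re - (θ + N) ≠ k := fun N k hk =>
    hθd (k + N) (by push_cast; linarith)
  have hJ := integrable_inv_sin_mul_sin (c := c) (d := d) hθc hθd
  set j : ℝ → ℂ := fun t => (Complex.sin (Real.pi * (c - (θ + t * Complex.I))) *
      Complex.sin (Real.pi * (d - (θ + t * Complex.I))))⁻¹ with hj
  have hM : Tendsto (fun N : ℕ => θ + (N : ℝ)) atTop atTop :=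
    tendsto_atTop_add_const_left _ _ tendsto_natCast_atTop_atTop
  -- Moving from `θ` to `θ + N` changes each sine only by the sign `(-1) ^ N`. One integrable
  -- function `j` thus serves all lines, and `q ^ (θ + N)` sends the integrals to 0.
  have hline : ∀ N : ℕ, σ₁ < θ + N → σ₂ < θ + N → ∀ t : ℝ,
      ‖F ((θ + N : ℝ) + t * Complex.I)‖ ≤ Real.pi * q ^ (θ + N) * K * ‖j t‖ := by
    intro N h1 h2 t
    have hs : ∀ w : ℂ, Complex.sin (Real.pi * (w - ((θ + N : ℝ) + t * Complex.I))) =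
        (-1) ^ N * Complex.sin (Real.pi * (w - (θ + t * Complex.I))) := by
      intro w
      rw [← sin_sub_nat_mul_pi]
      congr 1
      push_cast
      ring
    have hn := norm_barnesReg_le (a := a) (b := b) (e := e) (f := f) (g := g)
      (s := (θ + N : ℝ) + t * Complex.I) hq0
      (sin_pi_mul_ne_zero_of_re (w := c - ((θ + N : ℝ) + t * Complex.I))
        fun k => by simpa using hθcN N k)
      (sin_pi_mul_ne_zero_of_re (w := d - ((θ + N : ℝ) + t * Complex.I))
        fun k => by simpa using hθdN N k)
      (hKs _ (by simpa [hσ] using Or.inl h1.le))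
    have hre : (((θ + N : ℝ) : ℂ) + t * Complex.I).re = θ + N := by simp
    have hnorm : ‖(Complex.sin (Real.pi * (c - ((θ + N : ℝ) + t * Complex.I))) *
        Complex.sin (Real.pi * (d - ((θ + N : ℝ) + t * Complex.I))))⁻¹‖ = ‖j t‖ := by
      rw [hs, hs]
      simp [hj]
    rw [hre, hnorm] at hn
    exact hn
  have hint : ∀ N : ℕ, σ₁ < θ + N → σ₂ < θ + N →
      Integrable fun t : ℝ => F ((θ + N : ℝ) + t * Complex.I) := by
    intro N h1 h2
    have hcont : Continuous fun t : ℝ => F ((θ + N : ℝ) + t * Complex.I) := by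
      refine continuous_iff_continuousAt.2 fun t => ?_
      refine ContinuousAt.comp (f := fun t : ℝ => ((θ + N : ℝ) : ℂ) + t * Complex.I)
        (hdiff _ ?_).continuousAt (by fun_prop)
      rintro (hp | ⟨n, hp⟩ | ⟨n, hp⟩)
      · have := (hLre _ hp).1
        simp at this
        linarith
      · exact hθcN N (-n) (by have := congrArg Complex.re hp; simp at this; push_cast; linarith)
      · exact hθdN N (-n) (by have := congrArg Complex.re hp; simp at this; push_cast; linarith)
    exact (hJ.norm.const_mul _).mono' hcont.aestronglyMeasurable
      (Eventually.of_forall (hline N h1 h2))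
  -- the identity for each line
  set Sc : ℕ → ℂ := fun n => (q : ℂ) ^ c * (q : ℂ) ^ n * core ((q : ℂ) ^ c * (q : ℂ) ^ n) with hSc
  set Sd : ℕ → ℂ := fun n => (q : ℂ) ^ d * (q : ℂ) ^ n * core ((q : ℂ) ^ d * (q : ℂ) ^ n) with hSd
  have hid : ∀ᶠ N : ℕ in atTop, (∫ t : ℝ, F ((θ + N : ℝ) + t * Complex.I)) * Complex.I +
      2 * Real.pi * Complex.I / Complex.sin (Real.pi * (d - c)) *
      (∑ n ∈ Finset.range ⌈θ + N - c.re⌉₊, Sc n - ∑ n ∈ Finset.range ⌈θ + N - d.re⌉₊, Sd n) =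
      ∫ t : ℝ, F (γ t) * deriv γ t := by
    filter_upwards [hM.eventually_gt_atTop σ₁, hM.eventually_gt_atTop σ₂] with N h1 h2
    obtain ⟨S, hS, hsum⟩ := sum_increasingPoles hcd (θ + N)
    rw [hv.integral_eq hreg h1 h2 (r := r)
      (fun p hp => ⟨hleft p hp, (hLre p hp).1, (hLre p hp).2, meromorphicAt_barnesReg hq0 hq1 hw p⟩)
      (fun p hp => ⟨hright p hp, ?_, ?_, hres p hp⟩) hfin hdiff hS hγi (hint N h1 h2) hB hFB,
      hsum r]
    · simp only [hrc, hrd, hSc, hSd, cpow_add_ofReal hq0, Complex.cpow_natCast,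
        Finset.sum_neg_distrib, ← Finset.sum_div]
      ring
    · rcases hp with ⟨n, rfl⟩ | ⟨n, rfl⟩
      · simp; linarith
      · simp; linarith
    · rcases hp with ⟨n, rfl⟩ | ⟨n, rfl⟩
      · exact fun h => hθcN N (-n) (by simp at h; push_cast; linarith)
      · exact fun h => hθdN N (-n) (by simp at h; push_cast; linarith)
  -- the limit
  have l1 : Tendsto (fun N : ℕ => ∫ t : ℝ, F ((θ + N : ℝ) + t * Complex.I)) atTop (𝓝 0) := by
    have hz : Tendsto (fun N : ℕ => Real.pi * q ^ (θ + N) * K * ∫ t, ‖j t‖) atTop (𝓝 0) := by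
      have h1 : Tendsto (fun N : ℕ => q ^ (θ + N)) atTop (𝓝 0) :=
        (tendsto_rpow_atTop_of_base_lt_one q (by linarith) hq1).comp hM
      simpa using ((h1.const_mul Real.pi).mul_const K).mul_const (∫ t, ‖j t‖)
    refine squeeze_zero_norm' ?_ hz
    filter_upwards [hM.eventually_gt_atTop σ₁, hM.eventually_gt_atTop σ₂] with N h1 h2
    rw [← integral_const_mul]
    exact norm_integral_le_of_norm_le (hJ.norm.const_mul _)
      (Eventually.of_forall (hline N h1 h2))
  have l2 : ∀ (x : ℂ), Tendsto (fun N : ℕ => ∑ n ∈ Finset.range ⌈θ + N - x.re⌉₊,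
      (q : ℂ) ^ x * (q : ℂ) ^ n * core ((q : ℂ) ^ x * (q : ℂ) ^ n)) atTop
      (𝓝 (jacksonSum q ((q : ℂ) ^ x) core)) := fun x =>
    (summable_jackson hQ hρ hK).hasSum.tendsto_sum_nat.comp
      (tendsto_nat_ceil_atTop.comp (tendsto_atTop_add_const_right _ (-x.re) hM))
  have l3 := (l1.mul_const Complex.I).add (((l2 c).sub (l2 d)).const_mul
    (2 * Real.pi * Complex.I / Complex.sin (Real.pi * (d - c))))
  rw [zero_mul, zero_add] at l3
  exact tendsto_nhds_unique (tendsto_const_nhds.congr' (hid.mono fun _ h => h.symm)) l3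

end ContourIntegral

/-! ### The remaining series and the main theorem -/

section Evaluation

theorem tsum_eq_mul_phi32 {q E U V X Y z : ℂ} (hq : ‖q‖ < 1) (hU : qPochInf q U ≠ 0)
    (hV : qPochInf q V ≠ 0) (hX : qPochInf q X ≠ 0) (hY : qPochInf q Y ≠ 0) :
    ∑' n, qPoch q E n / qPoch q q n * (qPochInf q (X * q ^ n) /
      (qPochInf q (U * q ^ n) * qPochInf q (V * q ^ n)) * qPochInf q (Y * q ^ n)) * z ^ n =
    qPochInf q X * qPochInf q Y / (qPochInf q U * qPochInf q V) * phi32 q E U V Y X z := by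
  rw [phi32, ← tsum_mul_left]
  refine tsum_congr fun n => ?_
  rw [qPochInf_mul_pow_eq_div hq hU, qPochInf_mul_pow_eq_div hq hV,
    qPochInf_mul_pow_eq_div hq hX, qPochInf_mul_pow_eq_div hq hY]
  simp only [div_eq_mul_inv, mul_inv, inv_inv]
  ring

end Evaluation

theorem mainTheorem11 (q : ℝ) (hq0 : 0 < q) (hq1 : q < 1) (a b c d e f g : ℂ)
    (hf : ‖(q : ℂ) ^ f‖ < 1) (hg : ‖(q : ℂ) ^ g‖ < 1)
    (hcf : ‖(q : ℂ) ^ (c + f)‖ < 1) (hcg : ‖(q : ℂ) ^ (c + g)‖ < 1)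
    (hdf : ‖(q : ℂ) ^ (d + f)‖ < 1) (hdg : ‖(q : ℂ) ^ (d + g)‖ < 1)
    (hcdfg : ‖(q : ℂ) ^ (c + d + f + g)‖ < 1)
    -- the right-hand side is defined: no denominator in it vanishes
    (hsin : ∀ n : ℤ, c - d ≠ (n : ℂ))
    (hceg : ∀ n : ℕ, (q : ℂ) ^ (c + e + g) * (q : ℂ) ^ n ≠ 1)
    (habcd : ∀ n : ℕ, (q : ℂ) ^ (a + b + c + d) * (q : ℂ) ^ n ≠ 1)
    -- the contour separates the decreasing from the increasing sequences of poles
    (γ : ℝ → ℂ) (hγ : IsBarnesContour γ)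
    (hleft : ∀ p ∈ decreasingPoles q a ∪ decreasingPoles q b ∪ decreasingPoles q f ∪
      decreasingPoles q g, LiesLeftOf γ p)
    (hright : ∀ p ∈ increasingPoles c ∪ increasingPoles d, LiesRightOf γ p) :
    MeasureTheory.Integrable
        (fun t : ℝ => barnesIntegrand q a b c d e f g (γ t) * deriv γ t) ∧
      1 / (2 * (Real.pi : ℂ) * Complex.I) *
          ∫ t : ℝ, barnesIntegrand q a b c d e f g (γ t) * deriv γ t =
        (q : ℂ) ^ c / Complex.sin (Real.pi * (d - c)) *
          ((qPochInf q q * qPochInf q ((q : ℂ) ^ (1 + c - d)) * qPochInf q ((q : ℂ) ^ (d - c)) *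
              qPochInf q ((q : ℂ) ^ (a + b + c + d)) * qPochInf q ((q : ℂ) ^ (a + c + d + f)) *
              qPochInf q ((q : ℂ) ^ (b + c + d + f)) * qPochInf q ((q : ℂ) ^ (c + e + g))) /
            (qPochInf q ((q : ℂ) ^ (a + c)) * qPochInf q ((q : ℂ) ^ (a + d)) *
              qPochInf q ((q : ℂ) ^ (b + c)) * qPochInf q ((q : ℂ) ^ (b + d)) *
              qPochInf q ((q : ℂ) ^ (c + f)) * qPochInf q ((q : ℂ) ^ (c + g)) *
              qPochInf q ((q : ℂ) ^ (d + f)))) *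
          phi32 q ((q : ℂ) ^ e) ((q : ℂ) ^ (a + c)) ((q : ℂ) ^ (b + c))
            ((q : ℂ) ^ (c + e + g)) ((q : ℂ) ^ (a + b + c + d)) ((q : ℂ) ^ (d + g)) := by
  have hQ := norm_ofReal_lt_one hq0 hq1
  have hQ0 : (q : ℂ) ≠ 0 := by exact_mod_cast hq0.ne'
  obtain ⟨hint, hval⟩ := integral_barnesReg (e := e) hq0 hq1 hcdfg hsin hγ hleft hright
  have hae := ae_barnesIntegrand_eq hq0 hq1 a b c d e f g γ
  refine ⟨hint.congr (hae.mono fun t ht => ht.symm), ?_⟩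
  rw [MeasureTheory.integral_congr_ae hae, hval]
  -- Nonvanishing of these denominators comes from the contour: a zero would make `s` a decreasing
  -- pole, lying on both sides at once.
  have hpole : ∀ x s : ℂ, (∀ p ∈ decreasingPoles q x, LiesLeftOf γ p) → LiesRightOf γ s →
      qPochInf q ((q : ℂ) ^ x * (q : ℂ) ^ s) ≠ 0 := fun x s hx hs =>
    qPochInf_cpow_ne_zero hq0 hq1 fun h => not_liesLeftOf_and_liesRightOf (hx s h) hs
  have ha := fun p hp => hleft p (Or.inl (Or.inl (Or.inl hp)))
  have hb := fun p hp => hleft p (Or.inl (Or.inl (Or.inr hp)))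
  have hf' := fun p hp => hleft p (Or.inl (Or.inr hp))
  have hc : LiesRightOf γ c := hright c (Or.inl ⟨0, by simp⟩)
  have hd : LiesRightOf γ d := hright d (Or.inr ⟨0, by simp⟩)
  have hX : qPochInf q ((q : ℂ) ^ a * (q : ℂ) ^ b * (q : ℂ) ^ c * (q : ℂ) ^ d) ≠ 0 :=
    qPochInf_ne_zero hQ fun n => by simpa only [cpow_add_ofReal hq0] using habcd n
  have hY : qPochInf q ((q : ℂ) ^ e * (q : ℂ) ^ g * (q : ℂ) ^ c) ≠ 0 :=
    qPochInf_ne_zero hQ fun n => by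
      have := hceg n
      rwa [show c + e + g = e + g + c by ring, cpow_add_ofReal hq0, cpow_add_ofReal hq0] at this
  rw [jacksonSum_barnesCore_sub hQ0 hQ (by simp [Complex.cpow_eq_zero_iff, hQ0])
    (by simp [Complex.cpow_eq_zero_iff, hQ0]) (hpole a c ha hc) (hpole b c hb hc)
    (hpole f c hf' hc) (hpole a d ha hd) (hpole b d hb hd) (hpole f d hf' hd)
    (by rwa [← cpow_add_ofReal hq0, add_comm]) (by rwa [← cpow_add_ofReal hq0, add_comm])
    (norm_cpow_mul_lt_one hq0 hcdfg),
    tsum_eq_mul_phi32 hQ (hpole a c ha hc) (hpole b c hb hc) hX hY]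
  have e1 : (q : ℂ) ^ (1 + c - d) = q * (q : ℂ) ^ c / (q : ℂ) ^ d := by
    rw [← cpow_one_sub_add hq0]
    congr 1
    ring
  have e2 : (q : ℂ) ^ (d - c) = (q : ℂ) ^ d / (q : ℂ) ^ c := Complex.cpow_sub _ _ hQ0
  have e3 : (q : ℂ) ^ (c + e + g) = (q : ℂ) ^ e * (q : ℂ) ^ g * (q : ℂ) ^ c := by
    rw [cpow_add_ofReal hq0, cpow_add_ofReal hq0]; ring
  rw [e1, e2, e3, add_comm c f, add_comm c g, add_comm d f, add_comm d g]
  simp only [cpow_add_ofReal hq0]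
  have hpi : (2 * (Real.pi : ℂ) * Complex.I) ≠ 0 := by simp [Real.pi_ne_zero]
  rw [one_div_mul_eq_div, div_eq_iff hpi]
  simp only [div_eq_mul_inv, mul_inv]
  ring
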